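/- **Notation.** On $\mathbb R^3$ put $\langle\xi\rangle=\sqrt{2+|\xi|^2}$ (and $\langle t\rangle=\sqrt{2+t^2}$ for times), $\langle\nabla\rangle=\sqrt{2-\Delta}$, $U=|\nabla|\langle\nabla\rangle^{-1}$, $H=|\nabla|\langle\nabla\rangle$, all understood as Fourier multipliers on $L^2(\mathbb R^3;\mathbb C)$, and $J(t)=e^{-itH}xe^{itH}$. For $v\in L^2$ let $$\|v\|_{X(t)}=\|\langle\nabla\rangle v\|_{L^2}+\|J(t)v\|_{L^2}+\|(x\times\nabla)v\|_{L^2},$$ and say that $v$ has finite energy norm at time $t$ if $v\in H^1$, $J(t)v\in L^2$ and $(x\times\nabla)v\in L^2$. Let $\varphi$ be a smooth radial function on $\mathbb R^3$ with $\varphi=1$ on the unit ball and $\varphi$ supported in $\{|\xi|\le\frac{11}{10}\}$, let $\psi(\xi)=\varphi(\xi)-\varphi(2\xi)$, and for $N\in2^{\mathbb Z}$ let $v_N$ be defined by $\widehat{v_N}(\xi)=\psi(\xi/N)\widehat v(\xi)$. The Lorentz quasi-norm is $\|f\|_{L^{q,\alpha}}=\bigl\|\lambda\,|\{x:|f(x)|>\lambda\}|^{1/q}\bigr\|_{L^\alpha((0,\infty),\,d\lambda/\lambda)}$.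 **Lemma 3.2 (Decay).** There is an absolute constant $C$ such that, for every $t\ge0$ and every $v$ with finite energy norm at time $t$, one has $U^{-1}v\in L^2$ and: (i) $\|v\|_{L^6}\le C\langle t\rangle^{-1}\|v\|_{X(t)}$. (ii) There is a constant $C_\varphi$, depending only on $\varphi$, such that for every dyadic $0<N\le1$, every $t\ge 0$ and every $v\in L^2$ with $J(t)v\in L^2$, the function $U^{-1}v_N$ belongs to $L^2$ and $$\|U^{-1}v_N\|_{L^{6,2}}\le C_\varphi\min\bigl\{N,\;N^{1/3}t^{-2/3},\;N^{-2/3}t^{-1}\bigr\}\,\|J(t)v\|_{L^2}$$ (for $t=0$ the minimum is $N$). Consequently, for every $t\ge0$ and every $v$ with finite energy norm at time $t$, $\|U^{-1}v\|_{L^6}\le C\langle t\rangle^{-7/9}\|v\|_{X(t)}$. (iii) For every $2\le r\le6$, $$\|v\|_{L^r}\le C\langle t\rangle^{-(\frac32-\frac3r)}\|v\|_{X(t)}\quad\text{and}\quad\|U^{-1}v\|_{L^r}\le C\langle t\rangle^{-\frac79(\frac32-\frac3r)}\|v\|_{X(t)}.$$ -/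

import Mathlib

open MeasureTheory
open scoped FourierTransform ENNReal NNReal

noncomputable section

namespace Decay

/-- Physical space `ℝ³`. -/
abbrev R3 : Type := EuclideanSpace ℝ (Fin 3)

/-- `L²(ℝ³; ℂ)`. -/
abbrev L2 : Type := Lp ℂ 2 (volume : Measure R3)

/-- The bracket `⟨y⟩ = √(2 + |y|²)`, used for frequencies as well as for times. -/
def bracket {E : Type*} [NormedAddCommGroup E] (y : E) : ℝ := √(2 + ‖y‖ ^ 2)

/-! ### Fourier multipliers on `L²`

Symbols are functions of the angular frequency, for which `∂ₖ` has symbol `i ξₖ`.  Mathlib's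
transform uses the kernel `exp (-2πi x·ξ)`, hence the dilation by `2π`. -/

/-- `f` belongs to the (maximal) `L²` domain of the multiplier with symbol `m`. -/
def MultDom (m : R3 → ℂ) (f : L2) : Prop :=
  MemLp (fun ξ : R3 => m ((2 * Real.pi) • ξ) * (𝓕 f : L2) ξ) 2 volume

open Classical in
/-- The multiplier with symbol `m`, as an operator on `L²` with domain `MultDom m`
(the value outside the domain is the default `0`). -/
def mult (m : R3 → ℂ) (f : L2) : L2 :=
  if h : MultDom m f then 𝓕⁻ (h.toLp : L2) else 0

/-- The symbol of `⟨∇⟩ = √(2 - Δ)`. -/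
def japSymbol (ξ : R3) : ℂ := (bracket ξ : ℝ)

/-- The symbol of `U⁻¹`, where `U = |∇| ⟨∇⟩⁻¹`. -/
def uInvSymbol (ξ : R3) : ℂ := ((‖ξ‖ / bracket ξ)⁻¹ : ℝ)

/-- The symbol of `H = |∇| ⟨∇⟩`. -/
def hSymbol (ξ : R3) : ℝ := ‖ξ‖ * bracket ξ

/-- The symbol of `e^{itH}`. -/
def propSymbol (t : ℝ) (ξ : R3) : ℂ := Complex.exp (Complex.I * (t * hSymbol ξ : ℝ))

/-- The symbol of `∂ₖ`. -/
def derivSymbol (k : Fin 3) (ξ : R3) : ℂ := Complex.I * (ξ k : ℝ)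

/-- An admissible Littlewood-Paley cutoff: a smooth radial function on `ℝ³`, equal to one on the
unit ball and supported in the ball of radius `11/10`. -/
structure IsCutoff (φ : R3 → ℝ) : Prop where
  smooth : ContDiff ℝ (⊤ : ℕ∞) φ
  radial : ∀ ξ η : R3, ‖ξ‖ = ‖η‖ → φ ξ = φ η
  eq_one : ∀ ξ : R3, ‖ξ‖ ≤ 1 → φ ξ = 1
  supp : ∀ ξ : R3, 11 / 10 < ‖ξ‖ → φ ξ = 0

/-- The symbol `ψ(ξ/N)` of the Littlewood-Paley projection `P_N`, with `ψ(ξ) = φ(ξ) - φ(2ξ)`. -/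
def lpSymbol (φ : R3 → ℝ) (N : ℝ) (ξ : R3) : ℂ :=
  (φ (N⁻¹ • ξ) - φ ((2 : ℝ) • N⁻¹ • ξ) : ℝ)

/-- The Littlewood-Paley projection `P_N`. -/
def lpProj (φ : R3 → ℝ) (N : ℝ) (f : L2) : L2 := mult (lpSymbol φ N) f

/-! ### The weighted norm and the energy norm -/

/-- `f` belongs to the `L²` domain of multiplication by the coordinate `xⱼ`. -/
def PosDom (j : Fin 3) (f : L2) : Prop :=
  MemLp (fun x : R3 => ((x j : ℝ) : ℂ) * f x) 2 volume

open Classical in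
/-- Multiplication by `xⱼ`, as an operator on `L²` with domain `PosDom j`
(the value outside the domain is the default `0`). -/
def pos (j : Fin 3) (f : L2) : L2 :=
  if h : PosDom j f then h.toLp else 0

/-- The propagator `e^{itH}`. -/
def prop (t : ℝ) (f : L2) : L2 := mult (propSymbol t) f

/-- The components of `J(t) f = e^{-itH} x e^{itH} f`. -/
def J (t : ℝ) (f : L2) (j : Fin 3) : L2 := prop (-t) (pos j (prop t f))

/-- `J(t) f` is defined and belongs to `L²`. -/
def MemJ (t : ℝ) (f : L2) : Prop := ∀ j : Fin 3, PosDom j (prop t f)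

/-- `‖J(t) f‖_{L²}`, the `L²` norm of the vector field `J(t) f : ℝ³ → ℂ³`. -/
def normJ (t : ℝ) (f : L2) : ℝ≥0∞ :=
  eLpNorm (fun x : R3 => (WithLp.toLp 2 (fun j => J t f j x) : EuclideanSpace ℂ (Fin 3))) 2 volume

/-- The vector field `(x × ∇) f`, for `f ∈ H¹`. -/
def angular (f : L2) (x : R3) : EuclideanSpace ℂ (Fin 3) :=
  WithLp.toLp 2
    (crossProduct (fun j => ((x j : ℝ) : ℂ)) (fun k => mult (derivSymbol k) f x))

/-- `f` has finite energy norm at time `t`: `f ∈ H¹`, `J(t) f ∈ L²` and `(x × ∇) f ∈ L²`. -/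
def MemX (t : ℝ) (f : L2) : Prop :=
  MultDom japSymbol f ∧ MemJ t f ∧ MemLp (angular f) 2 volume

/-- The energy norm at time `t`:
`‖f‖_X = ‖⟨∇⟩f‖_{L²} + ‖J(t)f‖_{L²} + ‖(x × ∇)f‖_{L²}`. -/
def normX (t : ℝ) (f : L2) : ℝ≥0∞ :=
  eLpNorm (mult japSymbol f) 2 volume + normJ t f + eLpNorm (angular f) 2 volume

/-- The Lorentz quasi-norm
`‖f‖_{L^{q,α}} = ‖λ |{x : |f(x)| > λ}|^{1/q}‖_{L^α((0,∞), dλ/λ)}`. -/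
def lorentzNorm (q : ℝ) (α : ℝ≥0∞) (f : R3 → ℂ) : ℝ≥0∞ :=
  eLpNorm (fun l : ℝ => ENNReal.ofReal l * volume {x : R3 | l < ‖f x‖} ^ (1 / q)) α
    ((volume.restrict (Set.Ioi (0 : ℝ))).withDensity fun l => ENNReal.ofReal l⁻¹)

end Decay

end

noncomputable section

namespace Decay

/-! Write h(r) = r√(2 + r²), so that H has symbol h(|ξ|). A Fourier multiplier m applied to v is
e^{-itH} m applied to e^{itH} v, and the L² norm of |x| e^{itH} v is exactly ‖J(t)v‖
(`weightMass_prop`). The decay estimates are thus bounds from |x|⁻¹L² to L^{6,2} for the operators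
e^{-itH} m.

If T is bounded on L² with norm B and from L¹ to L^∞ with norm A, then real interpolation maps
L^{6/5,2} to L^{6,2} with norm ≲ A^{2/3}B^{1/3}, and |x|⁻¹L² embeds in L^{6/5,2}. Both facts are
obtained together in `exists_lorentzNorm_le`: f is cut at |x| = 2^K, the inner part is measured in
L¹ and the outer part in L², and the resulting dyadic sums are controlled by ∫|x|²|f|². The same
sums give Hardy's inequality for the Fourier transform (`exists_hardy`), which puts U⁻¹v in L²
because |x|⁻¹ is then the singularity of the symbol of U⁻¹.

For the symbol of U⁻¹ localized at |ξ| ~ N ≤ 1 one has B ≲ 1/N. The kernel of e^{-itH} times it is a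
one-dimensional integral of h'(r)n(r)e^{-ith(r)} against ∫_{-r}^{r} e^{iρs} ds, with a bounded
amplitude n. The size of the support gives A ≲ N²; since h'e^{-ith} is a derivative, one integration
by parts gives A ≲ N/t; van der Corput's lemma, with h'' ≳ N, improves this to A ≲ N^{-1/2}t^{-3/2}
(`norm_oscInt_le`). Inserting these in A^{2/3}B^{1/3} yields the three entries N, N^{1/3}t^{-2/3},
N^{-2/3}t^{-1} of the minimum.

The last two entries balance at N = t^{-1/3}, so the low frequencies of U⁻¹v sum to t^{-7/9}. For v
itself the symbol has an extra factor N, and N^{1/3}t^{-1} sums to t^{-1}. All frequencies between 1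
and R are treated in one piece, with a bound t^{-1} uniform in R. Bounded times are covered by the
Sobolev embedding, which is the interpolation theorem applied to the inverse Fourier transform.
Hölder's inequality between L² and L⁶ gives the intermediate exponents. -/

/-! ### Dyadic geometric sums -/

/-- `2 ^ a` as an extended nonnegative real. -/
abbrev twoPow (a : ℝ) : ℝ≥0∞ := (2 : ℝ≥0∞) ^ a

lemma twoPow_add (a b : ℝ) : twoPow (a + b) = twoPow a * twoPow b :=
  ENNReal.rpow_add a b (by norm_num) (by norm_num)

lemma twoPow_ne_zero (a : ℝ) : twoPow a ≠ 0 := by simp [twoPow]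

lemma twoPow_ne_top (a : ℝ) : twoPow a ≠ ∞ := by
  simp [twoPow, ENNReal.rpow_eq_top_iff]

lemma twoPow_rpow (a b : ℝ) : twoPow a ^ b = twoPow (a * b) := (ENNReal.rpow_mul _ _ _).symm

lemma twoPow_sq (a : ℝ) : twoPow a ^ 2 = twoPow (2 * a) := by
  rw [sq, ← twoPow_add]; ring_nf

lemma twoPow_eq_ofReal (a : ℝ) : twoPow a = ENNReal.ofReal ((2 : ℝ) ^ a) := by
  rw [← ENNReal.ofReal_rpow_of_pos (by norm_num)]; norm_num

lemma geom_const_ne_top {a : ℝ} (ha : 0 < a) : (1 - twoPow (-a))⁻¹ ≠ ∞ := by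
  have : twoPow (-a) < 1 := by
    simpa [twoPow] using ENNReal.rpow_lt_rpow_of_exponent_lt (x := 2) (y := -a) (z := 0)
      (by norm_num) (by norm_num) (by linarith)
  simpa [tsub_eq_zero_iff_le] using this

lemma tsum_twoPow_nat (a : ℝ) : ∑' n : ℕ, twoPow (-(a * n)) = (1 - twoPow (-a))⁻¹ := by
  rw [← ENNReal.tsum_geometric]
  refine tsum_congr fun n => ?_
  rw [← ENNReal.rpow_natCast, twoPow_rpow]
  ring_nf

/-- Geometric sums over the dyadic scales below `r`. -/
lemma tsum_twoPow_le {a : ℝ} (ha : 0 < a) {r : ℝ} (hr : 0 < r) :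
    ∑' K : ℤ, (if (2 : ℝ) ^ K ≤ r then twoPow (a * K) else 0)
      ≤ (1 - twoPow (-a))⁻¹ * ENNReal.ofReal (r ^ a) := by
  set k := Int.log 2 r
  have h1 : (2 : ℝ) ^ k ≤ r := by exact_mod_cast Int.zpow_log_le_self (b := 2) (by norm_num) hr
  have hle (K : ℤ) (hK : (2 : ℝ) ^ K ≤ r) : K ≤ k := by
    exact (Int.zpow_le_iff_le_log (b := 2) (by norm_num) hr).1 (by exact_mod_cast hK)
  have hinj : Function.Injective (fun n : ℕ => k - (n : ℤ)) := fun m n h => by simpa using h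
  rw [← hinj.tsum_eq]
  · calc ∑' n : ℕ, (if (2 : ℝ) ^ (k - (n : ℤ)) ≤ r then twoPow (a * (k - (n : ℤ) : ℤ)) else 0)
        ≤ ∑' n : ℕ, twoPow (a * k) * twoPow (-(a * n)) := by
          refine ENNReal.tsum_le_tsum fun n => ?_
          split_ifs
          · rw [← twoPow_add]; apply le_of_eq; push_cast; ring_nf
          · exact zero_le
      _ = twoPow (a * k) * (1 - twoPow (-a))⁻¹ := by rw [ENNReal.tsum_mul_left, tsum_twoPow_nat]
      _ ≤ _ := by
          rw [mul_comm]
          gcongr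
          rw [twoPow_eq_ofReal]
          refine ENNReal.ofReal_le_ofReal ?_
          rw [mul_comm, Real.rpow_mul (by norm_num), Real.rpow_intCast]
          exact Real.rpow_le_rpow (by positivity) h1 ha.le
  · intro K hK
    have : (2 : ℝ) ^ K ≤ r := by by_contra h; simp [h] at hK
    exact ⟨(k - K).toNat, by have := hle K this; simp only; omega⟩

/-- Geometric sums over the dyadic scales above `r`. -/
lemma tsum_twoPow_gt {a : ℝ} (ha : 0 < a) {r : ℝ} (hr : 0 < r) :
    ∑' K : ℤ, (if r < (2 : ℝ) ^ K then twoPow (-(a * K)) else 0)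
      ≤ (1 - twoPow (-a))⁻¹ * ENNReal.ofReal (r ^ (-a)) := by
  have := tsum_twoPow_le ha (inv_pos.2 hr)
  rw [← (Equiv.neg ℤ).tsum_eq, Real.inv_rpow hr.le, ← Real.rpow_neg hr.le] at this
  refine le_trans (ENNReal.tsum_le_tsum fun K => ?_) this
  simp only [Equiv.neg_apply, zpow_neg]
  split_ifs with h1 h2
  · push_cast; rw [mul_neg]
  · exact absurd (inv_anti₀ hr h1.le) h2
  · exact zero_le
  · exact zero_le

lemma ofReal_norm_rpow {E : Type*} [NormedAddCommGroup E] (x : E) (hx : x ≠ 0) (a : ℝ) :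
    ENNReal.ofReal (‖x‖ ^ a) = ‖x‖ₑ ^ a := by
  rw [← ENNReal.ofReal_rpow_of_pos (norm_pos_iff.2 hx), ofReal_norm]

/-- The mass of `|x| ^ (-5/2)` over a ball of `ℝ³`. -/
lemma exists_lintegral_ball_rpow_le : ∃ C : ℝ≥0, ∀ K : ℤ,
    ∫⁻ x in Metric.ball (0 : R3) ((2 : ℝ) ^ K), ENNReal.ofReal (‖x‖ ^ (-(5 / 2) : ℝ))
      ≤ C * twoPow (K / 2) := by
  set c : ℝ := 3 * volume.real (Metric.ball (0 : R3) 1) * 2 with hc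
  have hc0 : 0 ≤ c := by positivity
  refine ⟨⟨c, hc0⟩, fun K => ?_⟩
  set R : ℝ := (2 : ℝ) ^ K
  have hR : 0 < R := by positivity
  have heq : Set.EqOn (fun y : ℝ => y ^ (Module.finrank ℝ R3 - 1) • y ^ (-(5 / 2) : ℝ))
      (fun y => y ^ (-(1 / 2) : ℝ)) (Set.Ioo 0 R) := fun y hy => by
    have : (y ^ 2 : ℝ) = y ^ (2 : ℝ) := by norm_cast
    simp only [finrank_euclideanSpace, Fintype.card_fin, smul_eq_mul]
    rw [this, ← Real.rpow_add hy.1]; norm_num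
  have hint : IntegrableOn (fun x : R3 => ‖x‖ ^ (-(5 / 2) : ℝ)) (Metric.ball 0 R) := by
    rw [integrableOn_fun_norm_addHaar volume (f := fun y => y ^ (-(5 / 2) : ℝ)),
      integrableOn_congr_fun heq measurableSet_Ioo]
    exact (intervalIntegral.integrableOn_Ioo_rpow_iff hR).2 (by norm_num)
  rw [← ofReal_integral_eq_lintegral_ofReal hint (.of_forall fun x => by positivity)]
  have : ∫ x in Metric.ball (0 : R3) R, ‖x‖ ^ (-(5 / 2) : ℝ) = c * R ^ (1 / 2 : ℝ) := by
    have h1 := integral_fun_norm_addHaar (volume : Measure R3)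
      ((Set.Iio R).indicator fun y => y ^ (-(5 / 2) : ℝ))
    rw [← integral_indicator measurableSet_ball]
    have h2 : ∀ x : R3, (Metric.ball (0 : R3) R).indicator (fun x => ‖x‖ ^ (-(5 / 2) : ℝ)) x
        = (Set.Iio R).indicator (fun y => y ^ (-(5 / 2) : ℝ)) ‖x‖ := fun x => by
      simp [Set.indicator]
    simp_rw [h2, h1]
    have h3 : ∫ y in Set.Ioi (0 : ℝ), y ^ (Module.finrank ℝ R3 - 1) •
        (Set.Iio R).indicator (fun y => y ^ (-(5 / 2) : ℝ)) y = 2 * R ^ (1 / 2 : ℝ) := by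
      have h4 : ∀ y : ℝ, y ^ (Module.finrank ℝ R3 - 1) •
        (Set.Iio R).indicator (fun y => y ^ (-(5 / 2) : ℝ)) y = (Set.Iio R).indicator
          (fun y => y ^ (Module.finrank ℝ R3 - 1) • y ^ (-(5 / 2) : ℝ)) y := fun y => by
        simp [Set.indicator]
      simp_rw [h4]
      rw [setIntegral_indicator measurableSet_Iio, Set.Ioi_inter_Iio,
        setIntegral_congr_fun measurableSet_Ioo heq, ← integral_Ioc_eq_integral_Ioo,
        ← intervalIntegral.integral_of_le hR.le, integral_rpow (by left; norm_num)]
      norm_num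
      ring
    rw [h3]
    simp [hc]
    ring
  rw [this, ENNReal.ofReal_mul hc0, twoPow_eq_ofReal]
  gcongr
  · rw [ENNReal.ofReal, Real.toNNReal_of_nonneg hc0]; rfl
  · apply le_of_eq
    simp only [R]
    rw [← Real.rpow_intCast, ← Real.rpow_mul (by norm_num)]; ring_nf

/-! ### Dyadic masses of a function and its weighted norm -/

/-- The part of the `L¹` mass of `f` inside the ball of radius `2 ^ K`. -/
def innerMass (f : R3 → ℂ) (K : ℤ) : ℝ≥0∞ := ∫⁻ x in Metric.ball 0 ((2 : ℝ) ^ K), ‖f x‖ₑ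

/-- The part of the `L²` mass of `f` outside the ball of radius `2 ^ K`. -/
def outerMass (f : R3 → ℂ) (K : ℤ) : ℝ≥0∞ := ∫⁻ x in (Metric.ball 0 ((2 : ℝ) ^ K))ᶜ, ‖f x‖ₑ ^ 2

/-- The squared `L²` norm of `|x| f`. -/
def weightMass (f : R3 → ℂ) : ℝ≥0∞ := ∫⁻ x, ‖x‖ₑ ^ 2 * ‖f x‖ₑ ^ 2

lemma ae_ne_zero : ∀ᵐ x : R3, x ≠ 0 := by
  simp [ae_iff]

/-- After exchanging sum and integral, the point x carries the weight ∑ 2^{2K} over 2^K ≤ |x|, a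
geometric sum comparable to its largest term |x|². -/
lemma exists_tsum_outerMass_le : ∃ C : ℝ≥0, ∀ f : R3 → ℂ, AEStronglyMeasurable f →
    ∑' K : ℤ, twoPow (2 * K) * outerMass f K ≤ C * weightMass f := by
  refine ⟨((1 - twoPow (-2))⁻¹).toNNReal, fun f hf => ?_⟩
  rw [ENNReal.coe_toNNReal (geom_const_ne_top (by norm_num))]
  calc ∑' K : ℤ, twoPow (2 * K) * outerMass f K
      = ∑' K : ℤ, ∫⁻ x, (if (2 : ℝ) ^ K ≤ ‖x‖ then twoPow (2 * K) else 0) * ‖f x‖ₑ ^ 2 := by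
        refine tsum_congr fun K => ?_
        rw [outerMass, ← lintegral_const_mul' _ _ (twoPow_ne_top _),
          ← lintegral_indicator measurableSet_ball.compl]
        refine lintegral_congr fun x => ?_
        simp [Set.indicator]
    _ = ∫⁻ x, (∑' K : ℤ, (if (2 : ℝ) ^ K ≤ ‖x‖ then twoPow (2 * K) else 0)) * ‖f x‖ₑ ^ 2 := by
        rw [← lintegral_tsum]
        · simp_rw [ENNReal.tsum_mul_right]
        · intro K
          refine AEMeasurable.mul (Measurable.aemeasurable ?_) (hf.enorm.pow_const 2)
          exact Measurable.ite (measurableSet_le measurable_const measurable_norm)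
            measurable_const measurable_const
    _ ≤ ∫⁻ x, (1 - twoPow (-2))⁻¹ * (‖x‖ₑ ^ 2 * ‖f x‖ₑ ^ 2) := by
        refine lintegral_mono_ae ?_
        filter_upwards [ae_ne_zero] with x hx
        rw [← mul_assoc]
        gcongr
        refine (tsum_twoPow_le (a := 2) (by norm_num) (norm_pos_iff.2 hx)).trans ?_
        rw [ofReal_norm_rpow x hx]; norm_cast
    _ = _ := by
        rw [lintegral_const_mul' _ _ (geom_const_ne_top (by norm_num)), weightMass]

/-- Cauchy–Schwarz with the weight |x|^{5/2} turns the squared L¹ mass into an L² integral over the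
same ball. The exponent must be below 3 for |x|^{-5/2} to be integrable at the origin, and above 2
for the remaining sum of 2^{-K/2} over 2^K > |x| to converge; that sum restores the weight |x|². -/
lemma exists_tsum_innerMass_le : ∃ C : ℝ≥0, ∀ f : R3 → ℂ, AEStronglyMeasurable f →
    ∑' K : ℤ, twoPow (-K) * innerMass f K ^ 2 ≤ C * weightMass f := by
  obtain ⟨C, hC⟩ := exists_lintegral_ball_rpow_le
  refine ⟨C * ((1 - twoPow (-(1 / 2)))⁻¹).toNNReal, fun f hf => ?_⟩
  rw [ENNReal.coe_mul, ENNReal.coe_toNNReal (geom_const_ne_top (by norm_num))]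
  have hcs (K : ℤ) : innerMass f K ^ 2 ≤ C * twoPow (K / 2) *
      ∫⁻ x in Metric.ball 0 ((2 : ℝ) ^ K), ‖x‖ₑ ^ (5 / 2 : ℝ) * ‖f x‖ₑ ^ 2 := by
    have h := ENNReal.lintegral_mul_le_Lp_mul_Lq (volume.restrict (Metric.ball (0 : R3) (2 ^ K)))
      Real.HolderConjugate.two_two (f := fun x => ENNReal.ofReal (‖x‖ ^ (-(5 / 4) : ℝ)))
      (g := fun x => ‖x‖ₑ ^ (5 / 4 : ℝ) * ‖f x‖ₑ)
      (by fun_prop) (AEMeasurable.mul (by fun_prop) hf.enorm.restrict)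
    have h1 : innerMass f K = ∫⁻ x in Metric.ball 0 ((2 : ℝ) ^ K),
        ((fun x : R3 => ENNReal.ofReal (‖x‖ ^ (-(5 / 4) : ℝ))) *
          fun x => ‖x‖ₑ ^ (5 / 4 : ℝ) * ‖f x‖ₑ) x := by
      refine lintegral_congr_ae (ae_restrict_of_ae ?_)
      filter_upwards [ae_ne_zero] with x hx
      simp only [Pi.mul_apply]
      rw [ofReal_norm_rpow x hx, ← mul_assoc, ← ENNReal.rpow_add _ _ (by simpa using hx) (by simp)]
      simp
    rw [← h1] at h
    have h2 := pow_le_pow_left' h 2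
    rw [mul_pow] at h2
    have hsq (y : ℝ≥0∞) : (y ^ (1 / 2 : ℝ)) ^ 2 = y := by
      rw [← ENNReal.rpow_natCast, ← ENNReal.rpow_mul]; norm_num
    rw [hsq, hsq] at h2
    refine h2.trans ?_
    gcongr
    · refine le_trans (lintegral_mono fun x => ?_) (hC K)
      rw [ENNReal.ofReal_rpow_of_nonneg (by positivity) (by norm_num),
        ← Real.rpow_mul (norm_nonneg _)]
      norm_num
    · refine le_of_eq ?_
      rw [ENNReal.mul_rpow_of_nonneg _ _ (by norm_num), ← ENNReal.rpow_mul]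
      norm_num
  calc ∑' K : ℤ, twoPow (-K) * innerMass f K ^ 2
      ≤ ∑' K : ℤ, C * ∫⁻ x, (if ‖x‖ < (2 : ℝ) ^ K then twoPow (-((1 / 2) * K)) else 0) *
          (‖x‖ₑ ^ (5 / 2 : ℝ) * ‖f x‖ₑ ^ 2) := by
        refine ENNReal.tsum_le_tsum fun K => ?_
        refine (mul_le_mul_right (hcs K) _).trans (le_of_eq ?_)
        rw [mul_assoc, ← mul_assoc, mul_comm (twoPow _) (C : ℝ≥0∞), mul_assoc, ← mul_assoc (twoPow _),
          ← twoPow_add, ← lintegral_const_mul' _ _ (twoPow_ne_top _),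
          ← lintegral_indicator measurableSet_ball]
        congr 1
        refine lintegral_congr fun x => ?_
        simp only [Set.indicator, mem_ball_zero_iff]
        split_ifs
        · congr 2; ring
        · simp
    _ = C * ∫⁻ x, (∑' K : ℤ, (if ‖x‖ < (2 : ℝ) ^ K then twoPow (-((1 / 2) * K)) else 0)) *
          (‖x‖ₑ ^ (5 / 2 : ℝ) * ‖f x‖ₑ ^ 2) := by
        rw [ENNReal.tsum_mul_left, ← lintegral_tsum]
        · simp_rw [ENNReal.tsum_mul_right]
        · intro K
          refine AEMeasurable.mul (Measurable.aemeasurable ?_)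
            (AEMeasurable.mul (by fun_prop) (hf.enorm.pow_const 2))
          exact Measurable.ite (measurableSet_lt measurable_norm measurable_const)
            measurable_const measurable_const
    _ ≤ C * ∫⁻ x, (1 - twoPow (-(1 / 2)))⁻¹ * (‖x‖ₑ ^ 2 * ‖f x‖ₑ ^ 2) := by
        refine mul_le_mul_right (lintegral_mono_ae ?_) _
        filter_upwards [ae_ne_zero] with x hx
        rw [← mul_assoc, ← mul_assoc]
        gcongr ?_ * _
        refine (mul_le_mul_left (tsum_twoPow_gt (a := 1 / 2) (by norm_num)
          (norm_pos_iff.2 hx)) _).trans (le_of_eq ?_)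
        rw [ofReal_norm_rpow x hx, mul_assoc, ← ENNReal.rpow_add _ _ (by simpa using hx) (by simp)]
        norm_num
    _ = _ := by
        rw [lintegral_const_mul' _ _ (geom_const_ne_top (by norm_num)), weightMass, mul_assoc]

/-- The dyadic mass sums behind real interpolation and Hardy's inequality. -/
lemma exists_tsum_mass_le : ∃ C : ℝ≥0, ∀ f : R3 → ℂ, AEStronglyMeasurable f →
    ∑' K : ℤ, (twoPow (-K) * innerMass f K ^ 2 + twoPow (2 * K) * outerMass f K)
      ≤ C * weightMass f := by
  obtain ⟨C₁, h₁⟩ := exists_tsum_innerMass_le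
  obtain ⟨C₂, h₂⟩ := exists_tsum_outerMass_le
  refine ⟨C₁ + C₂, fun f hf => ?_⟩
  rw [ENNReal.tsum_add, ENNReal.coe_add, add_mul]
  exact add_le_add (h₁ f hf) (h₂ f hf)

/-! ### The Lorentz quasi-norm of `L^{6,2}` -/

lemma lintegral_ofReal_lt_le (y : ℝ≥0∞) :
    ∫⁻ l in Set.Ioi (0 : ℝ), ENNReal.ofReal l * (if ENNReal.ofReal l < y then 1 else 0) ≤ y ^ 2 := by
  rcases eq_or_ne y ∞ with rfl | hy
  · simp
  calc ∫⁻ l in Set.Ioi (0 : ℝ), ENNReal.ofReal l * (if ENNReal.ofReal l < y then 1 else 0)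
      ≤ ∫⁻ l in Set.Ioi (0 : ℝ), (Set.Iio y.toReal).indicator (fun _ => y) l := by
        refine lintegral_mono fun l => ?_
        simp only [Set.indicator, Set.mem_Iio]
        split_ifs with h1 h2 h2
        · simpa using h1.le
        · refine absurd ?_ h2
          rw [← ENNReal.ofReal_toReal hy] at h1
          exact (ENNReal.ofReal_lt_ofReal_iff'.1 h1).1
        · simp
        · simp
    _ = y ^ 2 := by
        rw [lintegral_indicator measurableSet_Iio, Measure.restrict_restrict measurableSet_Iio,
          lintegral_const, Measure.restrict_apply_univ, Set.inter_comm, Set.Ioi_inter_Iio,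
          Real.volume_Ioo, sub_zero, ENNReal.ofReal_toReal hy, sq]

/-- With q = 6 and α = 2 the square of the integrand is λ² d(λ)^{1/3}, where d is the distribution
function, and the measure dλ/λ removes one factor λ. -/
lemma lorentzNorm_six_two_sq_eq (f : R3 → ℂ) :
    lorentzNorm 6 2 f ^ 2 = ∫⁻ l in Set.Ioi (0 : ℝ),
      ENNReal.ofReal l * volume {x : R3 | l < ‖f x‖} ^ (1 / 3 : ℝ) := by
  rw [lorentzNorm, eLpNorm_eq_lintegral_rpow_enorm_toReal (by norm_num) (by norm_num)]
  rw [← ENNReal.rpow_natCast, ← ENNReal.rpow_mul]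
  norm_num
  have hanti : Antitone fun l : ℝ => volume {x : R3 | l < ‖f x‖} := fun a b hab =>
    measure_mono fun x (hx : b < ‖f x‖) => lt_of_le_of_lt hab hx
  rw [lintegral_withDensity_eq_lintegral_mul₀ (by fun_prop)]
  · refine setLIntegral_congr_fun measurableSet_Ioi fun l hl => ?_
    have hl0 : ENNReal.ofReal l ≠ 0 := by simpa using hl
    simp only [Pi.mul_apply]
    rw [ENNReal.ofReal_inv_of_pos hl, mul_pow, sq (ENNReal.ofReal l),
      mul_assoc (ENNReal.ofReal l), ← mul_assoc (ENNReal.ofReal l)⁻¹,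
      ENNReal.inv_mul_cancel hl0 (by simp), one_mul, ← ENNReal.rpow_natCast, ← ENNReal.rpow_mul]
    norm_num
  · have := hanti.measurable
    fun_prop

/-- The Lorentz space `L^{6,2}` embeds in `L⁶`. -/
lemma eLpNorm_six_le_lorentzNorm (f : R3 → ℂ) (hf : AEStronglyMeasurable f) :
    eLpNorm f 6 volume ≤ 2 * lorentzNorm 6 2 f := by
  set L := lorentzNorm 6 2 f ^ 2 with hL
  set d : ℝ → ℝ≥0∞ := fun l => volume {x : R3 | l < ‖f x‖} with hd
  have hanti : Antitone d := fun a b hab =>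
    measure_mono fun x (hx : b < ‖f x‖) => lt_of_le_of_lt hab hx
  have hL' : L = ∫⁻ l in Set.Ioi (0 : ℝ), ENNReal.ofReal l * d l ^ (1 / 3 : ℝ) :=
    lorentzNorm_six_two_sq_eq f
  -- As d is nonincreasing, d(l)^{1/3} l²/2 is at most the integral of s d(s)^{1/3} over (0, l],
  -- hence at most L: this is the embedding of L^{6,2} in weak L⁶.
  have hpt (l : ℝ) (hl : 0 < l) :
      ENNReal.ofReal (l ^ (2 : ℝ)) * d l ^ (1 / 3 : ℝ) ≤ 2 * L := by
    have h1 : ENNReal.ofReal (l ^ (2 : ℝ) / 2) = ∫⁻ s in Set.Ioc 0 l, ENNReal.ofReal s := by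
      rw [← ofReal_integral_eq_lintegral_ofReal, ← intervalIntegral.integral_of_le hl.le, integral_id]
      · norm_num
      · exact (intervalIntegrable_iff_integrableOn_Ioc_of_le hl.le).1 intervalIntegral.intervalIntegrable_id
      · exact (ae_restrict_iff' measurableSet_Ioc).2 (.of_forall fun s hs => hs.1.le)
    have h2 : ENNReal.ofReal (l ^ (2 : ℝ)) = 2 * ENNReal.ofReal (l ^ (2 : ℝ) / 2) := by
      rw [← ENNReal.ofReal_ofNat, ← ENNReal.ofReal_mul (by norm_num)]; congr 1; ring
    rw [h2, mul_assoc]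
    gcongr
    rw [h1, hL', ← lintegral_mul_const _ (by fun_prop)]
    calc ∫⁻ s in Set.Ioc 0 l, ENNReal.ofReal s * d l ^ (1 / 3 : ℝ)
        ≤ ∫⁻ s in Set.Ioc 0 l, ENNReal.ofReal s * d s ^ (1 / 3 : ℝ) := by
          refine setLIntegral_mono' measurableSet_Ioc fun s hs => ?_
          gcongr
          exact hanti hs.2
      _ ≤ _ := lintegral_mono_set fun s hs => hs.1
  have h6 : ∫⁻ x, ‖f x‖ₑ ^ (6 : ℝ) ≤ 6 * (2 * L) ^ 2 * L := by
    have := lintegral_rpow_eq_lintegral_meas_lt_mul (volume : Measure R3) (f := fun x => ‖f x‖)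
      (.of_forall fun x => norm_nonneg _) hf.norm.aemeasurable (p := 6) (by norm_num)
    have h7 : ∫⁻ x, ‖f x‖ₑ ^ (6 : ℝ) = ∫⁻ x, ENNReal.ofReal (‖f x‖ ^ (6 : ℝ)) := by
      refine lintegral_congr fun x => ?_
      rw [← ENNReal.ofReal_rpow_of_nonneg (norm_nonneg _) (by norm_num), ofReal_norm]
    rw [h7, this]
    calc _ ≤ ENNReal.ofReal 6 * ∫⁻ l in Set.Ioi (0 : ℝ),
          (2 * L) ^ 2 * (ENNReal.ofReal l * d l ^ (1 / 3 : ℝ)) := by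
          refine mul_le_mul_right (setLIntegral_mono' measurableSet_Ioi fun l hl => ?_) _
          have hl' : (0 : ℝ) < l := hl
          refine le_trans (le_of_eq ?_) (mul_le_mul_left (pow_le_pow_left' (hpt l hl) 2) _)
          -- The layer-cake integrand factors as l⁵ d = (l² d^{1/3})² · (l d^{1/3}). The pointwise
          -- bound absorbs the square, and the last factor integrates to L.
          have e1 : d l = d l ^ (1 / 3 : ℝ) * d l ^ (1 / 3 : ℝ) * d l ^ (1 / 3 : ℝ) := by
            rw [← ENNReal.rpow_add_of_nonneg, ← ENNReal.rpow_add_of_nonneg] <;> norm_num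
          have e2 : ENNReal.ofReal (l ^ ((6 : ℝ) - 1)) = ENNReal.ofReal (l ^ (2 : ℝ)) ^ 2 *
              ENNReal.ofReal l := by
            rw [← ENNReal.ofReal_pow (by positivity), ← ENNReal.ofReal_mul (by positivity)]
            congr 1
            norm_num
            ring
          change d l * _ = _
          rw [e2]
          nth_rw 1 [e1]
          ring
      _ = ENNReal.ofReal 6 * ((2 * L) ^ 2 * L) := by
          rw [hL', lintegral_const_mul]
          have := hanti.measurable
          fun_prop
      _ = _ := by rw [mul_assoc, ENNReal.ofReal_ofNat]
  rw [eLpNorm_eq_lintegral_rpow_enorm_toReal (by norm_num) (by norm_num)]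
  norm_num
  norm_num at h6
  calc (∫⁻ x, ‖f x‖ₑ ^ 6) ^ (1 / 6 : ℝ) ≤ ((2 * lorentzNorm 6 2 f) ^ 6) ^ (1 / 6 : ℝ) := by
        gcongr
        refine h6.trans ?_
        rw [hL]
        have : (6 : ℝ≥0∞) * (2 * lorentzNorm 6 2 f ^ 2) ^ 2 * lorentzNorm 6 2 f ^ 2
          = 24 * lorentzNorm 6 2 f ^ 6 := by ring
        rw [this, mul_pow]
        gcongr
        norm_num
    _ = _ := by
        rw [← ENNReal.rpow_natCast, ← ENNReal.rpow_mul]; norm_num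

/-- Discretization of the Lorentz norm along dyadic levels of the distribution function. -/
lemma lorentzNorm_six_two_sq_le_tsum {f : R3 → ℂ} (y : ℤ → ℝ≥0∞) {c : ℝ≥0} (hc : c ≠ 0)
    (hfin : ∀ l : ℝ, 0 < l → volume {x : R3 | l < ‖f x‖} ≠ ∞)
    (hy : ∀ K : ℤ, volume {x : R3 | y K < ‖f x‖ₑ} ≤ c ^ 3 * twoPow (-(3 * K))) :
    lorentzNorm 6 2 f ^ 2 ≤ 2 * c * ∑' K : ℤ, twoPow (-K) * y K ^ 2 := by
  have hpt (l : ℝ) (hl : 0 < l) : volume {x : R3 | l < ‖f x‖} ^ (1 / 3 : ℝ) ≤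
      ∑' K : ℤ, 2 * c * twoPow (-K) * (if ENNReal.ofReal l < y K then 1 else 0) := by
    set m := volume {x : R3 | l < ‖f x‖} with hm
    rcases eq_or_ne m 0 with h0 | h0
    · simp [h0]
    -- Here m^{1/3} = c s, and j is the integer with 2^j < s ≤ 2^{j+1}. If y (-j) were at most l,
    -- the hypothesis at K = -j would give m^{1/3} ≤ c 2^j < c s. So the single term K = -j is
    -- switched on, and it already dominates m^{1/3}.
    set s : ℝ := (m ^ (1 / 3 : ℝ) / c).toReal with hs
    have hm3 : m ^ (1 / 3 : ℝ) ≠ ∞ := ENNReal.rpow_ne_top_of_nonneg (by norm_num) (hfin l hl)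
    have hne : m ^ (1 / 3 : ℝ) / c ≠ ∞ := ENNReal.div_ne_top hm3 (by simpa using hc)
    have hs0 : 0 < s := by
      refine ENNReal.toReal_pos ?_ hne
      simp [ENNReal.div_eq_zero_iff, h0]
    obtain ⟨j, hj1, hj2⟩ := exists_mem_Ioc_zpow (y := (2 : ℝ)) hs0 (by norm_num)
    have hsm : m ^ (1 / 3 : ℝ) = c * ENNReal.ofReal s := by
      rw [hs, ENNReal.ofReal_toReal hne, ENNReal.mul_div_cancel (by simpa using hc) (by simp)]
    have key : ENNReal.ofReal l < y (-j) := by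
      by_contra hcon
      have h1 : m ≤ c ^ 3 * twoPow (-(3 * (-j : ℤ))) := by
        refine le_trans (measure_mono fun x hx => ?_) (hy (-j))
        refine lt_of_le_of_lt (not_lt.1 hcon) ?_
        rw [← ofReal_norm]
        exact (ENNReal.ofReal_lt_ofReal_iff (hl.trans hx)).2 hx
      have h2 : m ^ (1 / 3 : ℝ) ≤ c * twoPow j := by
        refine (ENNReal.rpow_le_rpow h1 (by norm_num)).trans (le_of_eq ?_)
        rw [ENNReal.mul_rpow_of_nonneg _ _ (by norm_num), twoPow_rpow, ← ENNReal.rpow_natCast,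
          ← ENNReal.rpow_mul]
        push_cast
        congr 1
        · norm_num
        · congr 1; ring
      rw [hsm] at h2
      have h3 := (ENNReal.mul_le_mul_iff_right (by simpa using hc) (by simp)).1 h2
      rw [twoPow_eq_ofReal, ENNReal.ofReal_le_ofReal_iff (by positivity), Real.rpow_intCast] at h3
      exact absurd hj1 (not_lt.2 h3)
    refine le_trans ?_ (ENNReal.le_tsum (-j))
    rw [if_pos key, mul_one, hsm, mul_comm 2 (c : ℝ≥0∞), mul_assoc]
    gcongr
    have h4 : (2 : ℝ≥0∞) * twoPow (-(-j : ℤ)) = twoPow (j + 1 : ℤ) := by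
      push_cast
      rw [neg_neg, twoPow_add, mul_comm]
      simp [twoPow]
    rw [h4, twoPow_eq_ofReal, Real.rpow_intCast]
    exact ENNReal.ofReal_le_ofReal hj2
  rw [lorentzNorm_six_two_sq_eq]
  calc _ ≤ ∫⁻ l in Set.Ioi (0 : ℝ), ∑' K : ℤ, 2 * c * twoPow (-K) *
          (ENNReal.ofReal l * (if ENNReal.ofReal l < y K then 1 else 0)) := by
        refine setLIntegral_mono' measurableSet_Ioi fun l hl => ?_
        refine (mul_le_mul_right (hpt l hl) _).trans (le_of_eq ?_)
        rw [← ENNReal.tsum_mul_left]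
        exact tsum_congr fun K => by ring
    _ ≤ ∑' K : ℤ, 2 * c * twoPow (-K) * y K ^ 2 := by
        have hmeas (K : ℤ) : Measurable fun l : ℝ =>
            ENNReal.ofReal l * (if ENNReal.ofReal l < y K then (1 : ℝ≥0∞) else 0) := by
          refine Measurable.mul (by fun_prop) ?_
          exact Measurable.ite (measurableSet_lt (by fun_prop) measurable_const)
            measurable_const measurable_const
        rw [lintegral_tsum fun K => ((hmeas K).const_mul _).aemeasurable]
        refine ENNReal.tsum_le_tsum fun K => ?_
        rw [lintegral_const_mul _ (hmeas K)]
        gcongr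
        exact lintegral_ofReal_lt_le (y K)
    _ = _ := by
        rw [← ENNReal.tsum_mul_left]
        exact tsum_congr fun K => by ring

/-! ### Real interpolation and Hardy's inequality for dispersive maps -/

/-- An additive map of `L²` that is bounded on `L²` and from `L¹` to `L^∞`. -/
structure Dispersive (T : L2 → L2) (A B : ℝ≥0) : Prop where
  map_add : ∀ f g, T (f + g) = T f + T g
  two_two : ∀ f, eLpNorm (T f) 2 volume ≤ B * eLpNorm f 2 volume
  one_top : ∀ f, eLpNorm (T f) ∞ volume ≤ A * eLpNorm f 1 volume

/-- The decomposition of `T f` at the scale `2 ^ K`. -/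
lemma Dispersive.exists_split {T : L2 → L2} {A B : ℝ≥0} (hT : Dispersive T A B) (f : L2) (K : ℤ) :
    ∃ g b : L2, T f = g + b ∧ (∀ᵐ x, ‖g x‖ₑ ≤ A * innerMass f K) ∧
      eLpNorm b 2 volume ≤ B * outerMass f K ^ (1 / 2 : ℝ) := by
  set S : Set R3 := Metric.ball 0 ((2 : ℝ) ^ K)
  have hS : MeasurableSet S := measurableSet_ball
  have h1 : MemLp (S.indicator f) 2 volume := (Lp.memLp f).indicator hS
  have h2 : MemLp (Sᶜ.indicator f) 2 volume := (Lp.memLp f).indicator hS.compl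
  have hf : f = h1.toLp + h2.toLp := by
    rw [← MemLp.toLp_add]
    refine Lp.ext ?_
    filter_upwards [MemLp.coeFn_toLp (h1.add h2)] with x hx
    rw [hx, Set.indicator_self_add_compl]
  refine ⟨T h1.toLp, T h2.toLp, by rw [← hT.map_add, ← hf], ?_, ?_⟩
  · have := hT.one_top h1.toLp
    rw [eLpNorm_congr_ae h1.coeFn_toLp, eLpNorm_indicator_eq_eLpNorm_restrict hS,
      eLpNorm_one_eq_lintegral_enorm, eLpNorm_exponent_top] at this
    exact (ae_le_eLpNormEssSup).mono fun x hx => hx.trans this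
  · refine (hT.two_two _).trans ?_
    rw [eLpNorm_congr_ae h2.coeFn_toLp, eLpNorm_indicator_eq_eLpNorm_restrict hS.compl,
      eLpNorm_eq_lintegral_rpow_enorm_toReal (by norm_num) (by norm_num), outerMass]
    norm_num
    rfl

lemma outerMass_ne_top (f : L2) (K : ℤ) : outerMass f K ≠ ∞ := by
  refine ne_top_of_le_ne_top ?_ (setLIntegral_le_lintegral _ _)
  have := (Lp.memLp f).2.ne
  rw [eLpNorm_eq_lintegral_rpow_enorm_toReal (by norm_num) (by norm_num)] at this
  norm_num at this
  exact this

lemma ENNReal_rpow_half_sq (y : ℝ≥0∞) : (y ^ (1 / 2 : ℝ)) ^ 2 = y := by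
  rw [← ENNReal.rpow_natCast, ← ENNReal.rpow_mul]; norm_num

lemma ENNReal_sq_rpow_half (y : ℝ≥0∞) : (y ^ 2) ^ (1 / 2 : ℝ) = y := by
  rw [← ENNReal.rpow_natCast, ← ENNReal.rpow_mul]; norm_num

lemma ENNReal_add_sq_le (a b : ℝ≥0∞) : (a + b) ^ 2 ≤ 2 * (a ^ 2 + b ^ 2) := by
  have := ENNReal.rpow_add_le_mul_rpow_add_rpow a b (p := 2) (by norm_num)
  norm_num at this
  exact this

lemma lintegral_sq_eq_eLpNorm {E : Type*} [NormedAddCommGroup E] (f : R3 → E) :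
    ∫⁻ x, ‖f x‖ₑ ^ 2 = eLpNorm f 2 volume ^ 2 := by
  rw [eLpNorm_eq_lintegral_rpow_enorm_toReal (by norm_num) (by norm_num)]
  norm_num
  rw [ENNReal_rpow_half_sq]

/-- The image of the inner part never exceeds A times the inner mass, so above this threshold only
the image b of the outer part can be responsible. Chebyshev's inequality in L² for b at height A
2^{3K/2} w, with w the square root of the outer mass, gives a bound from which w cancels. -/
lemma Dispersive.volume_superlevel_le {T : L2 → L2} {A B : ℝ≥0} (hT : Dispersive T A B)
    (hA : A ≠ 0) (f : L2) (K : ℤ) :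
    volume {x : R3 | A * (innerMass f K + twoPow (3 / 2 * K) * outerMass f K ^ (1 / 2 : ℝ)) <
      ‖T f x‖ₑ} ≤ (B / A : ℝ≥0) ^ 2 * twoPow (-(3 * K)) := by
  obtain ⟨g, b, hgb, hg, hb⟩ := hT.exists_split f K
  set w := outerMass f K ^ (1 / 2 : ℝ) with hw
  have hwt : w ≠ ∞ := ENNReal.rpow_ne_top_of_nonneg (by norm_num) (outerMass_ne_top f K)
  have hA' : (A : ℝ≥0∞) ≠ 0 := by simpa using hA
  set ε : ℝ≥0∞ := A * (twoPow (3 / 2 * K) * w) with hε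
  have hsub : volume {x : R3 | A * (innerMass f K + twoPow (3 / 2 * K) * w) < ‖T f x‖ₑ} ≤
      volume {x : R3 | ε < ‖b x‖ₑ} := by
    refine measure_mono_ae ?_
    have hae : T f =ᵐ[volume] fun x => g x + b x := by rw [hgb]; exact Lp.coeFn_add g b
    filter_upwards [hg, hae] with x h1 h2 (h3 : _ < _)
    rw [h2, mul_add] at h3
    exact lt_of_add_lt_add_left (h3.trans_le ((enorm_add_le _ _).trans (add_le_add_left h1 _)))
  refine hsub.trans ?_
  -- If the outer mass vanishes, so does the Chebyshev height, and one cannot divide by it; but then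
  -- b = 0 almost everywhere.
  rcases eq_or_ne w 0 with h0 | h0
  · have hb0 : b =ᵐ[volume] (0 : R3 → ℂ) := by
      rw [← eLpNorm_eq_zero_iff (Lp.aestronglyMeasurable b) (by norm_num : (2 : ℝ≥0∞) ≠ 0)]
      simpa [h0] using hb
    refine le_of_eq_of_le ?_ zero_le
    rw [measure_eq_zero_iff_ae_notMem]
    filter_upwards [hb0] with x hx
    simp [hx]
  have hεt : ε ≠ ∞ := ENNReal.mul_ne_top (by simp) (ENNReal.mul_ne_top (twoPow_ne_top _) hwt)
  have hε0 : ε ≠ 0 := mul_ne_zero hA' (mul_ne_zero (twoPow_ne_zero _) h0)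
  have hch := mul_meas_ge_le_pow_eLpNorm' volume (p := 2) (by norm_num) (by norm_num)
    (Lp.aestronglyMeasurable b) ε
  have h1 : ε ^ 2 * volume {x : R3 | ε < ‖b x‖ₑ} ≤ (B * w) ^ 2 := by
    calc _ ≤ ε ^ 2 * volume {x : R3 | ε ≤ ‖b x‖ₑ} := by
          gcongr; exact fun h => h.le
      _ ≤ eLpNorm b 2 volume ^ 2 := by simpa using hch
      _ ≤ _ := by gcongr
  have h2 : ε ^ 2 * ((B / A : ℝ≥0) ^ 2 * twoPow (-(3 * K))) = (B * w) ^ 2 := by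
    rw [hε, mul_pow, mul_pow, twoPow_sq, ENNReal.coe_div hA]
    have e1 : twoPow (2 * (3 / 2 * K)) * twoPow (-(3 * K)) = 1 := by
      rw [← twoPow_add]; ring_nf; simp
    have e2 : (A : ℝ≥0∞) ^ 2 * (B / A) ^ 2 = B ^ 2 := by
      rw [← mul_pow, ENNReal.mul_div_cancel hA' (by simp)]
    calc _ = ((A : ℝ≥0∞) ^ 2 * (B / A) ^ 2) * (twoPow (2 * (3 / 2 * K)) * twoPow (-(3 * K))) * w ^ 2 := by
          ring
      _ = _ := by rw [e1, e2]; ring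
  rw [← h2] at h1
  exact (ENNReal.mul_le_mul_iff_right (pow_ne_zero 2 hε0) (by finiteness)).1 h1

/-- Real interpolation: a dispersive map sends `|x|⁻¹ L²` to `L^{6,2}`. -/
theorem exists_lorentzNorm_le : ∃ C : ℝ≥0, ∀ (T : L2 → L2) (A B : ℝ≥0), A ≠ 0 → B ≠ 0 →
    Dispersive T A B → ∀ f : L2, lorentzNorm 6 2 (T f) ≤
      C * (A ^ (2 / 3 : ℝ) * B ^ (1 / 3 : ℝ) : ℝ≥0) * weightMass f ^ (1 / 2 : ℝ) := by
  obtain ⟨C, hC⟩ := exists_tsum_mass_le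
  refine ⟨(4 * C) ^ (1 / 2 : ℝ), fun T A B hA hB hT f => ?_⟩
  -- This is the value for which c³ = (B/A)², the constant in the superlevel bound. The discretized
  -- norm then produces the square root of c A², which is A^{2/3}B^{1/3}.
  set c : ℝ≥0 := (B / A) ^ (2 / 3 : ℝ) with hc
  have hc3 : c ^ 3 = (B / A) ^ 2 := by
    rw [hc, ← NNReal.rpow_natCast, ← NNReal.rpow_mul, ← NNReal.rpow_natCast]; norm_num
  have hc0 : c ≠ 0 := by
    rw [hc]; exact (NNReal.rpow_pos (div_pos (pos_iff_ne_zero.2 hB) (pos_iff_ne_zero.2 hA))).ne'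
  have hfin (l : ℝ) (hl : 0 < l) : volume {x : R3 | l < ‖T f x‖} ≠ ∞ := by
    have := (Lp.memLp (T f)).meas_ge_lt_top' (by norm_num) (by norm_num)
      (ε := ENNReal.ofReal l) (by simpa using hl)
    refine ne_top_of_le_ne_top this.ne (measure_mono fun x (hx : l < ‖T f x‖) => ?_)
    change _ ≤ ‖T f x‖ₑ
    rw [← ofReal_norm]
    exact ENNReal.ofReal_le_ofReal hx.le
  have h := lorentzNorm_six_two_sq_le_tsum (f := T f)
    (fun K : ℤ => A * (innerMass f K + twoPow (3 / 2 * K) * outerMass f K ^ (1 / 2 : ℝ))) hc0 hfin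
    (fun K => by
      refine (hT.volume_superlevel_le hA f K).trans (le_of_eq ?_)
      congr 1
      exact_mod_cast hc3.symm)
  have hsum : ∑' K : ℤ, twoPow (-K) *
      (A * (innerMass f K + twoPow (3 / 2 * K) * outerMass f K ^ (1 / 2 : ℝ))) ^ 2 ≤
      A ^ 2 * (2 * (C * weightMass f)) := by
    refine le_trans ?_ (mul_le_mul_right (mul_le_mul_right (hC f (Lp.aestronglyMeasurable f)) 2) _)
    rw [← ENNReal.tsum_mul_left, ← ENNReal.tsum_mul_left]
    refine ENNReal.tsum_le_tsum fun K => ?_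
    rw [mul_pow, ← mul_assoc, mul_comm (twoPow _), mul_assoc]
    refine mul_le_mul_right ?_ _
    refine (mul_le_mul_right (ENNReal_add_sq_le _ _) _).trans (le_of_eq ?_)
    rw [mul_pow, ENNReal_rpow_half_sq, twoPow_sq]
    have : twoPow (2 * K) = twoPow (-K) * twoPow (2 * (3 / 2 * K)) := by
      rw [← twoPow_add]; ring_nf
    rw [this]
    ring
  have h2 : lorentzNorm 6 2 (T f) ^ 2 ≤
      (4 * C * (c * A ^ 2) : ℝ≥0) * weightMass f := by
    refine h.trans ((mul_le_mul_right hsum _).trans (le_of_eq ?_))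
    push_cast
    ring
  have h3 := ENNReal.rpow_le_rpow h2 (z := 1 / 2) (by norm_num)
  rw [ENNReal_sq_rpow_half, ENNReal.mul_rpow_of_nonneg _ _ (by norm_num)] at h3
  refine h3.trans (le_of_eq ?_)
  rw [← ENNReal.coe_rpow_of_nonneg _ (by norm_num), ← ENNReal.coe_mul]
  congr 2
  rw [NNReal.mul_rpow]
  congr 1
  rw [hc, NNReal.mul_rpow, ← NNReal.rpow_mul, NNReal.div_rpow, ← NNReal.rpow_natCast,
    ← NNReal.rpow_mul]
  have : A ^ ((2 : ℕ) * (1 / 2) : ℝ) = A ^ (2 / 3 : ℝ) * A ^ (2 / 3 * (1 / 2) : ℝ) := by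
    rw [← NNReal.rpow_add hA]; norm_num
  rw [this]
  have h0 : A ^ (2 / 3 * (1 / 2) : ℝ) ≠ 0 := (NNReal.rpow_pos (pos_iff_ne_zero.2 hA)).ne'
  rw [show (1 / 3 : ℝ) = 2 / 3 * (1 / 2) by norm_num]
  field_simp

/-- Hardy's inequality for a dispersive map. -/
theorem exists_hardy : ∃ C : ℝ≥0, ∀ T : L2 → L2, Dispersive T 1 1 → ∀ f : L2,
    ∫⁻ x, (‖x‖ₑ⁻¹ * ‖T f x‖ₑ) ^ 2 ≤ C * weightMass f := by
  obtain ⟨C, hC⟩ := exists_tsum_mass_le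
  set v : ℝ≥0 := (volume (Metric.ball (0 : R3) 1)).toNNReal with hv
  have hv' : volume (Metric.ball (0 : R3) 1) = v := by
    rw [hv, ENNReal.coe_toNNReal measure_ball_lt_top.ne]
  refine ⟨(16 * v + 2) * C, fun T hT f => ?_⟩
  -- The shell |x| ~ 2^{-K} is paired with the cut of f at radius 2^K. On it |x|⁻² ≤ 2^{2K} and the
  -- volume is ≲ 2^{-3K}, so the bounded part contributes 2^{-K} times the squared inner mass and
  -- the L² part 2^{2K} times the outer mass: exactly the summands of `exists_tsum_mass_le`.
  set E : ℤ → Set R3 := fun K => Metric.ball 0 ((2 : ℝ) ^ (1 - K)) \ Metric.ball 0 ((2 : ℝ) ^ (-K))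
  have hE (K : ℤ) : MeasurableSet (E K) := measurableSet_ball.diff measurableSet_ball
  have hvol (K : ℤ) : volume (E K) ≤ 8 * twoPow (-(3 * K)) * v := by
    refine (measure_mono Set.sdiff_subset).trans (le_of_eq ?_)
    rw [Measure.addHaar_ball _ _ (by positivity), hv', finrank_euclideanSpace, Fintype.card_fin]
    congr 1
    have : (8 : ℝ≥0∞) = twoPow 3 := by norm_num [twoPow]
    rw [this, ← twoPow_add, twoPow_eq_ofReal]
    congr 1
    rw [← Real.rpow_intCast, ← Real.rpow_natCast, ← Real.rpow_mul (by norm_num)]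
    push_cast
    ring_nf
  have hshell (K : ℤ) : ∫⁻ x in E K, (‖x‖ₑ⁻¹ * ‖T f x‖ₑ) ^ 2 ≤
      (16 * v + 2) * (twoPow (-K) * innerMass f K ^ 2 + twoPow (2 * K) * outerMass f K) := by
    obtain ⟨g, b, hgb, hg, hb⟩ := hT.exists_split f K
    have hae : T f =ᵐ[volume] fun x => g x + b x := by rw [hgb]; exact Lp.coeFn_add g b
    calc ∫⁻ x in E K, (‖x‖ₑ⁻¹ * ‖T f x‖ₑ) ^ 2
        ≤ ∫⁻ x in E K, twoPow (2 * K) * (2 * (innerMass f K ^ 2 + ‖b x‖ₑ ^ 2)) := by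
          refine lintegral_mono_ae ?_
          filter_upwards [ae_restrict_of_ae hg, ae_restrict_of_ae hae, ae_restrict_mem (hE K)]
            with x h1 h2 h3
          rw [mul_pow]
          have hx : (2 : ℝ) ^ (-K) ≤ ‖x‖ := by simpa [E] using h3.2
          gcongr
          · have : twoPow (-K) ≤ ‖x‖ₑ := by
              rw [twoPow_eq_ofReal, ← ofReal_norm]
              exact ENNReal.ofReal_le_ofReal (by exact_mod_cast hx)
            calc (‖x‖ₑ⁻¹) ^ 2 ≤ ((twoPow (-K))⁻¹) ^ 2 := by gcongr
              _ = _ := by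
                rw [twoPow, ← ENNReal.rpow_neg, neg_neg]; exact twoPow_sq _
          · rw [h2]
            refine le_trans ?_ (ENNReal_add_sq_le _ _)
            gcongr
            refine (enorm_add_le _ _).trans ?_
            gcongr
            simpa using h1
      _ = twoPow (2 * K) * (2 * (innerMass f K ^ 2 * volume (E K) + ∫⁻ x in E K, ‖b x‖ₑ ^ 2)) := by
          rw [lintegral_const_mul' _ _ (twoPow_ne_top _), lintegral_const_mul' _ _ (by norm_num),
            lintegral_add_left measurable_const, lintegral_const, Measure.restrict_apply_univ]
      _ ≤ twoPow (2 * K) * (2 * (innerMass f K ^ 2 * (8 * twoPow (-(3 * K)) * v) +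
            outerMass f K)) := by
          gcongr
          · exact hvol K
          · refine (setLIntegral_le_lintegral _ _).trans ?_
            rw [lintegral_sq_eq_eLpNorm, ← ENNReal_rpow_half_sq (outerMass f K)]
            gcongr
            simpa using hb
      _ = 16 * v * (twoPow (2 * K) * twoPow (-(3 * K)) * innerMass f K ^ 2) +
            2 * (twoPow (2 * K) * outerMass f K) := by ring
      _ ≤ _ := by
          rw [← twoPow_add, show (2 * K + -(3 * K) : ℝ) = -K by ring, mul_add]
          gcongr
          · exact le_self_add
          · exact le_add_self
  have hcover : ∀ x : R3, x ≠ 0 → x ∈ ⋃ K, E K := fun x hx => by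
    obtain ⟨j, hj1, hj2⟩ := exists_mem_Ico_zpow (y := (2 : ℝ)) (norm_pos_iff.2 hx) (by norm_num)
    refine Set.mem_iUnion.2 ⟨-j, ?_⟩
    simp only [E, Set.mem_sdiff, mem_ball_zero_iff, neg_neg, not_lt, sub_neg_eq_add]
    exact ⟨by rwa [add_comm], hj1⟩
  calc ∫⁻ x, (‖x‖ₑ⁻¹ * ‖T f x‖ₑ) ^ 2 = ∫⁻ x in ⋃ K, E K, (‖x‖ₑ⁻¹ * ‖T f x‖ₑ) ^ 2 := by
        rw [← setLIntegral_univ]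
        refine setLIntegral_congr ?_
        filter_upwards [ae_ne_zero] with x hx
        exact propext ⟨fun _ => hcover x hx, fun _ => trivial⟩
    _ ≤ ∑' K, ∫⁻ x in E K, (‖x‖ₑ⁻¹ * ‖T f x‖ₑ) ^ 2 := lintegral_iUnion_le _ _
    _ ≤ ∑' K : ℤ, (16 * v + 2) *
          (twoPow (-K) * innerMass f K ^ 2 + twoPow (2 * K) * outerMass f K) :=
        ENNReal.tsum_le_tsum hshell
    _ ≤ _ := by
        rw [ENNReal.tsum_mul_left]
        push_cast
        rw [mul_assoc]
        gcongr
        exact hC f (Lp.aestronglyMeasurable f)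

/-! ### The Fourier transform on L² and on L¹ -/

lemma continuous_innerₗ : Continuous fun p : R3 × R3 => innerₗ R3 p.1 p.2 := by
  simp only [innerₗ_apply_apply]; fun_prop

open Real in
/-- The `L²` Fourier transform of an integrable function is its Fourier integral. -/
lemma fourier_ae_eq (f : L2) (hf : Integrable f) :
    (𝓕 f : L2) =ᵐ[volume] 𝓕 (f : R3 → ℂ) := by
  have hcont : Continuous (𝓕 (f : R3 → ℂ)) :=
    VectorFourier.fourierIntegral_continuous continuous_fourierChar continuous_innerₗ hf
  refine ae_eq_of_integral_contDiff_smul_eq ((Lp.memLp _).locallyIntegrable (by norm_num))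
    hcont.locallyIntegrable fun g hg hgc => ?_
  have hg₁ : HasCompactSupport (Complex.ofRealCLM ∘ g) := hgc.comp_left rfl
  have hg₂ : ContDiff ℝ (⊤ : ℕ∞) (Complex.ofRealCLM ∘ g) := Complex.ofRealCLM.contDiff.comp hg
  set φ : SchwartzMap R3 ℂ := hg₁.toSchwartzMap hg₂ with hφ
  -- Both sides are tested against smooth compactly supported functions. The L² transform obeys the
  -- multiplication formula ∫ φ f̂ = ∫ φ̂ f by its compatibility with tempered distributions, the
  -- Fourier integral by Fubini.
  have h1 := congrArg (fun D => D φ) (Lp.fourier_toTemperedDistribution_eq f)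
  simp only [TemperedDistribution.fourier_apply, Lp.toTemperedDistribution_apply] at h1
  have h2 := VectorFourier.integral_fourierIntegral_smul_eq_flip (μ := volume) (ν := volume)
    (L := innerₗ R3) (f := φ) (g := f) continuous_fourierChar continuous_innerₗ φ.integrable hf
  rw [flip_innerₗ] at h2
  calc ∫ x, g x • (𝓕 f : L2) x = ∫ x, φ x • (𝓕 f : L2) x := by simp [hφ]
    _ = ∫ x, (𝓕 φ) x • f x := h1.symm
    _ = ∫ x, φ x • 𝓕 (f : R3 → ℂ) x := h2
    _ = _ := by simp [hφ]

open Real in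
/-- The inverse `L²` Fourier transform of an integrable function is its inverse Fourier integral. -/
lemma fourierInv_ae_eq (f : L2) (hf : Integrable f) :
    (𝓕⁻ f : L2) =ᵐ[volume] 𝓕⁻ (f : R3 → ℂ) := by
  have hcont : Continuous (𝓕⁻ (f : R3 → ℂ)) :=
    VectorFourier.fourierIntegral_continuous (L := -innerₗ R3) continuous_fourierChar
      (by simp only [LinearMap.neg_apply, innerₗ_apply_apply]; fun_prop) hf
  refine ae_eq_of_integral_contDiff_smul_eq ((Lp.memLp _).locallyIntegrable (by norm_num))
    hcont.locallyIntegrable fun g hg hgc => ?_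
  have hg₁ : HasCompactSupport (Complex.ofRealCLM ∘ g) := hgc.comp_left rfl
  have hg₂ : ContDiff ℝ (⊤ : ℕ∞) (Complex.ofRealCLM ∘ g) := Complex.ofRealCLM.contDiff.comp hg
  set φ : SchwartzMap R3 ℂ := hg₁.toSchwartzMap hg₂ with hφ
  have h1 := congrArg (fun D => D φ) (Lp.fourierInv_toTemperedDistribution_eq f)
  simp only [TemperedDistribution.fourierInv_apply, Lp.toTemperedDistribution_apply] at h1
  have h2 := VectorFourier.integral_fourierIntegral_smul_eq_flip (μ := volume) (ν := volume)
    (L := -innerₗ R3) (f := φ) (g := f) continuous_fourierChar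
      (by simp only [LinearMap.neg_apply, innerₗ_apply_apply]; fun_prop) φ.integrable hf
  have h3 : (-innerₗ R3).flip = -innerₗ R3 := by
    ext x y; exact congrArg Neg.neg (real_inner_comm (F := R3) x y)
  rw [h3] at h2
  calc ∫ x, g x • (𝓕⁻ f : L2) x = ∫ x, φ x • (𝓕⁻ f : L2) x := by simp [hφ]
    _ = ∫ x, (𝓕⁻ φ) x • f x := h1.symm
    _ = ∫ x, φ x • 𝓕⁻ (f : R3 → ℂ) x := by
        refine Eq.trans (integral_congr_ae (.of_forall fun x => ?_)) h2
        rw [SchwartzMap.fourierInv_coe]; rfl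
    _ = _ := by simp [hφ]

lemma enorm_eq_eLpNorm (f : L2) : ‖f‖ₑ = eLpNorm f 2 volume := Lp.enorm_def f

lemma eLpNorm_fourier (f : L2) : eLpNorm (𝓕 f : L2) 2 volume = eLpNorm f 2 volume := by
  rw [← enorm_eq_eLpNorm, ← enorm_eq_eLpNorm, ← ofReal_norm, ← ofReal_norm, Lp.norm_fourier_eq]

lemma eLpNorm_fourierInv (f : L2) : eLpNorm (𝓕⁻ f : L2) 2 volume = eLpNorm f 2 volume := by
  rw [← eLpNorm_fourier, FourierTransform.fourier_fourierInv_eq]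

lemma integrable_of_eLpNorm_one_ne_top {f : L2} (hf : eLpNorm f 1 volume ≠ ∞) : Integrable f :=
  memLp_one_iff_integrable.1 ⟨Lp.aestronglyMeasurable f, lt_top_iff_ne_top.2 hf⟩

lemma enorm_fourierIntegral_le (f : R3 → ℂ) (x : R3) :
    ‖𝓕 f x‖ₑ ≤ eLpNorm f 1 volume := by
  rw [Real.fourier_eq, eLpNorm_one_eq_lintegral_enorm]
  refine (enorm_integral_le_lintegral_enorm _).trans (le_of_eq ?_)
  refine lintegral_congr fun y => ?_
  rw [← ofReal_norm, ← ofReal_norm, Circle.norm_smul]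

lemma enorm_fourierInvIntegral_le (f : R3 → ℂ) (x : R3) :
    ‖𝓕⁻ f x‖ₑ ≤ eLpNorm f 1 volume := by
  rw [Real.fourierInv_eq, eLpNorm_one_eq_lintegral_enorm]
  refine (enorm_integral_le_lintegral_enorm _).trans (le_of_eq ?_)
  refine lintegral_congr fun y => ?_
  rw [← ofReal_norm, ← ofReal_norm, Circle.norm_smul]

lemma eLpNorm_top_le_of_forall {g h : R3 → ℂ} {c : ℝ≥0∞} (hgh : g =ᵐ[volume] h)
    (hh : ∀ x, ‖h x‖ₑ ≤ c) : eLpNorm g ∞ volume ≤ c := by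
  rw [eLpNorm_congr_ae hgh, eLpNorm_exponent_top]
  exact essSup_le_of_ae_le _ (.of_forall hh)

/-- Plancherel's theorem and the trivial bound |f̂| ≤ ‖f‖₁. This instance feeds Hardy's inequality,
and the inverse transform below feeds the Sobolev embedding. -/
lemma dispersive_fourier : Dispersive (fun f => (𝓕 f : L2)) 1 1 where
  map_add f g := FourierTransform.fourier_add f g
  two_two f := by simp [eLpNorm_fourier]
  one_top f := by
    rcases eq_or_ne (eLpNorm f 1 volume) ∞ with h | h
    · simp [h]
    · rw [ENNReal.coe_one, one_mul]
      exact eLpNorm_top_le_of_forall (fourier_ae_eq f (integrable_of_eLpNorm_one_ne_top h))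
        (enorm_fourierIntegral_le f)

lemma dispersive_fourierInv : Dispersive (fun f => (𝓕⁻ f : L2)) 1 1 where
  map_add f g := FourierTransform.fourierInv_add f g
  two_two f := by simp [eLpNorm_fourierInv]
  one_top f := by
    rcases eq_or_ne (eLpNorm f 1 volume) ∞ with h | h
    · simp [h]
    · rw [ENNReal.coe_one, one_mul]
      exact eLpNorm_top_le_of_forall (fourierInv_ae_eq f (integrable_of_eLpNorm_one_ne_top h))
        (enorm_fourierInvIntegral_le f)

/-! ### Multipliers -/

lemma fourier_mult {m : R3 → ℂ} {f : L2} (h : MultDom m f) :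
    (𝓕 (mult m f) : L2) =ᵐ[volume] fun ξ => m ((2 * Real.pi) • ξ) * (𝓕 f : L2) ξ := by
  rw [mult, dif_pos h, FourierTransform.fourier_fourierInv_eq]
  exact h.coeFn_toLp

lemma mult_eq_of_fourier {m : R3 → ℂ} {f g : L2}
    (h : (𝓕 g : L2) =ᵐ[volume] fun ξ => m ((2 * Real.pi) • ξ) * (𝓕 f : L2) ξ) :
    MultDom m f ∧ mult m f = g := by
  have hd : MultDom m f := (memLp_congr_ae h).1 (Lp.memLp _)
  refine ⟨hd, ?_⟩
  have : (𝓕 (mult m f) : L2) = 𝓕 g := Lp.ext ((fourier_mult hd).trans h.symm)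
  exact (Lp.fourierTransformₗᵢ R3 ℂ).injective this

lemma eLpNorm_mult {m : R3 → ℂ} {f : L2} (h : MultDom m f) :
    eLpNorm (mult m f) 2 volume =
      eLpNorm (fun ξ => m ((2 * Real.pi) • ξ) * (𝓕 f : L2) ξ) 2 volume := by
  rw [← eLpNorm_fourier, eLpNorm_congr_ae (fourier_mult h)]

lemma aestronglyMeasurable_symbol {m : R3 → ℂ} (hm : Measurable m) (f : L2) :
    AEStronglyMeasurable (fun ξ => m ((2 * Real.pi) • ξ) * (𝓕 f : L2) ξ) :=
  (hm.comp (measurable_const_smul _)).aestronglyMeasurable.mul (Lp.aestronglyMeasurable _)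

lemma MultDom.mono {m n : R3 → ℂ} {f : L2} (hm : Measurable m) {c : ℝ}
    (hmn : ∀ ξ, ‖m ξ‖ ≤ c * ‖n ξ‖) (hn : MultDom n f) : MultDom m f :=
  MemLp.of_le_mul hn (aestronglyMeasurable_symbol hm f) (c := c) (.of_forall fun ξ => by
    rw [norm_mul, norm_mul, ← mul_assoc]
    gcongr
    exact hmn _)

lemma multDom_of_bounded {m : R3 → ℂ} (hm : Measurable m) {c : ℝ} (hc : ∀ ξ, ‖m ξ‖ ≤ c) (f : L2) :
    MultDom m f :=
  MemLp.of_le_mul (Lp.memLp (𝓕 f : L2)) (aestronglyMeasurable_symbol hm f) (c := c)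
    (.of_forall fun ξ => by
      rw [norm_mul]
      gcongr
      exact hc _)

lemma eLpNorm_mult_le {m n : R3 → ℂ} {f : L2} (hm : Measurable m) {c : ℝ≥0}
    (hmn : ∀ ξ, ‖m ξ‖ ≤ c * ‖n ξ‖) (hn : MultDom n f) :
    eLpNorm (mult m f) 2 volume ≤ c * eLpNorm (mult n f) 2 volume := by
  rw [eLpNorm_mult hn, eLpNorm_mult (hn.mono hm hmn)]
  have h : ∀ᵐ ξ : R3, ‖m ((2 * Real.pi) • ξ) * (𝓕 f : L2) ξ‖ ≤
      c * ‖n ((2 * Real.pi) • ξ) * (𝓕 f : L2) ξ‖ := .of_forall fun ξ => by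
    rw [norm_mul, norm_mul, ← mul_assoc]
    gcongr
    exact hmn _
  simpa using eLpNorm_le_mul_eLpNorm_of_ae_le_mul h 2

lemma mult_mult {m n k : R3 → ℂ} {f : L2} (hn : MultDom n f) (hk : MultDom k f)
    (hmn : ∀ ξ, m ξ * n ξ = k ξ) : MultDom m (mult n f) ∧ mult m (mult n f) = mult k f := by
  refine mult_eq_of_fourier ?_
  filter_upwards [fourier_mult hn, fourier_mult hk] with ξ h1 h2
  rw [h1, h2, ← hmn, mul_assoc]

lemma mult_one {m : R3 → ℂ} (hm : ∀ ξ, m ξ = 1) (f : L2) : mult m f = f :=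
  (mult_eq_of_fourier (.of_forall fun ξ => by simp [hm])).2

lemma mult_add_left {m n k : R3 → ℂ} {f : L2} (hm : MultDom m f) (hn : MultDom n f)
    (hk : ∀ ξ, k ξ = m ξ + n ξ) : mult k f = mult m f + mult n f := by
  refine (mult_eq_of_fourier ?_).2
  rw [FourierTransform.fourier_add]
  filter_upwards [Lp.coeFn_add (𝓕 (mult m f) : L2) (𝓕 (mult n f)), fourier_mult hm,
    fourier_mult hn] with ξ h1 h2 h3
  rw [h1, Pi.add_apply, h2, h3, hk, add_mul]

lemma mult_add_right {m : R3 → ℂ} {f g : L2} (hf : MultDom m f) (hg : MultDom m g) :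
    mult m (f + g) = mult m f + mult m g := by
  refine (mult_eq_of_fourier ?_).2
  rw [FourierTransform.fourier_add, FourierTransform.fourier_add]
  filter_upwards [Lp.coeFn_add (𝓕 (mult m f) : L2) (𝓕 (mult m g)), fourier_mult hf,
    fourier_mult hg, Lp.coeFn_add (𝓕 f : L2) (𝓕 g)] with ξ h1 h2 h3 h4
  rw [h1, h4, Pi.add_apply, Pi.add_apply, h2, h3, mul_add]

open Real in
/-- Multipliers with bounded kernel are dispersive. -/
lemma dispersive_mult {s : R3 → ℂ} (hs : Measurable s) {A B : ℝ≥0} (hA : A ≠ 0)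
    (hB : ∀ ξ, ‖s ξ‖ ≤ B)
    (hint : Integrable fun ξ : R3 => s ((2 * π) • ξ))
    (hker : ∀ x, ‖𝓕⁻ (fun ξ : R3 => s ((2 * π) • ξ)) x‖ ≤ A) : Dispersive (mult s) A B where
  map_add f g := mult_add_right (multDom_of_bounded hs hB f) (multDom_of_bounded hs hB g)
  two_two f := by
    have h := eLpNorm_mult_le (m := s) (n := fun _ => 1) (c := B) (f := f) hs (by simpa using hB)
      (multDom_of_bounded measurable_const (c := 1) (by simp) f)
    rwa [mult_one (fun _ => rfl)] at h
  one_top f := by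
    rcases eq_or_ne (eLpNorm f 1 volume) ∞ with h | h
    · rw [h, ENNReal.mul_top (by simpa using hA)]; exact le_top
    have hf := integrable_of_eLpNorm_one_ne_top h
    have hd := multDom_of_bounded hs hB f
    have hF : hd.toLp =ᵐ[volume] fun ξ => s ((2 * π) • ξ) * 𝓕 (f : R3 → ℂ) ξ := by
      filter_upwards [hd.coeFn_toLp, fourier_ae_eq f hf] with ξ h1 h2
      rw [h1, h2]
    have hcont : Continuous (𝓕 (f : R3 → ℂ)) :=
      VectorFourier.fourierIntegral_continuous continuous_fourierChar continuous_innerₗ hf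
    have hI : Integrable (fun ξ => s ((2 * π) • ξ) * 𝓕 (f : R3 → ℂ) ξ) := by
      refine hint.mul_bdd (c := (eLpNorm f 1 volume).toReal) hcont.aestronglyMeasurable
        (.of_forall fun ξ => ?_)
      rw [← toReal_enorm]
      exact ENNReal.toReal_mono h (enorm_fourierIntegral_le f ξ)
    have h1 : mult s f =ᵐ[volume] 𝓕⁻ (hd.toLp : R3 → ℂ) := by
      rw [mult, dif_pos hd]
      exact fourierInv_ae_eq _ (hI.congr hF.symm)
    refine eLpNorm_top_le_of_forall h1 fun x => ?_
    rw [Real.fourierInv_congr_ae hF]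
    -- With the character at x absorbed into the symbol, the multiplication formula moves the
    -- Fourier transform from f onto g. As 𝓕 g y is the kernel at x - y, the operator becomes a
    -- convolution with a bounded kernel.
    set g : R3 → ℂ := fun ξ => 𝐞 (inner ℝ ξ x) • s ((2 * π) • ξ) with hg
    have hgi : Integrable g := by
      refine (integrable_norm_iff ?_).1 ?_
      · exact (Continuous.aestronglyMeasurable (by fun_prop)).smul hint.aestronglyMeasurable
      · simpa [hg, Circle.norm_smul] using hint.norm
    have h2 := VectorFourier.integral_fourierIntegral_smul_eq_flip (μ := volume) (ν := volume)
      (L := innerₗ R3) (f := f) (g := g) continuous_fourierChar continuous_innerₗ hf hgi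
    rw [flip_innerₗ] at h2
    have h3 : 𝓕⁻ (fun ξ => s ((2 * π) • ξ) * 𝓕 (f : R3 → ℂ) ξ) x =
        ∫ y, f y • 𝓕 g y := by
      refine Eq.trans ?_ h2
      rw [Real.fourierInv_eq]
      refine integral_congr_ae (.of_forall fun ξ => ?_)
      simp only [hg, smul_eq_mul, Circle.smul_def]
      change _ = 𝓕 (f : R3 → ℂ) ξ * _
      ring
    have h4 (y : R3) : 𝓕 g y = 𝓕⁻ (fun ξ : R3 => s ((2 * π) • ξ)) (x - y) := by
      rw [Real.fourierInv_eq, Real.fourier_eq]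
      refine integral_congr_ae (.of_forall fun ξ => ?_)
      simp only [hg, smul_smul]
      rw [← AddChar.map_add_eq_mul, inner_sub_right]
      congr 2
      ring
    rw [h3, eLpNorm_one_eq_lintegral_enorm, ← lintegral_const_mul' _ _ (by simp)]
    refine (enorm_integral_le_lintegral_enorm _).trans (lintegral_mono fun y => ?_)
    rw [enorm_smul, mul_comm, h4]
    gcongr
    rw [← ofReal_norm, ← ENNReal.ofReal_coe_nnreal]
    exact ENNReal.ofReal_le_ofReal (hker _)

/-! ### The Fourier integral of a radial function -/

/-- Cylindrical coordinates `ℝ³ = ℝ × ℝ²`. -/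
def cylEquiv : R3 ≃ᵐ ℝ × (ℝ × ℝ) :=
  (MeasurableEquiv.toLp 2 (Fin 3 → ℝ)).symm.trans
    ((MeasurableEquiv.piFinSuccAbove (fun _ : Fin 3 => ℝ) 0).trans
      ((MeasurableEquiv.refl ℝ).prodCongr MeasurableEquiv.finTwoArrow))

lemma cylEquiv_apply (x : R3) : cylEquiv x = (x 0, x 1, x 2) := rfl

lemma measurePreserving_cylEquiv : MeasurePreserving cylEquiv := by
  have h1 := PiLp.volume_preserving_ofLp (Fin 3)
  have h2 := volume_preserving_piFinSuccAbove (fun _ : Fin 3 => ℝ) 0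
  have h3 := (MeasurePreserving.id (volume : Measure ℝ)).prod (volume_preserving_finTwoArrow ℝ)
  exact (h3.comp h2).comp h1

/-- Polar coordinates followed by the substitution r = √(s² + u²), for which r dr = u du: the
Jacobian has no singularity in r, a feature of codimension two. -/
lemma integral_radial_plane (g : ℝ → ℂ) (s : ℝ) :
    ∫ p : ℝ × ℝ, g (√(s ^ 2 + (p.1 ^ 2 + p.2 ^ 2))) =
      2 * Real.pi * ∫ r in Set.Ioi |s|, r * g r := by
  rw [← integral_comp_polarCoord_symm]
  have h1 : ∀ p ∈ polarCoord.target, p.1 • g (√(s ^ 2 + ((polarCoord.symm p).1 ^ 2 +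
      (polarCoord.symm p).2 ^ 2))) = (p.1 * g (√(s ^ 2 + p.1 ^ 2))) * 1 := fun p _ => by
    rw [polarCoord_symm_apply, mul_one, Complex.real_smul]
    congr 4
    linear_combination p.1 ^ 2 * Real.cos_sq_add_sin_sq p.2
  rw [setIntegral_congr_fun polarCoord.open_target.measurableSet h1, polarCoord_target,
    Measure.volume_eq_prod, setIntegral_prod_mul (f := fun u : ℝ => (u : ℂ) * g (√(s ^ 2 + u ^ 2)))
      (g := fun _ => (1 : ℂ))]
  have h2 : ∫ _ in Set.Ioo (-Real.pi) Real.pi, (1 : ℂ) = 2 * Real.pi := by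
    rw [setIntegral_const]
    simp [Real.pi_pos.le]
    ring
  rw [h2, mul_comm]
  congr 1
  set F : ℝ → ℝ := fun u => √(s ^ 2 + u ^ 2) with hF
  have hpos (u : ℝ) (hu : 0 < u) : 0 < s ^ 2 + u ^ 2 := by positivity
  have himg : F '' Set.Ioi 0 = Set.Ioi |s| := by
    ext r
    constructor
    · rintro ⟨u, hu, rfl⟩
      have hu' : (0 : ℝ) < u := hu
      exact Real.lt_sqrt_of_sq_lt (by rw [sq_abs]; nlinarith)
    · intro (hr : |s| < r)
      have hr0 : 0 ≤ r := (abs_nonneg s).trans hr.le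
      have h3 : s ^ 2 < r ^ 2 := by rw [← sq_abs s]; gcongr
      refine ⟨√(r ^ 2 - s ^ 2), Real.sqrt_pos.2 (by linarith), ?_⟩
      simp only [hF]
      rw [Real.sq_sqrt (by linarith), add_sub_cancel, Real.sqrt_sq hr0]
  have hderiv : ∀ u ∈ Set.Ioi (0 : ℝ), HasDerivWithinAt F (u / F u) (Set.Ioi 0) u := fun u hu => by
    have := ((hasDerivAt_pow 2 u).const_add (s ^ 2)).sqrt (hpos u hu).ne'
    have h0 : 0 < √(s ^ 2 + u ^ 2) := Real.sqrt_pos.2 (hpos u hu)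
    refine (this.congr_deriv ?_).hasDerivWithinAt
    simp only [hF]
    field_simp
    norm_num
  have hinj : Set.InjOn F (Set.Ioi 0) := by
    intro u hu v hv h
    have hu' : (0 : ℝ) < u := hu
    have hv' : (0 : ℝ) < v := hv
    have := (Real.sqrt_inj (hpos u hu).le (hpos v hv).le).1 h
    nlinarith
  rw [← himg, integral_image_eq_integral_abs_deriv_smul measurableSet_Ioi hderiv hinj]
  refine setIntegral_congr_fun measurableSet_Ioi fun u hu => ?_
  have hFu : 0 < F u := Real.sqrt_pos.2 (hpos u hu)
  have hu' : (0 : ℝ) < u := hu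
  rw [abs_of_nonneg (by positivity), Complex.real_smul, ← mul_assoc]
  congr 1
  rw [Complex.ofReal_div, div_mul_cancel₀ _ (by exact_mod_cast hFu.ne')]

/-- The Fourier integral of a radial function of `ℝ³`. -/
lemma integral_exp_mul_radial (g : ℝ → ℂ) (hg : Integrable fun ξ : R3 => g ‖ξ‖) (x : R3) :
    ∫ ξ : R3, Complex.exp (Complex.I * (inner ℝ x ξ : ℝ)) * g ‖ξ‖ =
      2 * Real.pi * ∫ r in Set.Ioi (0 : ℝ), r * g r *
        ∫ s in (-r)..r, Complex.exp (Complex.I * (‖x‖ * s : ℝ)) := by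
  set ρ := ‖x‖ with hρ
  set e : ℝ → ℂ := fun s => Complex.exp (Complex.I * (ρ * s : ℝ)) with he
  have hee (s : ℝ) : ‖e s‖ = 1 := by
    simp only [he]; rw [mul_comm, Complex.norm_exp_ofReal_mul_I]
  have hec : Continuous e := by fun_prop
  set y : R3 := ρ • EuclideanSpace.single 0 1 with hy
  have hyx : ‖y‖ = ‖x‖ := by simp [hy, norm_smul, hρ]
  -- The reflection in the hyperplane orthogonal to y - x exchanges y and x, two vectors of equal
  -- length, so the frequency integral may be computed with x along the first axis.
  set R := (Submodule.span ℝ {y - x})ᗮ.reflection with hR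
  have hRy : R y = x := Submodule.reflection_sub hyx
  have hrot : ∫ ξ : R3, Complex.exp (Complex.I * (inner ℝ x ξ : ℝ)) * g ‖ξ‖ =
      ∫ ξ : R3, e (ξ 0) * g ‖ξ‖ := by
    rw [← R.measurePreserving.integral_comp R.toMeasurableEquiv.measurableEmbedding]
    refine integral_congr_ae (.of_forall fun ξ => ?_)
    simp only
    rw [← hRy, R.inner_map_map, R.norm_map, hy, inner_smul_left, EuclideanSpace.inner_single_left]
    simp [he]
  have hnorm (ξ : R3) : ‖ξ‖ = √((ξ 0) ^ 2 + ((ξ 1) ^ 2 + (ξ 2) ^ 2)) := by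
    rw [EuclideanSpace.norm_eq, Fin.sum_univ_three]
    simp [add_assoc]
  have hg1 : Integrable fun ξ : R3 => e (ξ 0) * g ‖ξ‖ := by
    refine hg.bdd_mul (c := 1) ?_ (.of_forall fun ξ => (hee _).le)
    exact (hec.comp (by fun_prop : Continuous fun ξ : R3 => ξ 0)).aestronglyMeasurable
  set G : ℝ × (ℝ × ℝ) → ℂ := fun p => e p.1 * g (√(p.1 ^ 2 + (p.2.1 ^ 2 + p.2.2 ^ 2))) with hG
  have hGc : (fun ξ : R3 => e (ξ 0) * g ‖ξ‖) = G ∘ cylEquiv := by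
    ext ξ
    simp only [Function.comp, cylEquiv_apply, hG, hnorm]
  have hGi : Integrable G := by
    rw [hGc] at hg1
    exact (measurePreserving_cylEquiv.integrable_comp_emb cylEquiv.measurableEmbedding).1 hg1
  have hrad : IntegrableOn (fun r : ℝ => r ^ 2 • g r) (Set.Ioi 0) := by
    simpa using (integrable_fun_norm_addHaar (volume : Measure R3) (f := g)).1 hg
  -- The integral over the planes ξ₀ = s leaves a double integral over |s| < r. Integrating in s
  -- first produces the interval from -r to r of the statement.
  set k : ℝ × ℝ → ℂ := fun p => {p : ℝ × ℝ | |p.1| < p.2}.indicator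
    (fun p => e p.1 * (p.2 * g p.2)) p with hk
  have hmeasS : MeasurableSet {p : ℝ × ℝ | |p.1| < p.2} :=
    measurableSet_lt (by fun_prop) (by fun_prop)
  have hrg : AEStronglyMeasurable (fun r : ℝ => (r : ℂ) * g r)
      (volume.restrict (Set.Ioi 0)) := by
    have h1 : AEStronglyMeasurable (fun r : ℝ => ((r⁻¹ : ℝ) : ℂ) * (r ^ 2 • g r))
        (volume.restrict (Set.Ioi 0)) := by
      refine AEStronglyMeasurable.mul ?_ hrad.aestronglyMeasurable
      exact (Complex.measurable_ofReal.comp measurable_inv).aestronglyMeasurable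
    refine h1.congr ((ae_restrict_iff' measurableSet_Ioi).2 (.of_forall fun r hr => ?_))
    have hr' : (r : ℂ) ≠ 0 := by exact_mod_cast (ne_of_gt hr)
    simp only [Complex.real_smul]
    push_cast
    field_simp
  have hslice (r : ℝ) (s : ℝ) : k (s, r) = (Set.Ioo (-r) r).indicator e s * (r * g r) := by
    simp only [hk, Set.indicator, Set.mem_Ioo, ← abs_lt, Set.mem_ofPred_eq]
    split_ifs <;> simp
  have hki : Integrable k ((volume : Measure ℝ).prod (volume.restrict (Set.Ioi 0))) := by
    rw [integrable_prod_iff']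
    · constructor
      · refine .of_forall fun r => ?_
        simp_rw [hslice]
        refine Integrable.mul_const ?_ _
        rw [integrable_indicator_iff measurableSet_Ioo]
        exact (hec.integrableOn_Icc).mono_set Set.Ioo_subset_Icc_self
      -- The slice at height r has length 2r and integrand of modulus |r g(r)|, so its mass is 2|r²
      -- g(r)|, which is integrable because g(|ξ|) is integrable on ℝ³.
      · have : IntegrableOn (fun r : ℝ => 2 * ‖r ^ 2 • g r‖) (Set.Ioi 0) := hrad.norm.const_mul 2
        refine this.congr_fun (fun r hr => ?_) measurableSet_Ioi
        have hr' : (0 : ℝ) < r := hr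
        simp_rw [hslice, norm_mul, integral_mul_const, norm_indicator_eq_indicator_norm, hee]
        rw [integral_indicator measurableSet_Ioo, setIntegral_const]
        simp [abs_of_pos hr', hr'.le]
        ring
    · refine AEStronglyMeasurable.indicator ?_ hmeasS
      exact (hec.comp continuous_fst).aestronglyMeasurable.mul hrg.comp_snd
  have hcomp := measurePreserving_cylEquiv.integral_comp cylEquiv.measurableEmbedding G
  rw [hrot, hGc, Function.comp_def, hcomp,
    Measure.volume_eq_prod, integral_prod _ hGi]
  calc ∫ s, ∫ p : ℝ × ℝ, G (s, p) = ∫ s, 2 * Real.pi * ∫ r in Set.Ioi 0, k (s, r) := by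
        refine integral_congr_ae (.of_forall fun s => ?_)
        simp only [hG]
        rw [integral_const_mul, integral_radial_plane, mul_left_comm, ← integral_const_mul]
        congr 1
        rw [← integral_indicator measurableSet_Ioi, ← integral_indicator measurableSet_Ioi]
        refine integral_congr_ae (.of_forall fun r => ?_)
        simp only [hk, Set.indicator, Set.mem_Ioi, Set.mem_ofPred_eq]
        split_ifs with h1 h2 h2
        · rfl
        · exact absurd ((abs_nonneg s).trans_lt h1) h2
        · rfl
        · rfl
    _ = 2 * Real.pi * ∫ r in Set.Ioi 0, ∫ s, k (s, r) := by
        rw [integral_const_mul, integral_integral_swap hki]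
    _ = _ := by
        congr 1
        refine setIntegral_congr_fun measurableSet_Ioi fun r hr => ?_
        have hr' : (0 : ℝ) < r := hr
        simp only [hslice]
        rw [integral_mul_const, mul_comm, integral_indicator measurableSet_Ioo,
          ← integral_Ioc_eq_integral_Ioo, ← intervalIntegral.integral_of_le (by linarith)]

/-! ### Van der Corput's lemma -/

/-- The integrand is the derivative of -κ⁻¹ arctan(q/κ), and arctan varies by at most π whatever the
interval. -/
lemma integral_inv_sq_add_sq_le {q q' : ℝ → ℝ} {a b κ : ℝ} (hκ : 0 < κ)
    (hq : ∀ r, HasDerivAt q (q' r) r) (hqc : Continuous q') :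
    ∫ r in a..b, -q' r / (q r ^ 2 + κ ^ 2) ≤ Real.pi / κ := by
  have hd (r : ℝ) : HasDerivAt (fun r => -(κ⁻¹ * Real.arctan (q r / κ)))
      (-q' r / (q r ^ 2 + κ ^ 2)) r := by
    have := (((hq r).div_const κ).arctan.const_mul κ⁻¹).neg
    refine this.congr_deriv ?_
    have : 0 < q r ^ 2 + κ ^ 2 := by positivity
    field_simp
    ring
  have hqc' : Continuous q := continuous_iff_continuousAt.2 fun r => (hq r).continuousAt
  have hcont : Continuous fun r => -q' r / (q r ^ 2 + κ ^ 2) :=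
    hqc.neg.div (by fun_prop) fun r => by positivity
  rw [intervalIntegral.integral_eq_sub_of_hasDerivAt (fun r _ => hd r)
    (hcont.intervalIntegrable _ _)]
  have h1 := Real.arctan_lt_pi_div_two (q a / κ)
  have h2 := Real.neg_pi_div_two_lt_arctan (q b / κ)
  have : -(κ⁻¹ * Real.arctan (q b / κ)) - -(κ⁻¹ * Real.arctan (q a / κ)) =
      (Real.arctan (q a / κ) - Real.arctan (q b / κ)) / κ := by ring
  rw [this]
  gcongr
  linarith

lemma norm_exp_I_mul (x : ℝ) : ‖Complex.exp (Complex.I * x)‖ = 1 := by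
  rw [mul_comm, Complex.norm_exp_ofReal_mul_I]

/-- Van der Corput's second derivative test, for an amplitude vanishing at the endpoints. -/
lemma norm_integral_exp_mul_le {p q q' A A' : ℝ → ℝ} {a b κ V : ℝ} (hab : a ≤ b) (hκ : 0 < κ)
    (hp : ∀ r, HasDerivAt p (q r) r) (hq : ∀ r, HasDerivAt q (q' r) r) (hqc : Continuous q')
    (hlow : ∀ r ∈ Set.Icc a b, q' r ≤ -κ ^ 2)
    (hA : ∀ r, HasDerivAt A (A' r) r) (hAc : Continuous A') (ha : A a = 0) (hb : A b = 0)
    (hV : ∫ r in a..b, |A' r| ≤ V) :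
    ‖∫ r in a..b, Complex.exp (Complex.I * p r) * A r‖ ≤ 8 / κ * V := by
  have hpc : Continuous p := continuous_iff_continuousAt.2 fun r => (hp r).continuousAt
  have hqc' : Continuous q := continuous_iff_continuousAt.2 fun r => (hq r).continuousAt
  have hAc' : Continuous A := continuous_iff_continuousAt.2 fun r => (hA r).continuousAt
  have hD (r : ℝ) : 0 < q r ^ 2 + κ ^ 2 := by positivity
  -- The identity 1 = κ²/(q² + κ²) + q w is a smooth replacement for cutting out a neighbourhood of
  -- the stationary point. The first term is concentrated where |q| ≲ κ, and in the second q e^{ip}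
  -- is, up to a factor -i, the derivative of e^{ip}, so that one can integrate by parts.
  set w : ℝ → ℝ := fun r => q r / (q r ^ 2 + κ ^ 2) with hw
  set w' : ℝ → ℝ := fun r => q' r * (κ ^ 2 - q r ^ 2) / (q r ^ 2 + κ ^ 2) ^ 2 with hw'
  have hwd (r : ℝ) : HasDerivAt w (w' r) r := by
    have := (hq r).div (((hq r).pow 2).add_const (κ ^ 2)) (hD r).ne'
    refine this.congr_deriv ?_
    simp only [hw']
    simp only [Pi.pow_apply]
    congr 1
    push_cast
    ring
  have hwc : Continuous w := hqc'.div (by fun_prop) fun r => (hD r).ne'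
  have hwc' : Continuous w' := Continuous.div (by fun_prop) (by fun_prop)
    fun r => (pow_pos (hD r) 2).ne'
  set E : ℝ → ℂ := fun r => Complex.exp (Complex.I * p r) with hE
  have hEn (r : ℝ) : ‖E r‖ = 1 := norm_exp_I_mul _
  have hEc : Continuous E := by fun_prop
  have hEd (r : ℝ) : HasDerivAt E (E r * (Complex.I * q r)) r :=
    ((hp r).ofReal_comp.const_mul Complex.I).cexp
  have hWd (r : ℝ) : HasDerivAt (fun r => E r * ((w r * A r : ℝ) : ℂ))
      (E r * (Complex.I * q r) * ((w r * A r : ℝ) : ℂ) +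
        E r * ((w' r * A r + w r * A' r : ℝ) : ℂ)) r :=
    (hEd r).mul ((hwd r).mul (hA r)).ofReal_comp
  have hW0 := intervalIntegral.integral_eq_sub_of_hasDerivAt (a := a) (b := b) (fun r _ => hWd r)
    (Continuous.intervalIntegrable (by fun_prop) _ _)
  rw [ha, hb] at hW0
  simp only [mul_zero, Complex.ofReal_zero, sub_zero] at hW0
  have hsplit : ∫ r in a..b, E r * A r = ∫ r in a..b, (E r * ((κ ^ 2 / (q r ^ 2 + κ ^ 2) * A r : ℝ) : ℂ)
      + Complex.I * (E r * ((w' r * A r + w r * A' r : ℝ) : ℂ))) := by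
    rw [← sub_eq_zero, ← intervalIntegral.integral_sub, ← mul_zero (-Complex.I), ← hW0,
      ← intervalIntegral.integral_const_mul]
    · refine intervalIntegral.integral_congr fun r _ => ?_
      have h1 : A r = κ ^ 2 / (q r ^ 2 + κ ^ 2) * A r + q r * (w r * A r) := by
        simp only [hw]
        have := hD r
        field_simp
        ring
      generalize w' r * A r + w r * A' r = z
      generalize κ ^ 2 / (q r ^ 2 + κ ^ 2) * A r = y at h1
      generalize w r * A r = v at h1
      rw [h1]
      push_cast
      linear_combination (E r * q r * v) * Complex.I_sq
    · exact Continuous.intervalIntegrable (by fun_prop) _ _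
    · refine Continuous.intervalIntegrable ?_ _ _
      have : Continuous fun r => κ ^ 2 / (q r ^ 2 + κ ^ 2) :=
        continuous_const.div (by fun_prop) fun r => (hD r).ne'
      fun_prop
  have hAb (r : ℝ) (hr : r ∈ Set.Icc a b) : |A r| ≤ V := by
    have h1 := intervalIntegral.integral_eq_sub_of_hasDerivAt (a := a) (b := r) (fun r _ => hA r)
      (hAc.intervalIntegrable _ _)
    rw [ha, sub_zero] at h1
    rw [← h1]
    refine (intervalIntegral.abs_integral_le_integral_abs hr.1).trans (le_trans ?_ hV)
    exact intervalIntegral.integral_mono_interval le_rfl hr.1 hr.2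
      (.of_forall fun _ => abs_nonneg _) (hAc.abs.intervalIntegrable _ _)
  have hV0 : 0 ≤ V := (abs_nonneg _).trans (hAb a ⟨le_rfl, hab⟩)
  -- As A vanishes at a, |A| ≤ V. Since -q' ≥ κ², both κ²/(q² + κ²) and |w'| are at most -q'/(q² +
  -- κ²), whose integral is at most π/κ, while |w| ≤ 1/κ.
  have hmaj : ∀ r ∈ Set.Icc a b, ‖E r * ((κ ^ 2 / (q r ^ 2 + κ ^ 2) * A r : ℝ) : ℂ)
      + Complex.I * (E r * ((w' r * A r + w r * A' r : ℝ) : ℂ))‖ ≤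
      2 * V * (-q' r / (q r ^ 2 + κ ^ 2)) + 1 / κ * |A' r| := fun r hr => by
    have hq'0 : κ ^ 2 ≤ -q' r := by linarith [hlow r hr]
    have hq'1 : 0 ≤ -q' r := (sq_nonneg κ).trans hq'0
    have e1 : |κ ^ 2 / (q r ^ 2 + κ ^ 2) * A r| ≤ V * (-q' r / (q r ^ 2 + κ ^ 2)) := by
      rw [abs_mul, mul_comm, abs_of_nonneg (a := κ ^ 2 / _) (by positivity)]
      refine mul_le_mul (hAb r hr) ?_ (by positivity) hV0
      gcongr
    have e2 : |w' r * A r| ≤ V * (-q' r / (q r ^ 2 + κ ^ 2)) := by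
      rw [abs_mul, mul_comm]
      refine mul_le_mul (hAb r hr) ?_ (abs_nonneg _) hV0
      simp only [hw']
      rw [abs_div, abs_mul, abs_of_nonneg (sq_nonneg (q r ^ 2 + κ ^ 2)), ← abs_neg (q' r),
        abs_of_nonneg hq'1, div_le_div_iff₀ (pow_pos (hD r) 2) (hD r)]
      have : |κ ^ 2 - q r ^ 2| ≤ q r ^ 2 + κ ^ 2 := by
        rw [abs_le]; constructor <;> nlinarith [sq_nonneg κ, sq_nonneg (q r)]
      calc -q' r * |κ ^ 2 - q r ^ 2| * (q r ^ 2 + κ ^ 2)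
          ≤ -q' r * (q r ^ 2 + κ ^ 2) * (q r ^ 2 + κ ^ 2) := by gcongr
        _ = _ := by ring
    have e3 : |w r * A' r| ≤ 1 / κ * |A' r| := by
      rw [abs_mul]
      gcongr
      simp only [hw]
      rw [abs_div, abs_of_pos (hD r), div_le_div_iff₀ (hD r) hκ]
      nlinarith [sq_nonneg (|q r| - κ), sq_abs (q r), abs_nonneg (q r)]
    refine (norm_add_le _ _).trans ?_
    rw [norm_mul, norm_mul, norm_mul, hEn, Complex.norm_I, Complex.norm_real, Complex.norm_real,
      one_mul, one_mul, one_mul, Real.norm_eq_abs, Real.norm_eq_abs]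
    linarith [abs_add_le (w' r * A r) (w r * A' r)]
  have hcq : Continuous fun r => -q' r / (q r ^ 2 + κ ^ 2) :=
    hqc.neg.div (by fun_prop) fun r => (hD r).ne'
  have hfin : ‖∫ r in a..b, E r * A r‖ ≤ 2 * V * (Real.pi / κ) + 1 / κ * V := by
    rw [hsplit]
    refine (intervalIntegral.norm_integral_le_of_norm_le hab
      (.of_forall fun r hr => hmaj r ⟨hr.1.le, hr.2⟩)
      (Continuous.intervalIntegrable (by fun_prop) _ _)).trans ?_
    rw [intervalIntegral.integral_add, intervalIntegral.integral_const_mul,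
      intervalIntegral.integral_const_mul]
    · gcongr
      exact integral_inv_sq_add_sq_le hκ hq hqc
    · exact Continuous.intervalIntegrable (by fun_prop) _ _
    · exact Continuous.intervalIntegrable (by fun_prop) _ _
  refine hfin.trans ?_
  have : 2 * V * (Real.pi / κ) + 1 / κ * V = (2 * Real.pi + 1) / κ * V := by ring
  rw [this]
  gcongr
  -- The constant 8 is room for 2π + 1.
  linarith [Real.pi_lt_d2]

/-! ### The dispersion relation -/

/-- The radial profile of the dispersion relation. -/
def disp (r : ℝ) : ℝ := r * √(2 + r ^ 2)

/-- The first derivative of the dispersion relation. -/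
def disp' (r : ℝ) : ℝ := 2 * (1 + r ^ 2) / √(2 + r ^ 2)

/-- The second derivative of the dispersion relation. -/
def disp'' (r : ℝ) : ℝ := r * (6 + 2 * r ^ 2) / ((2 + r ^ 2) * √(2 + r ^ 2))

lemma hasDerivAt_sqrt_two_add_sq (r : ℝ) :
    HasDerivAt (fun r : ℝ => √(2 + r ^ 2)) (r / √(2 + r ^ 2)) r := by
  have h := ((hasDerivAt_pow 2 r).const_add 2).sqrt (by positivity : (2 + r ^ 2 : ℝ) ≠ 0)
  refine h.congr_deriv ?_
  field_simp
  norm_num [mul_comm]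

lemma hasDerivAt_disp (r : ℝ) : HasDerivAt disp (disp' r) r := by
  have h := (hasDerivAt_id r).mul (hasDerivAt_sqrt_two_add_sq r)
  refine h.congr_deriv ?_
  have h0 : 0 < √(2 + r ^ 2) := Real.sqrt_pos.2 (by positivity)
  have h1 := Real.sq_sqrt (by positivity : (0 : ℝ) ≤ 2 + r ^ 2)
  simp only [disp', id]
  field_simp
  linear_combination h1

lemma hasDerivAt_disp' (r : ℝ) : HasDerivAt disp' (disp'' r) r := by
  have h0 : 0 < √(2 + r ^ 2) := Real.sqrt_pos.2 (by positivity)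
  have h := (((hasDerivAt_pow 2 r).const_add 1).const_mul 2).div (hasDerivAt_sqrt_two_add_sq r) h0.ne'
  refine h.congr_deriv ?_
  have h1 := Real.sq_sqrt (by positivity : (0 : ℝ) ≤ 2 + r ^ 2)
  simp only [disp'']
  rw [div_eq_div_iff (by positivity) (by positivity)]
  field_simp
  push_cast
  rw [h1]
  ring

lemma continuous_disp'' : Continuous disp'' :=
  Continuous.div (by fun_prop) (by fun_prop) fun r => by positivity

lemma continuous_disp' : Continuous disp' :=
  continuous_iff_continuousAt.2 fun r => (hasDerivAt_disp' r).continuousAt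

lemma continuous_disp : Continuous disp :=
  continuous_iff_continuousAt.2 fun r => (hasDerivAt_disp r).continuousAt

/-- The second derivative vanishes linearly at r = 0 and tends to 2 at infinity, so on r ≥ N/4 it is
bounded below by a multiple of N. The absence of an upper limit on r lets N = 1 serve for all high
frequencies. -/
lemma le_disp'' {N r : ℝ} (hN0 : 0 < N) (hN : N ≤ 1) (hr : N / 4 ≤ r) : N / 3 ≤ disp'' r := by
  have hr0 : 0 < r := by linarith
  have hs : √(2 + r ^ 2) ≤ 6 * r / N := by
    rw [Real.sqrt_le_left (by positivity), div_pow, le_div_iff₀ (by positivity)]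
    nlinarith [mul_le_mul_of_nonneg_left (pow_le_one₀ hN0.le hN : N ^ 2 ≤ 1) (sq_nonneg r)]
  rw [disp'', le_div_iff₀ (by positivity)]
  have hs' : N * √(2 + r ^ 2) ≤ 6 * r := by rwa [le_div_iff₀ hN0, mul_comm] at hs
  nlinarith [mul_le_mul_of_nonneg_left hs' (by positivity : (0 : ℝ) ≤ 2 + r ^ 2)]

/-! ### Amplitudes, spherical means and the decay of the oscillatory integral -/

/-- Scale-invariant bounds for radial amplitudes. -/
structure Ampl (n : ℝ → ℝ) (M : ℝ) : Prop where
  contDiff : ContDiff ℝ 2 n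
  bdd : ∀ r, |n r| ≤ M
  bdd_deriv : ∀ r, |r * deriv n r| ≤ M
  integrable : Integrable (deriv n)
  integral_le : ∫ r, |deriv n r| ≤ M
  integrable' : Integrable (deriv fun r => r * deriv n r)
  integral_le' : ∫ r, |deriv (fun r => r * deriv n r) r| ≤ M

/-- The Fourier integral of a symbol on `(0, ∞)` against the spherical means of characters. -/
def sphMean (ρ r : ℝ) : ℂ := ∫ s in (-r)..r, Complex.exp (Complex.I * (ρ * s : ℝ))

lemma continuous_char (ρ : ℝ) : Continuous fun s : ℝ => Complex.exp (Complex.I * (ρ * s : ℝ)) := by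
  fun_prop

lemma hasDerivAt_sphMean (ρ r : ℝ) : HasDerivAt (sphMean ρ)
    (Complex.exp (Complex.I * (ρ * r : ℝ)) + Complex.exp (Complex.I * (-ρ * r : ℝ))) r := by
  have hc := continuous_char ρ
  have h1 (r : ℝ) : HasDerivAt (fun r => ∫ s in (0 : ℝ)..r, Complex.exp (Complex.I * (ρ * s : ℝ)))
      (Complex.exp (Complex.I * (ρ * r : ℝ))) r :=
    intervalIntegral.integral_hasDerivAt_right (hc.intervalIntegrable _ _)
      (hc.stronglyMeasurableAtFilter _ _) hc.continuousAt
  have h2 : sphMean ρ = fun r => (∫ s in (0 : ℝ)..r, Complex.exp (Complex.I * (ρ * s : ℝ))) -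
      ∫ s in (0 : ℝ)..(-r), Complex.exp (Complex.I * (ρ * s : ℝ)) := by
    ext r
    rw [sphMean, intervalIntegral.integral_interval_sub_left] <;>
      exact hc.intervalIntegrable _ _
  rw [h2]
  have h3 := (h1 (-r)).scomp r (hasDerivAt_neg r)
  refine ((h1 r).sub h3).congr_deriv ?_
  simp

lemma continuous_sphMean (ρ : ℝ) : Continuous (sphMean ρ) :=
  continuous_iff_continuousAt.2 fun r => (hasDerivAt_sphMean ρ r).continuousAt

lemma norm_sphMean_le (ρ : ℝ) {r : ℝ} (hr : 0 ≤ r) : ‖sphMean ρ r‖ ≤ 2 * r := by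
  have := intervalIntegral.norm_integral_le_of_norm_le_const (a := -r) (b := r) (C := 1)
    (f := fun s : ℝ => Complex.exp (Complex.I * (ρ * s : ℝ))) fun s _ => (norm_exp_I_mul _).le
  rw [abs_of_nonneg (by linarith)] at this
  rw [sphMean]
  linarith

/-- After rescaling, the r-dependence is an amplitude r times characters that are linear in r;
adding a linear term to the phase leaves its second derivative unchanged. -/
lemma sphMean_eq (ρ r : ℝ) : sphMean ρ r =
    ∫ σ in (-1 : ℝ)..1, r * Complex.exp (Complex.I * (ρ * σ * r : ℝ)) := by
  have h := intervalIntegral.smul_integral_comp_mul_left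
    (fun s : ℝ => Complex.exp (Complex.I * (ρ * s : ℝ))) r (a := -1) (b := 1)
  rw [sphMean, intervalIntegral.integral_const_mul]
  simp only [mul_neg, mul_one] at h
  rw [← h, Complex.real_smul]
  congr 1
  refine intervalIntegral.integral_congr fun σ _ => ?_
  congr 3
  ring

section Kernel

variable {n : ℝ → ℝ} {t a b : ℝ}

/-- The oscillatory integral representing the kernel of `e^{-itH}` with radial amplitude `n`. -/
def oscInt (n : ℝ → ℝ) (t ρ a b : ℝ) : ℂ :=
  ∫ r in a..b, ((disp' r * n r : ℝ) : ℂ) * Complex.exp (Complex.I * (-t * disp r : ℝ)) * sphMean ρ r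

lemma disp'_nonneg (r : ℝ) : 0 ≤ disp' r := by unfold disp'; positivity

lemma norm_oscInt_le_trivial (hn : Continuous n) (ρ : ℝ) (ha : 0 ≤ a) (hab : a ≤ b) :
    ‖oscInt n t ρ a b‖ ≤ ∫ r in a..b, disp' r * |n r| * (2 * r) := by
  have hd := continuous_disp'
  refine intervalIntegral.norm_integral_le_of_norm_le hab (.of_forall fun r hr => ?_)
    (Continuous.intervalIntegrable (by fun_prop) _ _)
  rw [norm_mul, norm_mul, norm_exp_I_mul, Complex.norm_real, mul_one, Real.norm_eq_abs, abs_mul,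
    abs_of_nonneg (disp'_nonneg r)]
  gcongr
  · exact mul_nonneg (disp'_nonneg r) (abs_nonneg _)
  · exact norm_sphMean_le ρ (ha.trans hr.1.le)

/-- Integration by parts in the radial variable. -/
lemma oscInt_eq (hn : ContDiff ℝ 2 n) (ρ : ℝ) (hna : n a = 0) (hnb : n b = 0) :
    t * oscInt n t ρ a b = -Complex.I * ∫ r in a..b, Complex.exp (Complex.I * (-t * disp r : ℝ)) *
      ((deriv n r : ℝ) * sphMean ρ r + n r * (Complex.exp (Complex.I * (ρ * r : ℝ)) +
        Complex.exp (Complex.I * (-ρ * r : ℝ)))) := by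
  have hd := continuous_disp'
  have hd0 := continuous_disp
  have hS := continuous_sphMean ρ
  have hn0 := hn.continuous
  have hn1 : Continuous (deriv n) := hn.continuous_deriv (by norm_num)
  have hnd (r : ℝ) : HasDerivAt n (deriv n r) r :=
    (hn.differentiable (by norm_num) r).hasDerivAt
  -- The factor h' in the integrand makes h'e^{-ith} an exact derivative divided by -it, whence the
  -- factor t on the left of the identity.
  have hE (r : ℝ) : HasDerivAt (fun r => Complex.exp (Complex.I * (-t * disp r : ℝ)))
      (Complex.exp (Complex.I * (-t * disp r : ℝ)) * (Complex.I * (-t * disp' r : ℝ))) r :=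
    ((((hasDerivAt_disp r).const_mul (-t)).ofReal_comp).const_mul Complex.I).cexp
  have hF (r : ℝ) := (hE r).mul ((hnd r).ofReal_comp.mul (hasDerivAt_sphMean ρ r))
  have h0 := intervalIntegral.integral_eq_sub_of_hasDerivAt (a := a) (b := b) (fun r _ => hF r)
    (Continuous.intervalIntegrable (by fun_prop) _ _)
  simp only [Pi.mul_apply, hna, hnb, Complex.ofReal_zero, zero_mul, mul_zero, sub_zero] at h0
  rw [← sub_eq_zero, oscInt, ← intervalIntegral.integral_const_mul,
    ← intervalIntegral.integral_const_mul, ← intervalIntegral.integral_sub,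
    ← mul_zero Complex.I, ← h0, ← intervalIntegral.integral_const_mul]
  · refine intervalIntegral.integral_congr fun r _ => ?_
    generalize Complex.exp (Complex.I * (-t * disp r : ℝ)) = e
    push_cast
    linear_combination (e * t * disp' r * n r * sphMean ρ r) * Complex.I_sq
  · exact Continuous.intervalIntegrable (by fun_prop) _ _
  · exact Continuous.intervalIntegrable (by fun_prop) _ _

/-- One integration by parts and no further cancellation: the spherical mean is at most 2r where the
derivative falls on n, and its derivative is at most 2 where it does not. -/
lemma norm_oscInt_le_inv (hn : ContDiff ℝ 2 n) (ht : 0 < t) (ρ : ℝ) (ha : 0 ≤ a) (hab : a ≤ b)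
    (hna : n a = 0) (hnb : n b = 0) :
    ‖oscInt n t ρ a b‖ ≤ t⁻¹ * ∫ r in a..b, (2 * |r * deriv n r| + 2 * |n r|) := by
  have hn0 := hn.continuous
  have hn1 : Continuous (deriv n) := hn.continuous_deriv (by norm_num)
  have h := congrArg norm (oscInt_eq (t := t) hn ρ hna hnb)
  rw [norm_mul, norm_mul, norm_neg, Complex.norm_I, one_mul, Complex.norm_real, Real.norm_eq_abs,
    abs_of_pos ht] at h
  rw [← div_eq_inv_mul, le_div_iff₀ ht, mul_comm, h]
  refine intervalIntegral.norm_integral_le_of_norm_le hab (.of_forall fun r hr => ?_)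
    (Continuous.intervalIntegrable (by fun_prop) _ _)
  have hr0 : 0 ≤ r := ha.trans hr.1.le
  rw [norm_mul, norm_exp_I_mul, one_mul]
  refine (norm_add_le _ _).trans ?_
  rw [norm_mul, norm_mul, Complex.norm_real, Complex.norm_real, Real.norm_eq_abs, Real.norm_eq_abs]
  have h1 : |deriv n r| * ‖sphMean ρ r‖ ≤ |deriv n r| * (2 * r) := by
    gcongr; exact norm_sphMean_le ρ hr0
  have h2 : ‖Complex.exp (Complex.I * (ρ * r : ℝ)) + Complex.exp (Complex.I * (-ρ * r : ℝ))‖ ≤ 2 := by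
    refine (norm_add_le _ _).trans ?_
    rw [norm_exp_I_mul, norm_exp_I_mul]; norm_num
  have h3 := mul_le_mul_of_nonneg_left h2 (abs_nonneg (n r))
  rw [abs_mul, abs_of_nonneg hr0]
  linarith

lemma deriv_eq_zero_of_eqOn {c d : ℝ} {f : ℝ → ℝ} (hf : ∀ r, r ∉ Set.Icc c d → f r = 0) {r : ℝ}
    (hr : r ∉ Set.Icc c d) : deriv f r = 0 := by
  have : f =ᶠ[nhds r] fun _ => 0 := by
    filter_upwards [isClosed_Icc.isOpen_compl.mem_nhds hr] with s hs using hf s hs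
  rw [this.deriv_eq, deriv_const]

/-- The dispersive decay of the oscillatory integral. -/
lemma norm_oscInt_le {N M : ℝ} (hn : Ampl n M) (ht : 0 < t) (ρ : ℝ) (hN0 : 0 < N)
    (hN : N ≤ 1) (ha : N / 4 ≤ a) (hab : a ≤ b) {c d : ℝ} (hac : a < c) (hdb : d < b)
    (hsupp : ∀ r, r ∉ Set.Icc c d → n r = 0) :
    ‖oscInt n t ρ a b‖ ≤ t⁻¹ * (32 * M / √(t * (N / 3))) := by
  have hac' : a ∉ Set.Icc c d := fun h => absurd h.1 (not_le.2 hac)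
  have hbd' : b ∉ Set.Icc c d := fun h => absurd h.2 (not_le.2 hdb)
  have hna := hsupp a hac'
  have hnb := hsupp b hbd'
  have hna' := deriv_eq_zero_of_eqOn hsupp hac'
  have hnb' := deriv_eq_zero_of_eqOn hsupp hbd'
  have hnc := hn.contDiff
  have hn0 := hnc.continuous
  have hn1 : Continuous (deriv n) := hnc.continuous_deriv (by norm_num)
  have hn1d : ContDiff ℝ 1 (deriv n) :=
    ((contDiff_succ_iff_deriv (n := 1)).1 (by rw [one_add_one_eq_two]; exact hnc)).2.2
  have hm : ContDiff ℝ 1 (fun r => r * deriv n r) := contDiff_id.mul hn1d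
  have hd0 := continuous_disp
  have hS := continuous_sphMean ρ
  set κ := √(t * (N / 3)) with hκ
  have hκ0 : 0 < κ := Real.sqrt_pos.2 (by positivity)
  have hκ2 : κ ^ 2 = t * (N / 3) := Real.sq_sqrt (by positivity)
  have hM0 : 0 ≤ M := (abs_nonneg _).trans (hn.bdd 0)
  have hI (f : ℝ → ℝ) (hf : Integrable f) (hfM : ∫ r, |f r| ≤ M) : ∫ r in a..b, |f r| ≤ M := by
    rw [intervalIntegral.integral_of_le hab]
    exact (setIntegral_le_integral hf.abs (.of_forall fun r => abs_nonneg _)).trans hfM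
  -- The term βr does not enter the second derivative of the phase, so the bound is uniform in β,
  -- and hence in the position ρ.
  have hvdc (β : ℝ) {A : ℝ → ℝ} (hA : ContDiff ℝ 1 A) (hAa : A a = 0) (hAb : A b = 0)
      (hAi : Integrable (deriv A)) (hAM : ∫ r, |deriv A r| ≤ M) :
      ‖∫ r in a..b, Complex.exp (Complex.I * (β * r - t * disp r : ℝ)) * A r‖ ≤ 8 / κ * M := by
    refine norm_integral_exp_mul_le (p := fun r => β * r - t * disp r)
      (q := fun r => β * 1 - t * disp' r) (q' := fun r => -(t * disp'' r)) (A' := deriv A) hab hκ0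
      (fun r => ((hasDerivAt_id r).const_mul β).sub ((hasDerivAt_disp r).const_mul t))
      (fun r => ((hasDerivAt_disp' r).const_mul t).const_sub _)
      (by have := continuous_disp''; fun_prop) (fun r hr => ?_)
      (fun r => (hA.differentiable (by norm_num) r).hasDerivAt)
      (hA.continuous_deriv (by norm_num)) hAa hAb (hI _ hAi hAM)
    have := le_disp'' hN0 hN (ha.trans hr.1)
    rw [hκ2]
    have := mul_le_mul_of_nonneg_left this ht.le
    linarith
  have h := congrArg norm (oscInt_eq (t := t) hnc ρ hna hnb)
  rw [norm_mul, norm_mul, norm_neg, Complex.norm_I, one_mul, Complex.norm_real, Real.norm_eq_abs,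
    abs_of_pos ht] at h
  rw [← div_eq_inv_mul, le_div_iff₀ ht, mul_comm, h]
  set m : ℝ → ℝ := fun r => r * deriv n r with hmdef
  set f : ℝ → ℝ → ℂ := fun σ r => Complex.exp (Complex.I * (ρ * σ * r - t * disp r : ℝ)) * m r
    with hf
  have hmc : Continuous m := hm.continuous
  have hfc : Continuous (Function.uncurry f) := by
    simp only [hf, Function.uncurry_def]
    fun_prop
  -- The term with n' and the spherical mean becomes an average over σ in [-1, 1] of oscillatory
  -- integrals with amplitude r n'(r); this is why `Ampl` controls the derivative of that function.
  have hsw : ∫ r in a..b, Complex.exp (Complex.I * (-t * disp r : ℝ)) *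
      ((deriv n r : ℝ) * sphMean ρ r) = ∫ σ in (-1 : ℝ)..1, ∫ r in a..b, f σ r := by
    have h1 : ∀ r, Complex.exp (Complex.I * (-t * disp r : ℝ)) *
        ((deriv n r : ℝ) * sphMean ρ r) = ∫ σ in (-1 : ℝ)..1, f σ r := fun r => by
      rw [sphMean_eq, ← intervalIntegral.integral_const_mul, ← intervalIntegral.integral_const_mul]
      refine intervalIntegral.integral_congr fun σ _ => ?_
      simp only [hf, hmdef]
      rw [show Complex.I * ((ρ * σ * r - t * disp r : ℝ) : ℂ) = Complex.I * (-t * disp r : ℝ) +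
        Complex.I * (ρ * σ * r : ℝ) by push_cast; ring, Complex.exp_add]
      push_cast
      ring
    simp_rw [h1]
    rw [intervalIntegral.integral_of_le hab, intervalIntegral.integral_of_le (by norm_num)]
    simp_rw [intervalIntegral.integral_of_le hab,
      intervalIntegral.integral_of_le (show (-1 : ℝ) ≤ 1 by norm_num)]
    refine integral_integral_swap (f := fun r σ => f σ r) ?_
    rw [Measure.prod_restrict]
    refine IntegrableOn.mono_set (t := Set.Icc a b ×ˢ Set.Icc (-1) 1) ?_
      (Set.prod_mono Set.Ioc_subset_Icc_self Set.Ioc_subset_Icc_self)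
    exact ContinuousOn.integrableOn_compact (isCompact_Icc.prod isCompact_Icc)
      (hfc.comp continuous_swap).continuousOn
  have hsplit : ∫ r in a..b, Complex.exp (Complex.I * (-t * disp r : ℝ)) *
      ((deriv n r : ℝ) * sphMean ρ r + n r * (Complex.exp (Complex.I * (ρ * r : ℝ)) +
        Complex.exp (Complex.I * (-ρ * r : ℝ)))) =
      (∫ σ in (-1 : ℝ)..1, ∫ r in a..b, f σ r) +
      ((∫ r in a..b, Complex.exp (Complex.I * (ρ * r - t * disp r : ℝ)) * n r) +
        ∫ r in a..b, Complex.exp (Complex.I * (-ρ * r - t * disp r : ℝ)) * n r) := by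
    rw [← hsw, ← intervalIntegral.integral_add, ← intervalIntegral.integral_add]
    · refine intervalIntegral.integral_congr fun r _ => ?_
      have e (β : ℝ) : Complex.exp (Complex.I * (β * r - t * disp r : ℝ)) =
          Complex.exp (Complex.I * (-t * disp r : ℝ)) * Complex.exp (Complex.I * (β * r : ℝ)) := by
        rw [← Complex.exp_add]; congr 1; push_cast; ring
      rw [e, e]
      ring
    all_goals exact Continuous.intervalIntegrable (by fun_prop) _ _
  rw [hsplit]
  have b1 : ‖∫ σ in (-1 : ℝ)..1, ∫ r in a..b, f σ r‖ ≤ 8 / κ * M * |1 - (-1)| := by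
    refine intervalIntegral.norm_integral_le_of_norm_le_const fun σ _ => ?_
    exact hvdc (ρ * σ) hm (by simp [hmdef, hna']) (by simp [hmdef, hnb']) hn.integrable'
      hn.integral_le'
  have b2 := hvdc ρ (hnc.of_le (by norm_num)) hna hnb hn.integrable hn.integral_le
  have b3 := hvdc (-ρ) (hnc.of_le (by norm_num)) hna hnb hn.integrable hn.integral_le
  -- The average over σ costs 2 · 8 and the two boundary exponentials 8 each, which makes 32.
  refine (norm_add_le _ _).trans ((add_le_add b1 ((norm_add_le _ _).trans (add_le_add b2 b3))).trans
    (le_of_eq ?_))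
  norm_num
  ring

end Kernel

/-! ### The kernel of the propagator -/

/-- The radial symbol `h'(r) n(r) / r`. -/
def radSymbol (n : ℝ → ℝ) (r : ℝ) : ℝ := disp' r * n r / r

lemma continuous_radSymbol {n : ℝ → ℝ} (hn : Continuous n) {c d : ℝ} (hc : 0 < c)
    (hsupp : ∀ r, r ∉ Set.Icc c d → n r = 0) : Continuous (radSymbol n) := by
  have hd := continuous_disp'
  rw [continuous_iff_continuousAt]
  intro r
  rcases eq_or_ne r 0 with rfl | hr
  · have : radSymbol n =ᶠ[nhds 0] fun _ => 0 := by
      filter_upwards [Iio_mem_nhds hc] with s hs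
      rw [radSymbol, hsupp s fun h => absurd h.1 (not_le.2 hs), mul_zero, zero_div]
    exact (continuousAt_const.congr this.symm)
  · exact ((hd.mul hn).continuousAt).div continuousAt_id hr

/-- The symbol of the propagator `e^{-itH}` with radial amplitude `n`. -/
def kerSymbol (n : ℝ → ℝ) (t : ℝ) (ξ : R3) : ℂ :=
  radSymbol n ‖ξ‖ * Complex.exp (Complex.I * (-t * disp ‖ξ‖ : ℝ))

lemma norm_kerSymbol (n : ℝ → ℝ) (t : ℝ) (ξ : R3) : ‖kerSymbol n t ξ‖ = |radSymbol n ‖ξ‖| := by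
  rw [kerSymbol, norm_mul, norm_exp_I_mul, mul_one, Complex.norm_real, Real.norm_eq_abs]

section

variable {n : ℝ → ℝ} {c d : ℝ} (t : ℝ)

lemma continuous_kerSymbol (hn : Continuous n) (hc : 0 < c)
    (hsupp : ∀ r, r ∉ Set.Icc c d → n r = 0) : Continuous (kerSymbol n t) := by
  have h1 := continuous_radSymbol hn hc hsupp
  have h2 := continuous_disp
  unfold kerSymbol
  fun_prop

lemma integrable_kerSymbol (hn : Continuous n) (hc : 0 < c)
    (hsupp : ∀ r, r ∉ Set.Icc c d → n r = 0) : Integrable (kerSymbol n t) := by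
  refine (continuous_kerSymbol t hn hc hsupp).integrable_of_hasCompactSupport ?_
  refine HasCompactSupport.intro (isCompact_closedBall (0 : R3) d) fun ξ hξ => ?_
  rw [kerSymbol, radSymbol, hsupp ‖ξ‖ fun h => hξ (by simpa using h.2)]
  simp

open Real in
-- The radial Fourier formula supplies a factor r which cancels the 1/r of the symbol. The remaining
-- constant is 2π from the formula times (2π)⁻³ from the change of frequency normalization, and is
-- at most 1.
lemma norm_fourierInv_kerSymbol_le (hn : Continuous n) (hc : 0 < c)
    (hsupp : ∀ r, r ∉ Set.Icc c d → n r = 0) {a b : ℝ} (ha : 0 < a) (hac : a < c) (hdb : d < b)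
    (hab : a ≤ b) (x : R3) :
    ‖𝓕⁻ (fun ξ : R3 => kerSymbol n t ((2 * π) • ξ)) x‖ ≤ ‖oscInt n t ‖x‖ a b‖ := by
  have h1 : 𝓕⁻ (fun ξ : R3 => kerSymbol n t ((2 * π) • ξ)) x =
      ∫ ξ : R3, (fun η => Complex.exp (Complex.I * (inner ℝ x η : ℝ)) * kerSymbol n t η)
        ((2 * π) • ξ) := by
    rw [Real.fourierInv_eq']
    refine integral_congr_ae (.of_forall fun ξ => ?_)
    simp only [smul_eq_mul]
    rw [inner_smul_right, real_inner_comm]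
    congr 2
    push_cast
    ring
  set g : ℝ → ℂ := fun r => radSymbol n r * Complex.exp (Complex.I * (-t * disp r : ℝ)) with hg
  have h2 := integral_exp_mul_radial g (integrable_kerSymbol t hn hc hsupp) x
  have h3 : ∫ r in Set.Ioi (0 : ℝ), r * g r *
      ∫ s in (-r)..r, Complex.exp (Complex.I * (‖x‖ * s : ℝ)) = oscInt n t ‖x‖ a b := by
    rw [oscInt, intervalIntegral.integral_of_le hab]
    have h4 : ∀ r ∈ Set.Ioi (0 : ℝ), r * g r *
        ∫ s in (-r)..r, Complex.exp (Complex.I * (‖x‖ * s : ℝ)) =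
        ((disp' r * n r : ℝ) : ℂ) * Complex.exp (Complex.I * (-t * disp r : ℝ)) *
          sphMean ‖x‖ r := fun r hr => by
      have hr' : (r : ℂ) ≠ 0 := by exact_mod_cast (ne_of_gt hr)
      rw [← sphMean]
      simp only [hg, radSymbol]
      push_cast
      field_simp
    rw [setIntegral_congr_fun measurableSet_Ioi h4]
    refine (setIntegral_eq_of_subset_of_forall_sdiff_eq_zero measurableSet_Ioi
      (fun r hr => ha.trans hr.1) fun r hr => ?_)
    rw [hsupp r fun h => hr.2 ⟨hac.trans_le h.1, h.2.trans hdb.le⟩]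
    simp
  have hbig : (1 : ℝ) ≤ 2 * π := by linarith [pi_gt_three]
  have h5 := Measure.integral_comp_smul (volume : Measure R3)
    (fun η => Complex.exp (Complex.I * (inner ℝ x η : ℝ)) * kerSymbol n t η) (2 * π)
  rw [h1, h5, finrank_euclideanSpace, Fintype.card_fin, norm_smul]
  rw [show (∫ η : R3, Complex.exp (Complex.I * (inner ℝ x η : ℝ)) * kerSymbol n t η) =
    2 * π * oscInt n t ‖x‖ a b from h2.trans (by rw [h3])]
  rw [norm_mul, ← mul_assoc]
  refine mul_le_of_le_one_left (norm_nonneg _) ?_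
  have : ‖(2 * π : ℂ)‖ = 2 * π := by
    rw [norm_mul, Complex.norm_real, Real.norm_eq_abs, abs_of_pos pi_pos]; norm_num
  rw [this, Real.norm_eq_abs, abs_abs, abs_of_pos (by positivity), inv_mul_le_iff₀ (by positivity), mul_one]
  exact le_self_pow₀ hbig (by norm_num)

end

/-! ### Calculus of amplitudes -/

lemma contDiff_one_deriv {n : ℝ → ℝ} (hn : ContDiff ℝ 2 n) : ContDiff ℝ 1 (deriv n) :=
  ((contDiff_succ_iff_deriv (n := 1)).1 (by rw [one_add_one_eq_two]; exact hn)).2.2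

lemma contDiff_one_mul_deriv {n : ℝ → ℝ} (hn : ContDiff ℝ 2 n) :
    ContDiff ℝ 1 (fun r => r * deriv n r) := contDiff_id.mul (contDiff_one_deriv hn)

namespace Ampl

variable {n k : ℝ → ℝ} {M L : ℝ}

lemma mono (hn : Ampl n M) (h : M ≤ L) : Ampl n L :=
  ⟨hn.contDiff, fun r => (hn.bdd r).trans h, fun r => (hn.bdd_deriv r).trans h, hn.integrable,
    hn.integral_le.trans h, hn.integrable', hn.integral_le'.trans h⟩

lemma nonneg (hn : Ampl n M) : 0 ≤ M := (abs_nonneg _).trans (hn.bdd 0)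

lemma hasDerivAt (hn : Ampl n M) (r : ℝ) : HasDerivAt n (deriv n r) r :=
  (hn.contDiff.differentiable (by norm_num) r).hasDerivAt

lemma hasDerivAt' (hn : Ampl n M) (r : ℝ) :
    HasDerivAt (fun r => r * deriv n r) (deriv (fun r => r * deriv n r) r) r :=
  ((contDiff_one_mul_deriv hn.contDiff).differentiable (by norm_num) r).hasDerivAt

lemma continuous_deriv (hn : Ampl n M) : Continuous (deriv n) :=
  hn.contDiff.continuous_deriv (by norm_num)

lemma continuous_deriv' (hn : Ampl n M) : Continuous (deriv fun r => r * deriv n r) :=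
  (contDiff_one_mul_deriv hn.contDiff).continuous_deriv (by norm_num)

/-- The only term of (r(nk)')' that is not of the form (bounded) × (integrable) at once is the cross
term 2 r n' k'; it is handled by the supremum of r n' and the L¹ norm of k'. Altogether ML + ML +
2ML. -/
lemma mul (hn : Ampl n M) (hk : Ampl k L) : Ampl (fun r => n r * k r) (4 * (M * L)) := by
  have hM := hn.nonneg
  have hL := hk.nonneg
  have hML : 0 ≤ M * L := mul_nonneg hM hL
  have hnc := hn.contDiff.continuous
  have hkc := hk.contDiff.continuous
  have hnc' := hn.continuous_deriv
  have hkc' := hk.continuous_deriv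
  have hnc2 := hn.continuous_deriv'
  have hkc2 := hk.continuous_deriv'
  have hd : deriv (fun r => n r * k r) = fun r => deriv n r * k r + n r * deriv k r :=
    funext fun r => ((hn.hasDerivAt r).mul (hk.hasDerivAt r)).deriv
  have hd2 : deriv (fun r => r * deriv (fun r => n r * k r) r) = fun r =>
      deriv (fun r => r * deriv n r) r * k r + n r * deriv (fun r => r * deriv k r) r +
        2 * (r * deriv n r * deriv k r) := by
    have : (fun r => r * deriv (fun r => n r * k r) r) =
        fun r => (r * deriv n r) * k r + n r * (r * deriv k r) := by
      ext r; rw [hd]; ring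
    rw [this]
    funext r
    refine (((hn.hasDerivAt' r).mul (hk.hasDerivAt r)).add
      ((hn.hasDerivAt r).mul (hk.hasDerivAt' r))).deriv.trans ?_
    ring
  have hi1 : Integrable fun r => L * |deriv n r| + M * |deriv k r| :=
    (hn.integrable.abs.const_mul L).add (hk.integrable.abs.const_mul M)
  have hb1 (r : ℝ) : |deriv n r * k r + n r * deriv k r| ≤ L * |deriv n r| + M * |deriv k r| := by
    refine (abs_add_le _ _).trans ?_
    rw [abs_mul, abs_mul, mul_comm |deriv n r|]
    gcongr
    · exact hk.bdd r
    · exact hn.bdd r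
  have hi2 : Integrable fun r => L * |deriv (fun r => r * deriv n r) r| +
      M * |deriv (fun r => r * deriv k r) r| + 2 * (M * |deriv k r|) :=
    ((hn.integrable'.abs.const_mul L).add (hk.integrable'.abs.const_mul M)).add
      ((hk.integrable.abs.const_mul M).const_mul 2)
  have hb2 (r : ℝ) : |deriv (fun r => r * deriv n r) r * k r +
      n r * deriv (fun r => r * deriv k r) r + 2 * (r * deriv n r * deriv k r)| ≤
      L * |deriv (fun r => r * deriv n r) r| +
      M * |deriv (fun r => r * deriv k r) r| + 2 * (M * |deriv k r|) := by
    refine (abs_add_le _ _).trans (add_le_add ((abs_add_le _ _).trans ?_) ?_)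
    · rw [abs_mul, abs_mul, mul_comm |deriv _ r|]
      gcongr
      · exact hk.bdd r
      · exact hn.bdd r
    · rw [abs_mul, abs_mul, abs_two]
      gcongr
      exact hn.bdd_deriv r
  refine ⟨hn.contDiff.mul hk.contDiff, fun r => ?_, fun r => ?_, ?_, ?_, ?_, ?_⟩
  · rw [abs_mul]
    have := mul_le_mul (hn.bdd r) (hk.bdd r) (abs_nonneg _) hM
    linarith
  · rw [hd, show r * (deriv n r * k r + n r * deriv k r) =
      (r * deriv n r) * k r + n r * (r * deriv k r) by ring]
    refine (abs_add_le _ _).trans ?_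
    rw [abs_mul (r * deriv n r), abs_mul (n r)]
    have h1 := mul_le_mul (hn.bdd_deriv r) (hk.bdd r) (abs_nonneg _) hM
    have h2 := mul_le_mul (hn.bdd r) (hk.bdd_deriv r) (abs_nonneg _) hM
    linarith
  · rw [hd]
    exact hi1.mono' (by fun_prop) (.of_forall hb1)
  · rw [hd]
    refine (integral_mono_of_nonneg (.of_forall fun r => abs_nonneg _) hi1 (.of_forall hb1)).trans ?_
    rw [integral_add (hn.integrable.abs.const_mul L) (hk.integrable.abs.const_mul M),
      integral_const_mul, integral_const_mul]
    have h1 := mul_le_mul_of_nonneg_left hn.integral_le hL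
    have h2 := mul_le_mul_of_nonneg_left hk.integral_le hM
    linarith
  · rw [hd2]
    exact hi2.mono' (by fun_prop) (.of_forall hb2)
  · rw [hd2]
    refine (integral_mono_of_nonneg (.of_forall fun r => abs_nonneg _) hi2 (.of_forall hb2)).trans ?_
    have hi3 : Integrable fun r => L * |deriv (fun r => r * deriv n r) r| +
        M * |deriv (fun r => r * deriv k r) r| :=
      (hn.integrable'.abs.const_mul L).add (hk.integrable'.abs.const_mul M)
    rw [integral_add hi3 ((hk.integrable.abs.const_mul M).const_mul 2),
      integral_add (hn.integrable'.abs.const_mul L) (hk.integrable'.abs.const_mul M),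
      integral_const_mul, integral_const_mul, integral_const_mul, integral_const_mul]
    have h1 := mul_le_mul_of_nonneg_left hn.integral_le' hL
    have h2 := mul_le_mul_of_nonneg_left hk.integral_le' hM
    have h3 := mul_le_mul_of_nonneg_left hk.integral_le hM
    linarith

lemma add (hn : Ampl n M) (hk : Ampl k L) : Ampl (fun r => n r + k r) (M + L) := by
  have hd : deriv (fun r => n r + k r) = fun r => deriv n r + deriv k r :=
    funext fun r => ((hn.hasDerivAt r).add (hk.hasDerivAt r)).deriv
  have hd2 : deriv (fun r => r * deriv (fun r => n r + k r) r) = fun r =>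
      deriv (fun r => r * deriv n r) r + deriv (fun r => r * deriv k r) r := by
    have : (fun r => r * deriv (fun r => n r + k r) r) =
        fun r => r * deriv n r + r * deriv k r := by
      ext r; rw [hd]; ring
    rw [this]
    exact funext fun r => ((hn.hasDerivAt' r).add (hk.hasDerivAt' r)).deriv
  refine ⟨hn.contDiff.add hk.contDiff, fun r => ?_, fun r => ?_, ?_, ?_, ?_, ?_⟩
  · exact (abs_add_le _ _).trans (add_le_add (hn.bdd r) (hk.bdd r))
  · rw [hd, mul_add]
    exact (abs_add_le _ _).trans (add_le_add (hn.bdd_deriv r) (hk.bdd_deriv r))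
  · rw [hd]; exact hn.integrable.add hk.integrable
  · rw [hd]
    refine (integral_mono_of_nonneg (.of_forall fun r => abs_nonneg _)
      (hn.integrable.abs.add hk.integrable.abs) (.of_forall fun r => abs_add_le _ _)).trans ?_
    simp only [Pi.add_apply]
    rw [integral_add hn.integrable.abs hk.integrable.abs]
    exact add_le_add hn.integral_le hk.integral_le
  · rw [hd2]; exact hn.integrable'.add hk.integrable'
  · rw [hd2]
    refine (integral_mono_of_nonneg (.of_forall fun r => abs_nonneg _)
      (hn.integrable'.abs.add hk.integrable'.abs) (.of_forall fun r => abs_add_le _ _)).trans ?_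
    simp only [Pi.add_apply]
    rw [integral_add hn.integrable'.abs hk.integrable'.abs]
    exact add_le_add hn.integral_le' hk.integral_le'

lemma const_mul (hn : Ampl n M) (c : ℝ) : Ampl (fun r => c * n r) (|c| * M) := by
  have hd : deriv (fun r => c * n r) = fun r => c * deriv n r :=
    funext fun r => ((hn.hasDerivAt r).const_mul c).deriv
  have hd2 : deriv (fun r => r * deriv (fun r => c * n r) r) = fun r =>
      c * deriv (fun r => r * deriv n r) r := by
    have : (fun r => r * deriv (fun r => c * n r) r) = fun r => c * (r * deriv n r) := by
      ext r; rw [hd]; ring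
    rw [this]
    exact funext fun r => ((hn.hasDerivAt' r).const_mul c).deriv
  refine ⟨contDiff_const.mul hn.contDiff, fun r => ?_, fun r => ?_, ?_, ?_, ?_, ?_⟩
  · rw [abs_mul]; gcongr; exact hn.bdd r
  · rw [hd, mul_left_comm, abs_mul]; gcongr; exact hn.bdd_deriv r
  · rw [hd]; exact hn.integrable.const_mul c
  · rw [hd]
    simp only [abs_mul]
    rw [integral_const_mul]
    gcongr
    exact hn.integral_le
  · rw [hd2]; exact hn.integrable'.const_mul c
  · rw [hd2]
    simp only [abs_mul]
    rw [integral_const_mul]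
    gcongr
    exact hn.integral_le'

lemma const (c : ℝ) : Ampl (fun _ => c) |c| := by
  refine ⟨contDiff_const, fun r => le_rfl, ?_, ?_, ?_, ?_, ?_⟩ <;> simp

/-- Amplitude bounds are invariant under dilations. -/
lemma comp_div (hn : Ampl n M) {N : ℝ} (hN : 0 < N) : Ampl (fun r => n (r / N)) M := by
  have hd : deriv (fun r => n (r / N)) = fun r => deriv n (r / N) / N :=
    funext fun r => by
      have := (hn.hasDerivAt (r / N)).comp r ((hasDerivAt_id r).div_const N)
      refine this.deriv.trans ?_
      ring
  have hd2 : deriv (fun r => r * deriv (fun r => n (r / N)) r) = fun r =>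
      deriv (fun r => r * deriv n r) (r / N) / N := by
    have : (fun r => r * deriv (fun r => n (r / N)) r) =
        fun r => (fun r => r * deriv n r) (r / N) := by
      ext r; rw [hd]; ring
    rw [this]
    funext r
    have := (hn.hasDerivAt' (r / N)).comp r ((hasDerivAt_id r).div_const N)
    refine this.deriv.trans ?_
    ring
  have hI (f : ℝ → ℝ) : ∫ r, |f (r / N) / N| = ∫ r, |f r| := by
    have := Measure.integral_comp_div (fun r => |f r|) N
    simp only [abs_div, abs_of_pos hN]
    rw [integral_div, this, abs_of_pos hN, smul_eq_mul, mul_div_cancel_left₀ _ hN.ne']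
  refine ⟨hn.contDiff.comp (contDiff_id.div_const N), fun r => hn.bdd _, fun r => ?_, ?_, ?_, ?_, ?_⟩
  · rw [hd, show r * (deriv n (r / N) / N) = r / N * deriv n (r / N) by ring]
    exact hn.bdd_deriv _
  · rw [hd]; exact (hn.integrable.comp_div hN.ne').div_const N
  · rw [hd, hI]; exact hn.integral_le
  · rw [hd2]; exact (hn.integrable'.comp_div hN.ne').div_const N
  · rw [hd2, hI]; exact hn.integral_le'

/-- Decay criterion for amplitude bounds. -/
lemma of_decay {n n₁ n₂ : ℝ → ℝ} {c : ℝ} (h1 : ∀ r, HasDerivAt n (n₁ r) r)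
    (h2 : ∀ r, HasDerivAt n₁ (n₂ r) r) (hc : Continuous n₂) (b0 : ∀ r, |n r| ≤ c)
    (b1 : ∀ r, |n₁ r| ≤ c / (1 + r ^ 2)) (b2 : ∀ r, |n₁ r + r * n₂ r| ≤ c / (1 + r ^ 2)) :
    Ampl n (4 * c) := by
  have hc0 : 0 ≤ c := (abs_nonneg _).trans (b0 0)
  have e1 : deriv n = n₁ := funext fun r => (h1 r).deriv
  have e2 : deriv (fun r => r * n₁ r) = fun r => n₁ r + r * n₂ r := funext fun r => by
    refine ((hasDerivAt_id r).mul (h2 r)).deriv.trans ?_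
    simp
  have c1 : Continuous n₁ := continuous_iff_continuousAt.2 fun r => (h2 r).continuousAt
  have hi : Integrable fun r : ℝ => c / (1 + r ^ 2) := by
    simpa [div_eq_mul_inv] using integrable_inv_one_add_sq.const_mul c
  -- The integral equals πc, and π < 4.
  have hI : ∫ r : ℝ, c / (1 + r ^ 2) ≤ 4 * c := by
    simp only [div_eq_mul_inv]
    rw [integral_const_mul, integral_univ_inv_one_add_sq]
    nlinarith [Real.pi_lt_four]
  refine ⟨?_, fun r => ?_, fun r => ?_, ?_, ?_, ?_, ?_⟩
  · have : ContDiff ℝ (1 + 1) n := by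
      refine contDiff_succ_iff_deriv.2 ⟨fun r => (h1 r).differentiableAt, by simp, ?_⟩
      rw [e1]
      refine contDiff_one_iff_deriv.2 ⟨fun r => (h2 r).differentiableAt, ?_⟩
      rwa [show deriv n₁ = n₂ from funext fun r => (h2 r).deriv]
    rwa [one_add_one_eq_two] at this
  · linarith [b0 r]
  · rw [e1, abs_mul]
    have h3 : |r| * (c / (1 + r ^ 2)) ≤ c := by
      rw [← mul_div_assoc, div_le_iff₀ (by positivity)]
      have : |r| ≤ 1 + r ^ 2 := by nlinarith [sq_abs r, sq_nonneg (|r| - 1)]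
      nlinarith
    have := mul_le_mul_of_nonneg_left (b1 r) (abs_nonneg r)
    linarith
  · rw [e1]; exact hi.mono' c1.aestronglyMeasurable (.of_forall b1)
  · rw [e1]
    exact (integral_mono_of_nonneg (.of_forall fun r => abs_nonneg _) hi (.of_forall b1)).trans hI
  · rw [e1, e2]
    exact hi.mono' (by fun_prop) (.of_forall b2)
  · rw [e1, e2]
    exact (integral_mono_of_nonneg (.of_forall fun r => abs_nonneg _) hi (.of_forall b2)).trans hI

/-- A bounded `C²` function with compactly supported derivative is an amplitude. -/
lemma exists_of_hasCompactSupport_deriv {n : ℝ → ℝ} {c : ℝ} (hn : ContDiff ℝ 2 n)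
    (hc : ∀ r, |n r| ≤ c) (s1 : HasCompactSupport (deriv n)) : ∃ M, Ampl n M := by
  have c1 : Continuous (deriv n) := hn.continuous_deriv (by norm_num)
  have cm : ContDiff ℝ 1 (fun r => r * deriv n r) := contDiff_one_mul_deriv hn
  have sm : HasCompactSupport (fun r => r * deriv n r) := s1.mul_left (f := fun r : ℝ => r)
  have c2 := cm.continuous_deriv (by norm_num)
  obtain ⟨C₁, h1⟩ := sm.exists_bound_of_continuous cm.continuous
  have hI1 : Integrable (deriv n) := c1.integrable_of_hasCompactSupport s1
  have hI2 : Integrable (deriv fun r => r * deriv n r) := c2.integrable_of_hasCompactSupport sm.deriv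
  have p0 : 0 ≤ c := (abs_nonneg _).trans (hc 0)
  have p1 : 0 ≤ C₁ := (norm_nonneg _).trans (h1 0)
  have p2 : 0 ≤ ∫ r, |deriv n r| := integral_nonneg fun r => abs_nonneg _
  have p3 : 0 ≤ ∫ r, |deriv (fun r => r * deriv n r) r| := integral_nonneg fun r => abs_nonneg _
  refine ⟨c + C₁ + (∫ r, |deriv n r|) + ∫ r, |deriv (fun r => r * deriv n r) r|, hn,
    fun r => ?_, fun r => ?_, hI1, ?_, hI2, ?_⟩
  · have := hc r; linarith
  · have := h1 r; rw [Real.norm_eq_abs] at this; linarith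
  · linarith
  · linarith

/-- A compactly supported `C²` function is an amplitude. -/
lemma exists_of_hasCompactSupport {n : ℝ → ℝ} (hn : ContDiff ℝ 2 n) (hs : HasCompactSupport n) :
    ∃ M, Ampl n M := by
  obtain ⟨C₀, h0⟩ := hs.exists_bound_of_continuous hn.continuous
  exact exists_of_hasCompactSupport_deriv hn h0 hs.deriv

end Ampl

/-! ### The amplitudes attached to `U⁻¹` and to the identity -/

lemma exists_ampl_inv_bracket : ∃ M, Ampl (fun r => (√(2 + r ^ 2))⁻¹) M := by
  refine ⟨_, Ampl.of_decay (c := 4) (n₁ := fun r => -r / ((2 + r ^ 2) * √(2 + r ^ 2)))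
    (n₂ := fun r => (2 * r ^ 2 - 2) / ((2 + r ^ 2) ^ 2 * √(2 + r ^ 2)))
    (fun r => ?_) (fun r => ?_) ?_ (fun r => ?_) (fun r => ?_) (fun r => ?_)⟩
  all_goals
    try (
      have hD : 0 < 2 + r ^ 2 := by positivity
      have hs : 0 < √(2 + r ^ 2) := Real.sqrt_pos.2 hD
      have hs2 : √(2 + r ^ 2) ^ 2 = 2 + r ^ 2 := Real.sq_sqrt hD.le
      have hs1 : 1 ≤ √(2 + r ^ 2) := Real.one_le_sqrt.2 (by nlinarith)
      have hrs : |r| ≤ √(2 + r ^ 2) := Real.abs_le_sqrt (by linarith))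
  · refine ((hasDerivAt_sqrt_two_add_sq r).inv hs.ne').congr_deriv ?_
    rw [hs2]
    field_simp
  · have h := (hasDerivAt_neg r).div ((((hasDerivAt_pow 2 r).const_add 2)).mul
      (hasDerivAt_sqrt_two_add_sq r)) (mul_pos hD hs).ne'
    refine h.congr_deriv ?_
    simp only [Pi.mul_apply]
    field_simp
    push_cast
    simp only [hs2]
    ring
  · exact Continuous.div (by fun_prop) (by fun_prop) fun r => by positivity
  · rw [abs_inv, abs_of_pos hs]
    exact (inv_le_one_of_one_le₀ hs1).trans (by norm_num)
  · rw [abs_div, abs_neg, abs_of_pos (by positivity : 0 < (2 + r ^ 2) * √(2 + r ^ 2)),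
      div_le_div_iff₀ (by positivity) (by positivity)]
    nlinarith [mul_le_mul_of_nonneg_right hrs hD.le, abs_nonneg r, sq_nonneg r, mul_pos hD hs]
  · have e : -r / ((2 + r ^ 2) * √(2 + r ^ 2)) + r * ((2 * r ^ 2 - 2) / ((2 + r ^ 2) ^ 2 * √(2 + r ^ 2)))
        = r * (r ^ 2 - 4) / ((2 + r ^ 2) ^ 2 * √(2 + r ^ 2)) := by
      field_simp; ring
    rw [e, abs_div, abs_mul, abs_of_pos (by positivity : 0 < (2 + r ^ 2) ^ 2 * √(2 + r ^ 2)),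
      div_le_div_iff₀ (by positivity) (by positivity)]
    have h1 : |r ^ 2 - 4| ≤ 2 * (2 + r ^ 2) := by rw [abs_le]; constructor <;> nlinarith
    have h2 := mul_le_mul hrs h1 (abs_nonneg _) hs.le
    have h3 := mul_le_mul_of_nonneg_right h2 (by positivity : 0 ≤ 1 + r ^ 2)
    nlinarith [mul_pos hD hs, mul_nonneg (mul_pos hD hs).le (sq_nonneg r)]

/-- This is the symbol of U, extended to an odd function. It does not decay, but `Ampl.of_decay`
asks for decay of derivatives only. -/
lemma exists_ampl_div_bracket : ∃ M, Ampl (fun r => r / √(2 + r ^ 2)) M := by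
  refine ⟨_, Ampl.of_decay (c := 10) (n₁ := fun r => 2 / ((2 + r ^ 2) * √(2 + r ^ 2)))
    (n₂ := fun r => -6 * r / ((2 + r ^ 2) ^ 2 * √(2 + r ^ 2)))
    (fun r => ?_) (fun r => ?_) ?_ (fun r => ?_) (fun r => ?_) (fun r => ?_)⟩
  all_goals
    try (
      have hD : 0 < 2 + r ^ 2 := by positivity
      have hs : 0 < √(2 + r ^ 2) := Real.sqrt_pos.2 hD
      have hs2 : √(2 + r ^ 2) ^ 2 = 2 + r ^ 2 := Real.sq_sqrt hD.le
      have hs1 : 1 ≤ √(2 + r ^ 2) := Real.one_le_sqrt.2 (by nlinarith)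
      have hrs : |r| ≤ √(2 + r ^ 2) := Real.abs_le_sqrt (by linarith))
  · refine ((hasDerivAt_id r).div (hasDerivAt_sqrt_two_add_sq r) hs.ne').congr_deriv ?_
    simp only [id]
    field_simp
    simp only [hs2]
    ring
  · have h := (hasDerivAt_const r (2 : ℝ)).div ((((hasDerivAt_pow 2 r).const_add 2)).mul
      (hasDerivAt_sqrt_two_add_sq r)) (mul_pos hD hs).ne'
    refine h.congr_deriv ?_
    simp only [Pi.mul_apply]
    field_simp
    push_cast
    simp only [hs2]
    ring
  · exact Continuous.div (by fun_prop) (by fun_prop) fun r => by positivity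
  · rw [abs_div, abs_of_pos hs, div_le_iff₀ hs]
    linarith
  · rw [abs_of_pos (by positivity), div_le_div_iff₀ (by positivity) (by positivity)]
    nlinarith [mul_le_mul_of_nonneg_left hs1 hD.le]
  · have e : 2 / ((2 + r ^ 2) * √(2 + r ^ 2)) + r * (-6 * r / ((2 + r ^ 2) ^ 2 * √(2 + r ^ 2)))
        = (4 - 4 * r ^ 2) / ((2 + r ^ 2) ^ 2 * √(2 + r ^ 2)) := by
      field_simp; ring
    rw [e, abs_div, abs_of_pos (by positivity : 0 < (2 + r ^ 2) ^ 2 * √(2 + r ^ 2)),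
      div_le_div_iff₀ (by positivity) (by positivity)]
    have h1 : |4 - 4 * r ^ 2| ≤ 4 * (2 + r ^ 2) := by rw [abs_le]; constructor <;> nlinarith
    have h2 := mul_le_mul_of_nonneg_right h1 (by positivity : 0 ≤ 1 + r ^ 2)
    have h3 := mul_le_mul_of_nonneg_left hs1 (by positivity : 0 ≤ (2 + r ^ 2) ^ 2)
    nlinarith

/-- The amplitude of `U⁻¹`. -/
def uAmp (r : ℝ) : ℝ := (2 + r ^ 2) / (2 * (1 + r ^ 2))

lemma exists_ampl_uAmp : ∃ M, Ampl uAmp M := by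
  have h : ∃ M, Ampl (fun r => (1 + r ^ 2)⁻¹) M := by
    refine ⟨_, Ampl.of_decay (c := 4) (n₁ := fun r => -(2 * r) / (1 + r ^ 2) ^ 2)
      (n₂ := fun r => (6 * r ^ 2 - 2) / (1 + r ^ 2) ^ 3)
      (fun r => ?_) (fun r => ?_) ?_ (fun r => ?_) (fun r => ?_) (fun r => ?_)⟩
    all_goals
      try have hD : 0 < 1 + r ^ 2 := by positivity
    · refine (((hasDerivAt_pow 2 r).const_add 1).inv hD.ne').congr_deriv ?_
      norm_num
    · have h := (((hasDerivAt_id r).const_mul 2).neg).div (((hasDerivAt_pow 2 r).const_add 1).pow 2)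
        (pow_pos hD 2).ne'
      refine h.congr_deriv ?_
      simp only [Pi.pow_apply, Pi.neg_apply, id]
      field_simp
      push_cast
      ring
    · exact Continuous.div (by fun_prop) (by fun_prop) fun r => by positivity
    · rw [abs_of_pos (by positivity)]
      exact (inv_le_one_of_one_le₀ (by nlinarith)).trans (by norm_num)
    · rw [abs_div, abs_neg, abs_of_pos (by positivity : 0 < (1 + r ^ 2) ^ 2),
        div_le_div_iff₀ (by positivity) (by positivity)]
      have h1 : |2 * r| ≤ 4 * (1 + r ^ 2) := by rw [abs_le]; constructor <;> nlinarith
      nlinarith [mul_le_mul_of_nonneg_right h1 hD.le]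
    · have e : -(2 * r) / (1 + r ^ 2) ^ 2 + r * ((6 * r ^ 2 - 2) / (1 + r ^ 2) ^ 3)
          = (4 * r) * (r ^ 2 - 1) / (1 + r ^ 2) ^ 3 := by
        field_simp; ring
      rw [e, abs_div, abs_mul, abs_of_pos (by positivity : 0 < (1 + r ^ 2) ^ 3),
        div_le_div_iff₀ (by positivity) (by positivity)]
      have h1 : |r ^ 2 - 1| ≤ 1 + r ^ 2 := by rw [abs_le]; constructor <;> nlinarith
      have h2 : |4 * r| ≤ 4 * (1 + r ^ 2) := by rw [abs_le]; constructor <;> nlinarith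
      have h3 := mul_le_mul h2 h1 (abs_nonneg _) (by positivity)
      nlinarith [mul_le_mul_of_nonneg_right h3 hD.le]
  obtain ⟨M, hM⟩ := h
  -- The amplitude tends to 1/2 at infinity; it is 1/2 + (1/2)(1 + r²)⁻¹.
  have := (Ampl.const (1 / 2)).add (hM.const_mul (1 / 2))
  refine ⟨_, (funext fun r => ?_ : uAmp = fun r => 1 / 2 + 1 / 2 * (1 + r ^ 2)⁻¹) ▸ this⟩
  rw [uAmp]
  field_simp
  ring

/-! ### The propagator and the weighted norm -/

lemma measurable_propSymbol (t : ℝ) : Measurable (propSymbol t) := by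
  unfold propSymbol hSymbol bracket
  fun_prop

lemma norm_propSymbol (t : ℝ) (ξ : R3) : ‖propSymbol t ξ‖ = 1 := norm_exp_I_mul _

lemma multDom_propSymbol (t : ℝ) (f : L2) : MultDom (propSymbol t) f :=
  multDom_of_bounded (measurable_propSymbol t) (fun ξ => (norm_propSymbol t ξ).le) f

lemma eLpNorm_prop (t : ℝ) (f : L2) : eLpNorm (prop t f) 2 volume = eLpNorm f 2 volume := by
  rw [prop, eLpNorm_mult (multDom_propSymbol t f), ← eLpNorm_fourier f]
  refine eLpNorm_congr_norm_ae (.of_forall fun ξ => ?_)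
  rw [norm_mul, norm_propSymbol, one_mul]

lemma sq_lintegral_J {t : ℝ} {f : L2} (hf : MemJ t f) (j : Fin 3) :
    ∫⁻ x, ‖J t f j x‖ₑ ^ 2 = ∫⁻ x, ‖x j‖ₑ ^ 2 * ‖prop t f x‖ₑ ^ 2 := by
  rw [lintegral_sq_eq_eLpNorm, J, eLpNorm_prop, ← lintegral_sq_eq_eLpNorm, pos, dif_pos (hf j)]
  refine lintegral_congr_ae ?_
  filter_upwards [(hf j).coeFn_toLp] with x hx
  rw [hx, enorm_mul, mul_pow]
  congr 2
  rw [← ofReal_norm, ← ofReal_norm, Complex.norm_real]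

lemma enorm_sq_euclidean {𝕜 : Type*} [RCLike 𝕜] (x : EuclideanSpace 𝕜 (Fin 3)) :
    ‖x‖ₑ ^ 2 = ∑ j, ‖x j‖ₑ ^ 2 := by
  simp only [← ofReal_norm]
  simp_rw [← ENNReal.ofReal_pow (norm_nonneg _)]
  rw [EuclideanSpace.norm_sq_eq, ENNReal.ofReal_sum_of_nonneg fun i _ => by positivity]

lemma weightMass_prop_eq_sum {t : ℝ} {f : L2} (hf : MemJ t f) :
    weightMass (prop t f) = ∑ j, ∫⁻ x, ‖J t f j x‖ₑ ^ 2 := by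
  rw [weightMass]
  simp_rw [enorm_sq_euclidean, sq_lintegral_J hf, Finset.sum_mul]
  refine lintegral_finsetSum' _ fun j _ => AEMeasurable.mul (Measurable.aemeasurable ?_)
    ((Lp.aestronglyMeasurable (prop t f)).enorm.pow_const 2)
  exact (continuous_enorm.measurable.comp (by fun_prop)).pow_const 2

/-- The outer e^{-itH} in J(t) is an isometry of L², so only the weight |x| on e^{itH}f is left.
This is how ‖J(t)f‖ enters the interpolation theorem. -/
lemma weightMass_prop {t : ℝ} {f : L2} (hf : MemJ t f) : weightMass (prop t f) = normJ t f ^ 2 := by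
  rw [normJ, ← lintegral_sq_eq_eLpNorm, weightMass_prop_eq_sum hf]
  simp_rw [enorm_sq_euclidean]
  rw [lintegral_finsetSum' _ fun j _ => ((Lp.aestronglyMeasurable (J t f j)).enorm.pow_const 2)]

lemma normJ_ne_top {t : ℝ} {f : L2} (hf : MemJ t f) : normJ t f ≠ ∞ := by
  have h : normJ t f ^ 2 ≠ ∞ := by
    rw [← weightMass_prop hf, weightMass_prop_eq_sum hf]
    refine ENNReal.sum_ne_top.2 fun j _ => ?_
    rw [lintegral_sq_eq_eLpNorm]
    exact ENNReal.pow_ne_top (Lp.eLpNorm_ne_top _)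
  exact fun h' => h (by rw [h']; simp)

/-! ### Frequency-localized dispersive bounds -/

lemma disp'_le (r : ℝ) : disp' r ≤ 2 * √(2 + r ^ 2) := by
  have hs : 0 < √(2 + r ^ 2) := Real.sqrt_pos.2 (by positivity)
  have hs2 : √(2 + r ^ 2) ^ 2 = 2 + r ^ 2 := Real.sq_sqrt (by positivity)
  rw [disp', div_le_iff₀ hs]
  nlinarith

/-- On r ≥ N/2 one has h'(r)/r ≤ 2√(2 + r²)/r ≤ 6/N: this is the L² norm B of the localized
operator, of the size of the symbol of U⁻¹ at frequency N. The bound does not depend on d. -/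
lemma abs_radSymbol_le {n : ℝ → ℝ} {M N d : ℝ} (hn : ∀ r, |n r| ≤ M) (hN0 : 0 < N) (hN : N ≤ 1)
    (hsupp : ∀ r, r ∉ Set.Icc (N / 2) d → n r = 0) (r : ℝ) : |radSymbol n r| ≤ 6 * M / N := by
  have hM : 0 ≤ M := (abs_nonneg _).trans (hn 0)
  by_cases hr : r ∈ Set.Icc (N / 2) d
  · have hr0 : 0 < r := by linarith [hr.1]
    have hs : √(2 + r ^ 2) ≤ 3 * r / N := by
      rw [Real.sqrt_le_left (by positivity), div_pow, le_div_iff₀ (by positivity)]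
      have h1 : N ^ 2 ≤ (2 * r) ^ 2 := by gcongr; linarith [hr.1]
      nlinarith [mul_le_mul_of_nonneg_left (pow_le_one₀ hN0.le hN : N ^ 2 ≤ 1) (sq_nonneg r)]
    rw [radSymbol, abs_div, abs_mul, abs_of_nonneg (disp'_nonneg r), abs_of_pos hr0, div_le_iff₀ hr0]
    calc disp' r * |n r| ≤ (2 * (3 * r / N)) * M := by
          gcongr
          · exact (disp'_le r).trans (by gcongr)
          · exact hn r
      _ = _ := by ring
  · rw [radSymbol, hsupp r hr]
    simp only [mul_zero, zero_div, abs_zero]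
    positivity

lemma measurable_radSymbol {n : ℝ → ℝ} (hn : Continuous n) : Measurable (radSymbol n) := by
  have := continuous_disp'.measurable
  have := hn.measurable
  unfold radSymbol
  fun_prop

lemma measurable_radSymbol_norm {n : ℝ → ℝ} (hn : Continuous n) :
    Measurable fun ξ : R3 => ((radSymbol n ‖ξ‖ : ℝ) : ℂ) :=
  Complex.measurable_ofReal.comp ((measurable_radSymbol hn).comp measurable_norm)

/-- A kernel bound yields a weighted `L^{6,2}` bound for the localized propagator. -/
lemma exists_lorentzNorm_radSymbol_le : ∃ C : ℝ≥0, ∀ (n : ℝ → ℝ) (M N d t A : ℝ), 0 < M → 0 < N →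
    N ≤ 1 → N / 2 ≤ d → 0 < A → Ampl n M → (∀ r, r ∉ Set.Icc (N / 2) d → n r = 0) →
    (∀ ρ, ‖oscInt n t ρ (N / 4) (2 * d)‖ ≤ A) → ∀ v : L2, MemJ t v →
    lorentzNorm 6 2 (mult (fun ξ => radSymbol n ‖ξ‖) v) ≤
      C * ENNReal.ofReal (A ^ (2 / 3 : ℝ) * (6 * M / N) ^ (1 / 3 : ℝ)) * normJ t v := by
  obtain ⟨C, hC⟩ := exists_lorentzNorm_le
  refine ⟨C, fun n M N d t A hM hN0 hN hd hA hn hsupp hosc v hv => ?_⟩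
  have hnc := hn.contDiff.continuous
  have hB : 0 < 6 * M / N := by positivity
  have hker := continuous_kerSymbol t hnc (by positivity : 0 < N / 2) hsupp
  have hb (ξ : R3) : ‖kerSymbol n t ξ‖ ≤ 6 * M / N := by
    rw [norm_kerSymbol]; exact abs_radSymbol_le hn.bdd hN0 hN hsupp _
  have hb' (ξ : R3) : ‖((radSymbol n ‖ξ‖ : ℝ) : ℂ)‖ ≤ 6 * M / N := by
    rw [Complex.norm_real]; exact abs_radSymbol_le hn.bdd hN0 hN hsupp _
  have hdisp : Dispersive (mult (kerSymbol n t)) ⟨A, hA.le⟩ ⟨6 * M / N, hB.le⟩ := by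
    refine dispersive_mult hker.measurable
      (NNReal.coe_ne_zero.1 (show ((⟨A, hA.le⟩ : ℝ≥0) : ℝ) ≠ 0
      from hA.ne')) hb ?_ fun x => ?_
    · exact (integrable_kerSymbol t hnc (by positivity) hsupp).comp_smul (by positivity)
    · exact (norm_fourierInv_kerSymbol_le t hnc (by positivity) hsupp (by positivity : 0 < N / 4)
        (by linarith) (by linarith : d < 2 * d) (by linarith) x).trans (hosc _)
  -- The phase of the kernel symbol cancels that of e^{itH}: the multiplier acting on v is the
  -- dispersive operator acting on e^{itH}v.
  have heq : mult (fun ξ => radSymbol n ‖ξ‖) v = mult (kerSymbol n t) (prop t v) := by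
    refine (mult_mult (multDom_propSymbol t v) (multDom_of_bounded (measurable_radSymbol_norm hnc)
      hb' v) fun ξ => ?_).2.symm
    rw [kerSymbol, propSymbol, mul_assoc, ← Complex.exp_add]
    have : hSymbol ξ = disp ‖ξ‖ := rfl
    rw [this]
    have h0 : Complex.I * ((-t * disp ‖ξ‖ : ℝ) : ℂ) + Complex.I * ((t * disp ‖ξ‖ : ℝ) : ℂ) = 0 := by
      push_cast; ring
    rw [h0, Complex.exp_zero, mul_one]
  rw [heq]
  refine (hC _ _ _ (NNReal.coe_ne_zero.1 (show ((⟨A, hA.le⟩ : ℝ≥0) : ℝ) ≠ 0 from hA.ne'))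
    (NNReal.coe_ne_zero.1 (show ((⟨_, hB.le⟩ : ℝ≥0) : ℝ) ≠ 0 from hB.ne')) hdisp _).trans (le_of_eq ?_)
  rw [weightMass_prop hv, ENNReal_sq_rpow_half]
  congr 2
  rw [← ENNReal.ofReal_coe_nnreal]
  congr 1

lemma sqrt_two_add_sq_le_five {r : ℝ} (h0 : 0 ≤ r) (hr : r ≤ 4) : √(2 + r ^ 2) ≤ 5 := by
  rw [Real.sqrt_le_left (by norm_num)]; nlinarith

/-- The interval is shorter than 4N, and on it h' ≤ 10, |n| ≤ M and the spherical mean is at most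
8N; the product is 320 M N². -/
lemma norm_oscInt_le_of_localized {n : ℝ → ℝ} {M N t : ℝ} (hn : Ampl n M) (hN0 : 0 < N)
    (hN : N ≤ 1) (ρ : ℝ) : ‖oscInt n t ρ (N / 4) (2 * (2 * N))‖ ≤ 320 * M * N ^ 2 := by
  have hM := hn.nonneg
  refine (norm_oscInt_le_trivial hn.contDiff.continuous ρ (by positivity) (by linarith)).trans ?_
  have hd := continuous_disp'
  have hnc := hn.contDiff.continuous
  calc ∫ r in (N / 4)..(2 * (2 * N)), disp' r * |n r| * (2 * r)
      ≤ ∫ r in (N / 4)..(2 * (2 * N)), (10 * M * (8 * N) : ℝ) := by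
        refine intervalIntegral.integral_mono_on (by linarith)
          (Continuous.intervalIntegrable (by fun_prop) _ _) (by simp) fun r hr => ?_
        have hr0 : 0 ≤ r := le_trans (by positivity) hr.1
        have h1 : disp' r ≤ 10 :=
          (disp'_le r).trans (by linarith [sqrt_two_add_sq_le_five hr0 (by linarith [hr.2])])
        exact mul_le_mul (mul_le_mul h1 (hn.bdd r) (abs_nonneg _) (by norm_num))
          (by linarith [hr.2]) (by linarith) (by positivity)
    _ = (2 * (2 * N) - N / 4) * (10 * M * (8 * N)) := by
        rw [intervalIntegral.integral_const, smul_eq_mul]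
    _ ≤ _ := by nlinarith [mul_nonneg hM (sq_nonneg N)]

/-- After the integration by parts the integrand is at most 4M on an interval shorter than 4N. -/
lemma norm_oscInt_le_of_localized_inv {n : ℝ → ℝ} {M N t : ℝ} (hn : Ampl n M) (hN0 : 0 < N)
    (ht : 0 < t) {ρ : ℝ}
    (hsupp : ∀ r, r ∉ Set.Icc (N / 2) (2 * N) → n r = 0) :
    ‖oscInt n t ρ (N / 4) (2 * (2 * N))‖ ≤ 16 * M * N / t := by
  have hM := hn.nonneg
  have hna := hsupp (N / 4) fun h => by linarith [h.1]
  have hnb := hsupp (2 * (2 * N)) fun h => by linarith [h.2]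
  refine (norm_oscInt_le_inv hn.contDiff ht ρ (by positivity) (by linarith) hna hnb).trans ?_
  have hnc := hn.contDiff.continuous
  have hnc' := hn.continuous_deriv
  rw [div_eq_inv_mul (16 * M * N)]
  refine mul_le_mul_of_nonneg_left ?_ (by positivity)
  calc ∫ r in (N / 4)..(2 * (2 * N)), (2 * |r * deriv n r| + 2 * |n r|)
      ≤ ∫ r in (N / 4)..(2 * (2 * N)), (2 * M + 2 * M : ℝ) := by
        refine intervalIntegral.integral_mono_on (by linarith)
          (Continuous.intervalIntegrable (by fun_prop) _ _) (by simp) fun r hr => ?_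
        gcongr
        · exact hn.bdd_deriv r
        · exact hn.bdd r
    _ = (2 * (2 * N) - N / 4) * (2 * M + 2 * M) := by
        rw [intervalIntegral.integral_const, smul_eq_mul]
    _ ≤ _ := by nlinarith [mul_nonneg hM hN0.le]

/-- The dispersive bound of an amplitude supported in `[N / 2, ∞)`. -/
lemma exists_lorentzNorm_dispersive : ∃ C : ℝ≥0, ∀ (n : ℝ → ℝ) (M : ℝ≥0) (N d t : ℝ), 0 < M →
    0 < N → N ≤ 1 → N / 2 ≤ d → 0 < t → Ampl n M → (∀ r, r ∉ Set.Icc (N / 2) d → n r = 0) →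
    ∀ v : L2, MemJ t v →
    lorentzNorm 6 2 (mult (fun ξ => radSymbol n ‖ξ‖) v) ≤
      C * M * (ENNReal.ofReal N ^ (-(2 / 3) : ℝ) * ENNReal.ofReal t ^ (-1 : ℝ)) * normJ t v := by
  obtain ⟨C, hC⟩ := exists_lorentzNorm_radSymbol_le
  refine ⟨C * 64, fun n M N d t hM hN0 hN hd ht hn hsupp v hv => ?_⟩
  have hM' : (0 : ℝ) < M := hM
  have hs : 0 < √(t * (N / 3)) := Real.sqrt_pos.2 (by positivity)
  refine (hC n M N d t (t⁻¹ * (32 * M / √(t * (N / 3)))) hM' hN0 hN hd (by positivity) hn hsupp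
    (fun ρ => norm_oscInt_le hn ht ρ hN0 hN le_rfl (by linarith) (by linarith)
      (by linarith : d < 2 * d) hsupp) v hv).trans (mul_le_mul_left ?_ _)
  rw [ENNReal.ofReal_rpow_of_pos hN0, ENNReal.ofReal_rpow_of_pos ht, ENNReal.coe_mul, mul_assoc,
    mul_assoc]
  refine mul_le_mul' le_rfl ?_
  rw [← ENNReal.ofReal_coe_nnreal, ← ENNReal.ofReal_coe_nnreal, ← ENNReal.ofReal_mul (by positivity),
    ← ENNReal.ofReal_mul (by positivity), ← ENNReal.ofReal_mul (by positivity)]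
  refine ENNReal.ofReal_le_ofReal ?_
  push_cast
  -- Cubing clears the exponents 2/3 and 1/3. The numerical constant becomes 32² · 3 · 6 = 18432,
  -- which is below 64³.
  refine le_of_pow_le_pow_left₀ (n := 3) (by norm_num) (by positivity) ?_
  have e1 : ((t⁻¹ * (32 * M / √(t * (N / 3)))) ^ (2 / 3 : ℝ) * (6 * M / N) ^ (1 / 3 : ℝ)) ^ 3 =
      (t⁻¹ * (32 * M / √(t * (N / 3)))) ^ 2 * (6 * M / N) := by
    rw [mul_pow, ← Real.rpow_natCast, ← Real.rpow_natCast, ← Real.rpow_mul (by positivity),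
      ← Real.rpow_mul (by positivity)]
    norm_num
  have e2 : (64 * (M * (N ^ (-(2 / 3) : ℝ) * t ^ (-1 : ℝ)))) ^ 3 =
      64 ^ 3 * (M : ℝ) ^ 3 * ((N ^ 2)⁻¹ * (t ^ 3)⁻¹) := by
    rw [mul_pow, mul_pow, mul_pow, ← Real.rpow_natCast, ← Real.rpow_natCast (t ^ _),
      ← Real.rpow_natCast (N ^ _), ← Real.rpow_mul hN0.le, ← Real.rpow_mul ht.le]
    norm_num [Real.rpow_neg hN0.le, Real.rpow_neg ht.le]
    ring
  rw [e1, e2, mul_pow, div_pow, Real.sq_sqrt (by positivity)]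
  have : (t⁻¹) ^ 2 * ((32 * M) ^ 2 / (t * (N / 3))) * (6 * M / N) =
      18432 * (M : ℝ) ^ 3 * ((N ^ 2)⁻¹ * (t ^ 3)⁻¹) := by
    field_simp
    norm_num
  rw [this]
  gcongr
  norm_num

/-- Here A ~ N² and B ~ 1/N, so A^{2/3}B^{1/3} ~ N, with no condition on t. -/
lemma exists_lorentzNorm_localized : ∃ C : ℝ≥0, ∀ (n : ℝ → ℝ) (M : ℝ≥0) (N t : ℝ), 0 < M →
    0 < N → N ≤ 1 → Ampl n M → (∀ r, r ∉ Set.Icc (N / 2) (2 * N) → n r = 0) →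
    ∀ v : L2, MemJ t v →
    lorentzNorm 6 2 (mult (fun ξ => radSymbol n ‖ξ‖) v) ≤
      C * M * ENNReal.ofReal N * normJ t v := by
  obtain ⟨C, hC⟩ := exists_lorentzNorm_radSymbol_le
  refine ⟨C * 100, fun n M N t hM hN0 hN hn hsupp v hv => ?_⟩
  have hM' : (0 : ℝ) < M := hM
  refine (hC n M N (2 * N) t (320 * M * N ^ 2) hM' hN0 hN (by linarith) (by positivity) hn hsupp
    (norm_oscInt_le_of_localized hn hN0 hN) v hv).trans (mul_le_mul_left ?_ _)
  rw [ENNReal.coe_mul, mul_assoc ((C : ℝ≥0∞) * _), mul_assoc (C : ℝ≥0∞)]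
  refine mul_le_mul' le_rfl ?_
  rw [← ENNReal.ofReal_coe_nnreal, ← ENNReal.ofReal_coe_nnreal,
    ← ENNReal.ofReal_mul (by positivity), ← ENNReal.ofReal_mul (by positivity)]
  refine ENNReal.ofReal_le_ofReal ?_
  push_cast
  refine le_of_pow_le_pow_left₀ (n := 3) (by norm_num) (by positivity) ?_
  have e1 : ((320 * M * N ^ 2) ^ (2 / 3 : ℝ) * (6 * M / N) ^ (1 / 3 : ℝ)) ^ 3 =
      (320 * M * N ^ 2) ^ 2 * (6 * M / N) := by
    have hX : 0 ≤ 320 * M * N ^ 2 := by positivity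
    generalize 320 * M * N ^ 2 = X at hX
    rw [mul_pow, ← Real.rpow_natCast, ← Real.rpow_natCast, ← Real.rpow_mul hX,
      ← Real.rpow_mul (by positivity)]
    norm_num
  rw [e1]
  have e2 : (320 * M * N ^ 2) ^ 2 * (6 * M / N) = 614400 * ((M : ℝ) ^ 3 * N ^ 3) := by
    field_simp
    norm_num
  rw [e2]
  have : 0 ≤ (M : ℝ) ^ 3 * N ^ 3 := by positivity
  nlinarith

/-- Here A ~ N/t and B ~ 1/N, so A^{2/3}B^{1/3} ~ N^{1/3}t^{-2/3}. -/
lemma exists_lorentzNorm_localized_inv : ∃ C : ℝ≥0, ∀ (n : ℝ → ℝ) (M : ℝ≥0) (N t : ℝ), 0 < M →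
    0 < N → N ≤ 1 → 0 < t → Ampl n M → (∀ r, r ∉ Set.Icc (N / 2) (2 * N) → n r = 0) →
    ∀ v : L2, MemJ t v →
    lorentzNorm 6 2 (mult (fun ξ => radSymbol n ‖ξ‖) v) ≤
      C * M * (ENNReal.ofReal N ^ (1 / 3 : ℝ) * ENNReal.ofReal t ^ (-(2 / 3) : ℝ)) *
        normJ t v := by
  obtain ⟨C, hC⟩ := exists_lorentzNorm_radSymbol_le
  refine ⟨C * 16, fun n M N t hM hN0 hN ht hn hsupp v hv => ?_⟩
  have hM' : (0 : ℝ) < M := hM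
  refine (hC n M N (2 * N) t (16 * M * N / t) hM' hN0 hN (by linarith) (by positivity) hn hsupp
    (fun ρ => norm_oscInt_le_of_localized_inv hn hN0 ht hsupp) v hv).trans (mul_le_mul_left ?_ _)
  rw [ENNReal.ofReal_rpow_of_pos hN0, ENNReal.ofReal_rpow_of_pos ht, ENNReal.coe_mul,
    mul_assoc ((C : ℝ≥0∞) * _), mul_assoc (C : ℝ≥0∞)]
  refine mul_le_mul' le_rfl ?_
  rw [← ENNReal.ofReal_coe_nnreal, ← ENNReal.ofReal_coe_nnreal, ← ENNReal.ofReal_mul (by positivity),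
    ← ENNReal.ofReal_mul (by positivity), ← ENNReal.ofReal_mul (by positivity)]
  refine ENNReal.ofReal_le_ofReal ?_
  push_cast
  refine le_of_pow_le_pow_left₀ (n := 3) (by norm_num) (by positivity) ?_
  have e1 : ((16 * M * N / t) ^ (2 / 3 : ℝ) * (6 * M / N) ^ (1 / 3 : ℝ)) ^ 3 =
      (16 * M * N / t) ^ 2 * (6 * M / N) := by
    rw [mul_pow, ← Real.rpow_natCast, ← Real.rpow_natCast, ← Real.rpow_mul (by positivity),
      ← Real.rpow_mul (by positivity)]
    norm_num
  have e2 : (16 * (M * (N ^ (1 / 3 : ℝ) * t ^ (-(2 / 3) : ℝ)))) ^ 3 =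
      16 ^ 3 * (M : ℝ) ^ 3 * (N * (t ^ 2)⁻¹) := by
    rw [mul_pow, mul_pow, mul_pow, ← Real.rpow_natCast, ← Real.rpow_natCast (t ^ _),
      ← Real.rpow_natCast (N ^ _), ← Real.rpow_mul hN0.le, ← Real.rpow_mul ht.le]
    norm_num [Real.rpow_neg ht.le]
    ring
  rw [e1, e2]
  have : (16 * M * N / t) ^ 2 * (6 * M / N) = 1536 * (M : ℝ) ^ 3 * (N * (t ^ 2)⁻¹) := by
    field_simp
    norm_num
  rw [this]
  gcongr
  norm_num

/-! ### Radial profiles of the Littlewood-Paley cutoffs -/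

/-- The profile of a radial function. -/
def profile (φ : R3 → ℝ) (s : ℝ) : ℝ := φ (s • EuclideanSpace.single 0 1)

/-- A smooth step: zero on `(-∞, 0]`, one on `[1 / 4, ∞)`. -/
def ramp (s : ℝ) : ℝ := Real.smoothTransition (4 * s)

/-- The profile of `ψ(ξ) = φ(ξ) - φ(2ξ)`, cut off to the positive half line. -/
def bump (φ : R3 → ℝ) (s : ℝ) : ℝ := (profile φ s - profile φ (2 * s)) * ramp s

lemma ramp_of_nonpos {s : ℝ} (hs : s ≤ 0) : ramp s = 0 :=
  Real.smoothTransition.zero_of_nonpos (by linarith)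

lemma ramp_of_le {s : ℝ} (hs : 1 / 4 ≤ s) : ramp s = 1 :=
  Real.smoothTransition.one_of_one_le (by linarith)

lemma contDiff_ramp : ContDiff ℝ 2 ramp :=
  Real.smoothTransition.contDiff.comp (contDiff_const.mul contDiff_id)

/-- The ramp equals 1 on a half line, but its derivative lives in [0, 1/4], which is enough. -/
lemma exists_ampl_ramp : ∃ M, Ampl ramp M := by
  refine Ampl.exists_of_hasCompactSupport_deriv (c := 1) contDiff_ramp (fun r => ?_) ?_
  · rw [ramp, abs_of_nonneg (Real.smoothTransition.nonneg _)]
    exact Real.smoothTransition.le_one _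
  · refine HasCompactSupport.intro (isCompact_Icc (a := (0 : ℝ)) (b := 1 / 4)) fun r hr => ?_
    have hr' : r < 0 ∨ 1 / 4 < r := by
      by_contra! h
      exact hr h
    rcases hr' with h | h
    · refine (Filter.EventuallyEq.deriv_eq (f := fun _ => (0 : ℝ)) ?_).trans (deriv_const _ _)
      filter_upwards [Iio_mem_nhds h] with s hs using ramp_of_nonpos (le_of_lt hs)
    · refine (Filter.EventuallyEq.deriv_eq (f := fun _ => (1 : ℝ)) ?_).trans (deriv_const _ _)
      filter_upwards [Ioi_mem_nhds h] with s hs using ramp_of_le (le_of_lt hs)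

namespace IsCutoff

variable {φ : R3 → ℝ}

lemma eq_profile (hφ : IsCutoff φ) (ξ : R3) : φ ξ = profile φ ‖ξ‖ :=
  hφ.radial _ _ (by rw [norm_smul, PiLp.norm_single]; simp)

lemma profile_eq_one (hφ : IsCutoff φ) {s : ℝ} (hs : |s| ≤ 1) : profile φ s = 1 :=
  hφ.eq_one _ (by rw [norm_smul, PiLp.norm_single]; simpa using hs)

lemma profile_eq_zero (hφ : IsCutoff φ) {s : ℝ} (hs : 11 / 10 < |s|) : profile φ s = 0 :=
  hφ.supp _ (by rw [norm_smul, PiLp.norm_single]; simpa using hs)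

lemma contDiff_profile (hφ : IsCutoff φ) : ContDiff ℝ 2 (profile φ) :=
  (hφ.smooth.of_le (by norm_cast)).comp (contDiff_id.smul contDiff_const)

lemma exists_ampl_profile (hφ : IsCutoff φ) : ∃ M, Ampl (profile φ) M := by
  refine Ampl.exists_of_hasCompactSupport hφ.contDiff_profile ?_
  refine HasCompactSupport.intro (isCompact_Icc (a := (-2 : ℝ)) (b := 2)) fun r hr => ?_
  refine hφ.profile_eq_zero ?_
  by_contra! h
  have := abs_le.1 h
  exact hr ⟨by linarith [this.1], by linarith [this.2]⟩

lemma bump_eq_zero (hφ : IsCutoff φ) {s : ℝ} (hs : s ∉ Set.Icc (1 / 2) 2) : bump φ s = 0 := by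
  rcases le_total s 0 with h | h
  · rw [bump, ramp_of_nonpos h, mul_zero]
  have hs' : s < 1 / 2 ∨ 2 < s := by
    by_contra! h
    exact hs h
  rcases hs' with h' | h'
  · rw [bump, hφ.profile_eq_one, hφ.profile_eq_one, sub_self, zero_mul]
    all_goals rw [abs_of_nonneg (by linarith)]; linarith
  · rw [bump, hφ.profile_eq_zero, hφ.profile_eq_zero, sub_self, zero_mul]
    all_goals rw [abs_of_nonneg (by linarith)]; linarith

/-- The ramp only acts on s < 1/4, where for s ≥ 0 both profiles equal 1 and their difference
vanishes anyway. It removes the mirror image on the negative axis of the even function ψ. -/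
lemma bump_of_nonneg (hφ : IsCutoff φ) {s : ℝ} (hs : 0 ≤ s) :
    bump φ s = profile φ s - profile φ (2 * s) := by
  rcases le_total (1 / 4) s with h | h
  · rw [bump, ramp_of_le h, mul_one]
  · rw [bump, hφ.profile_eq_one, hφ.profile_eq_one, sub_self, zero_mul]
    all_goals rw [abs_of_nonneg (by linarith)]; linarith

lemma contDiff_bump (hφ : IsCutoff φ) : ContDiff ℝ 2 (bump φ) :=
  ((hφ.contDiff_profile).sub (hφ.contDiff_profile.comp (contDiff_const.mul contDiff_id))).mul
    contDiff_ramp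

lemma hasCompactSupport_bump (hφ : IsCutoff φ) : HasCompactSupport (bump φ) :=
  HasCompactSupport.intro isCompact_Icc fun _ => hφ.bump_eq_zero

lemma exists_ampl_bump (hφ : IsCutoff φ) : ∃ M, Ampl (bump φ) M :=
  Ampl.exists_of_hasCompactSupport hφ.contDiff_bump hφ.hasCompactSupport_bump

lemma exists_ampl_mul_bump (hφ : IsCutoff φ) : ∃ M, Ampl (fun s => s * bump φ s) M :=
  Ampl.exists_of_hasCompactSupport (contDiff_id.mul hφ.contDiff_bump)
    (hφ.hasCompactSupport_bump.mul_left (f := fun s : ℝ => s))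

lemma lpSymbol_eq (hφ : IsCutoff φ) {N : ℝ} (hN : 0 < N) (ξ : R3) :
    lpSymbol φ N ξ = (bump φ (‖ξ‖ / N) : ℝ) := by
  have h1 : ‖N⁻¹ • ξ‖ = ‖ξ‖ / N := by
    rw [norm_smul, norm_inv, Real.norm_of_nonneg hN.le, inv_mul_eq_div]
  rw [lpSymbol, hφ.eq_profile, hφ.eq_profile ((2 : ℝ) • _), norm_smul (2 : ℝ), h1,
    hφ.bump_of_nonneg (by positivity), Real.norm_of_nonneg zero_le_two]

lemma bump_div_eq_zero (hφ : IsCutoff φ) {N : ℝ} (hN : 0 < N) {r : ℝ}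
    (hr : r ∉ Set.Icc (N / 2) (2 * N)) :
    bump φ (r / N) = 0 := by
  refine hφ.bump_eq_zero fun h => hr ⟨?_, ?_⟩
  · have := (le_div_iff₀ hN).1 h.1; linarith
  · exact (div_le_iff₀ hN).1 h.2

lemma continuous (hφ : IsCutoff φ) : Continuous φ := hφ.smooth.continuous

lemma exists_bound (hφ : IsCutoff φ) : ∃ c : ℝ, ∀ ξ, |φ ξ| ≤ c := by
  obtain ⟨M, hM⟩ := hφ.exists_ampl_profile
  exact ⟨M, fun ξ => by rw [hφ.eq_profile]; exact hM.bdd _⟩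

end IsCutoff

/-- Fixing one cutoff makes the constants of the summed estimates absolute. The factor 100/21 is the
inverse of 121/100 - 1. -/
lemma exists_isCutoff : ∃ φ : R3 → ℝ, IsCutoff φ := by
  refine ⟨fun ξ => Real.smoothTransition ((121 / 100 - ‖ξ‖ ^ 2) * (100 / 21)), ?_, fun ξ η h => ?_,
    fun ξ h => ?_, fun ξ h => ?_⟩
  · exact Real.smoothTransition.contDiff.comp
      ((contDiff_const.sub (contDiff_norm_sq ℝ)).mul contDiff_const)
  · simp only [h]
  · refine Real.smoothTransition.one_of_one_le ?_
    nlinarith [norm_nonneg ξ]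
  · refine Real.smoothTransition.zero_of_nonpos ?_
    nlinarith [norm_nonneg ξ]

/-! ### Symbols as radial amplitudes -/

/-- The amplitude of U⁻¹ is chosen so that h' · `uAmp` = √(2 + r²); division by r gives the symbol
of U⁻¹. -/
lemma radSymbol_uAmp_mul (k : ℝ → ℝ) (r : ℝ) :
    radSymbol (fun r => uAmp r * k r) r = (r / √(2 + r ^ 2))⁻¹ * k r := by
  have hs : 0 < √(2 + r ^ 2) := Real.sqrt_pos.2 (by positivity)
  have hs2 : √(2 + r ^ 2) ^ 2 = 2 + r ^ 2 := Real.sq_sqrt (by positivity)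
  have h : disp' r * uAmp r = √(2 + r ^ 2) := by
    rw [disp', uAmp]
    field_simp
    rw [hs2]
  rw [radSymbol, ← mul_assoc, h, inv_div]
  ring

/-- Multiplying by the symbol of U turns U⁻¹ back into the identity. At r = 0 the left side is 0 by
the convention for division, so k must vanish there. -/
lemma radSymbol_uAmp_mul_div (k : ℝ → ℝ) {r : ℝ} (hk : r = 0 → k r = 0) :
    radSymbol (fun r => uAmp r * (r / √(2 + r ^ 2)) * k r) r = k r := by
  simp only [mul_assoc]
  rw [radSymbol_uAmp_mul]
  rcases eq_or_ne r 0 with h | h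
  · rw [hk h]; simp
  · have hs : 0 < √(2 + r ^ 2) := Real.sqrt_pos.2 (by positivity)
    field_simp

lemma uInvSymbol_eq (ξ : R3) : uInvSymbol ξ = ((‖ξ‖ / √(2 + ‖ξ‖ ^ 2))⁻¹ : ℝ) := rfl

lemma measurable_uInvSymbol : Measurable uInvSymbol := by
  unfold uInvSymbol bracket
  fun_prop

lemma measurable_lpSymbol {φ : R3 → ℝ} (hφ : IsCutoff φ) (N : ℝ) : Measurable (lpSymbol φ N) := by
  have := hφ.continuous
  unfold lpSymbol
  fun_prop

lemma exists_norm_lpSymbol_le {φ : R3 → ℝ} (hφ : IsCutoff φ) :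
    ∃ c : ℝ, ∀ N ξ, ‖lpSymbol φ N ξ‖ ≤ c := by
  obtain ⟨c, hc⟩ := hφ.exists_bound
  refine ⟨c + c, fun N ξ => ?_⟩
  rw [lpSymbol, Complex.norm_real]
  exact (abs_sub _ _).trans (add_le_add (hc _) (hc _))

/-- The frequency-localized bound for `U⁻¹ v_N`. -/
lemma exists_lorentzNorm_uInv_lpProj {φ : R3 → ℝ} (hφ : IsCutoff φ) :
    ∃ C : ℝ≥0, ∀ t : ℝ, 0 ≤ t → ∀ v : L2, MemJ t v → ∀ N : ℝ, 0 < N → N ≤ 1 →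
      MultDom (fun ξ => uInvSymbol ξ * lpSymbol φ N ξ) v ∧
      lorentzNorm 6 2 (mult (fun ξ => uInvSymbol ξ * lpSymbol φ N ξ) v)
        ≤ C * min (ENNReal.ofReal N)
            (min (ENNReal.ofReal N ^ (1 / 3 : ℝ) * ENNReal.ofReal t ^ (-(2 / 3) : ℝ))
              (ENNReal.ofReal N ^ (-(2 / 3) : ℝ) * ENNReal.ofReal t ^ (-1 : ℝ)))
          * normJ t v := by
  obtain ⟨M₁, hM₁⟩ := exists_ampl_uAmp
  obtain ⟨M₂, hM₂⟩ := hφ.exists_ampl_bump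
  obtain ⟨C₁, h₁⟩ := exists_lorentzNorm_localized
  obtain ⟨C₂, h₂⟩ := exists_lorentzNorm_localized_inv
  obtain ⟨C₃, h₃⟩ := exists_lorentzNorm_dispersive
  set M : ℝ≥0 := (4 * (M₁ * M₂)).toNNReal + 1 with hM
  have hM0 : 0 < M := by positivity
  refine ⟨(C₁ + C₂ + C₃) * M, fun t ht v hv N hN0 hN => ?_⟩
  have hn : Ampl (fun r => uAmp r * bump φ (r / N)) M :=
    (hM₁.mul (hM₂.comp_div hN0)).mono (by
      rw [hM]; push_cast; linarith [Real.le_coe_toNNReal (4 * (M₁ * M₂))])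
  have hsupp (r : ℝ) (hr : r ∉ Set.Icc (N / 2) (2 * N)) : uAmp r * bump φ (r / N) = 0 := by
    rw [hφ.bump_div_eq_zero hN0 hr, mul_zero]
  have hsymb : (fun ξ => uInvSymbol ξ * lpSymbol φ N ξ) =
      fun ξ : R3 => ((radSymbol (fun r => uAmp r * bump φ (r / N)) ‖ξ‖ : ℝ) : ℂ) := by
    funext ξ
    rw [radSymbol_uAmp_mul, hφ.lpSymbol_eq hN0, uInvSymbol_eq]
    push_cast
    rfl
  rw [hsymb]
  refine ⟨multDom_of_bounded (measurable_radSymbol_norm hn.contDiff.continuous) (fun ξ => by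
    rw [Complex.norm_real]; exact abs_radSymbol_le hn.bdd hN0 hN hsupp _) v, ?_⟩
  have hC₁ : (C₁ : ℝ≥0∞) * M ≤ ((C₁ + C₂ + C₃) * M : ℝ≥0) := by
    push_cast
    exact mul_le_mul_left ((le_add_right le_rfl).trans (le_add_right le_rfl)) _
  have hC₂ : (C₂ : ℝ≥0∞) * M ≤ ((C₁ + C₂ + C₃) * M : ℝ≥0) := by
    push_cast
    exact mul_le_mul_left ((le_add_left le_rfl).trans (le_add_right le_rfl)) _
  have hC₃ : (C₃ : ℝ≥0∞) * M ≤ ((C₁ + C₂ + C₃) * M : ℝ≥0) := by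
    push_cast
    exact mul_le_mul_left (le_add_left le_rfl) _
  have b₁ := (h₁ _ M N t hM0 hN0 hN hn hsupp v hv).trans
    (mul_le_mul_left (mul_le_mul_left hC₁ _) _)
  -- At t = 0 the negative powers of t are ∞ in `ℝ≥0∞`, and the minimum is N.
  rcases ht.eq_or_lt with rfl | ht0
  · have hN' : ENNReal.ofReal N ≠ 0 := by simpa using hN0
    have e1 : ENNReal.ofReal N ^ (1 / 3 : ℝ) * ENNReal.ofReal (0 : ℝ) ^ (-(2 / 3) : ℝ) = ∞ := by
      rw [ENNReal.ofReal_zero, ENNReal.zero_rpow_of_neg (by norm_num), ENNReal.mul_top]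
      exact (ENNReal.rpow_pos (pos_iff_ne_zero.2 hN') ENNReal.ofReal_ne_top).ne'
    have e2 : ENNReal.ofReal N ^ (-(2 / 3) : ℝ) * ENNReal.ofReal (0 : ℝ) ^ (-1 : ℝ) = ∞ := by
      rw [ENNReal.ofReal_zero, ENNReal.zero_rpow_of_neg (by norm_num), ENNReal.mul_top]
      exact (ENNReal.rpow_pos (pos_iff_ne_zero.2 hN') ENNReal.ofReal_ne_top).ne'
    rw [e1, e2, min_self, min_eq_left le_top]
    exact b₁
  · have b₂ := (h₂ _ M N t hM0 hN0 hN ht0 hn hsupp v hv).trans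
      (mul_le_mul_left (mul_le_mul_left hC₂ _) _)
    have b₃ := (h₃ _ M N (2 * N) t hM0 hN0 hN (by linarith) ht0 hn hsupp v hv).trans
      (mul_le_mul_left (mul_le_mul_left hC₃ _) _)
    rcases min_choice (ENNReal.ofReal N)
      (min (ENNReal.ofReal N ^ (1 / 3 : ℝ) * ENNReal.ofReal t ^ (-(2 / 3) : ℝ))
        (ENNReal.ofReal N ^ (-(2 / 3) : ℝ) * ENNReal.ofReal t ^ (-1 : ℝ))) with h | h <;> rw [h]
    · exact b₁
    rcases min_choice (ENNReal.ofReal N ^ (1 / 3 : ℝ) * ENNReal.ofReal t ^ (-(2 / 3) : ℝ))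
      (ENNReal.ofReal N ^ (-(2 / 3) : ℝ) * ENNReal.ofReal t ^ (-1 : ℝ)) with h | h <;> rw [h]
    · exact b₂
    · exact b₃

/-- The frequency-localized bound for `v_N`. -/
lemma exists_lorentzNorm_lpProj {φ : R3 → ℝ} (hφ : IsCutoff φ) :
    ∃ C : ℝ≥0, ∀ t : ℝ, 0 < t → ∀ v : L2, MemJ t v → ∀ N : ℝ, 0 < N → N ≤ 1 →
      lorentzNorm 6 2 (mult (lpSymbol φ N) v)
        ≤ C * (ENNReal.ofReal N ^ (1 / 3 : ℝ) * ENNReal.ofReal t ^ (-1 : ℝ)) * normJ t v := by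
  obtain ⟨M₁, hM₁⟩ := exists_ampl_uAmp
  obtain ⟨M₂, hM₂⟩ := exists_ampl_inv_bracket
  obtain ⟨M₃, hM₃⟩ := hφ.exists_ampl_mul_bump
  obtain ⟨C, h⟩ := exists_lorentzNorm_dispersive
  set M : ℝ≥0 := (4 * (M₁ * (4 * (M₂ * M₃)))).toNNReal + 1 with hM
  have hM0 : 0 < M := by positivity
  refine ⟨C * M, fun t ht v hv N hN0 hN => ?_⟩
  -- Writing r/√(2 + r²) as N · (r/N) · (2 + r²)^{-1/2} displays the gain of the identity over U⁻¹
  -- as a scalar N in front of a uniformly bounded amplitude. It improves N^{-2/3} to N^{1/3}.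
  have hn : Ampl (fun r => N * (uAmp r * ((√(2 + r ^ 2))⁻¹ * (r / N * bump φ (r / N)))))
      (M * N.toNNReal : ℝ≥0) :=
    ((hM₁.mul (hM₂.mul (hM₃.comp_div hN0))).const_mul N).mono (by
      rw [abs_of_pos hN0, NNReal.coe_mul, Real.coe_toNNReal _ hN0.le, mul_comm, hM]
      push_cast
      gcongr
      linarith [Real.le_coe_toNNReal (4 * (M₁ * (4 * (M₂ * M₃))))])
  have hne : (fun r => N * (uAmp r * ((√(2 + r ^ 2))⁻¹ * (r / N * bump φ (r / N))))) =
      fun r => uAmp r * (r / √(2 + r ^ 2)) * bump φ (r / N) := by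
    funext r
    field_simp
  rw [hne] at hn
  have hsupp (r : ℝ) (hr : r ∉ Set.Icc (N / 2) (2 * N)) :
      uAmp r * (r / √(2 + r ^ 2)) * bump φ (r / N) = 0 := by
    rw [hφ.bump_div_eq_zero hN0 hr, mul_zero]
  have hsymb : lpSymbol φ N = fun ξ : R3 =>
      ((radSymbol (fun r => uAmp r * (r / √(2 + r ^ 2)) * bump φ (r / N)) ‖ξ‖ : ℝ) : ℂ) := by
    funext ξ
    rw [radSymbol_uAmp_mul_div (fun r => bump φ (r / N)), hφ.lpSymbol_eq hN0]
    intro h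
    exact hφ.bump_div_eq_zero hN0 fun h' => by linarith [h'.1]
  rw [hsymb]
  refine (h _ _ N (2 * N) t (mul_pos hM0 (Real.toNNReal_pos.2 hN0)) hN0 hN (by linarith) ht hn hsupp
    v hv).trans (mul_le_mul_left (le_of_eq ?_) _)
  have hN' : (N.toNNReal : ℝ≥0∞) = ENNReal.ofReal N := rfl
  have e : ENNReal.ofReal N ^ (1 / 3 : ℝ) = ENNReal.ofReal N * ENNReal.ofReal N ^ (-(2 / 3) : ℝ) := by
    conv_rhs => enter [1]; rw [← ENNReal.rpow_one (ENNReal.ofReal N)]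
    rw [← ENNReal.rpow_add _ _ (by simpa using hN0) ENNReal.ofReal_ne_top]
    norm_num
  rw [e, ENNReal.coe_mul, ENNReal.coe_mul, hN']
  ring

/-- The dispersive bound at high frequencies. -/
lemma exists_lorentzNorm_high {φ : R3 → ℝ} (hφ : IsCutoff φ) {w : ℝ → ℝ} (hw : ∃ M, Ampl w M) :
    ∃ C : ℝ≥0, ∀ t : ℝ, 0 < t → ∀ v : L2, MemJ t v → ∀ R : ℝ, 1 ≤ R →
      lorentzNorm 6 2 (mult (fun ξ => radSymbol (fun r => w r *
        ((profile φ (r / R) - profile φ r) * ramp r)) ‖ξ‖) v)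
        ≤ C * ENNReal.ofReal t ^ (-1 : ℝ) * normJ t v := by
  obtain ⟨M₁, hM₁⟩ := hw
  obtain ⟨M₂, hM₂⟩ := hφ.exists_ampl_profile
  obtain ⟨M₃, hM₃⟩ := exists_ampl_ramp
  obtain ⟨C, h⟩ := exists_lorentzNorm_dispersive
  set M : ℝ≥0 := (4 * (M₁ * (4 * ((M₂ + |(-1 : ℝ)| * M₂) * M₃)))).toNNReal + 1 with hM
  have hM0 : 0 < M := by positivity
  refine ⟨C * M, fun t ht v hv R hR => ?_⟩
  have hR0 : 0 < R := by linarith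
  have hn : Ampl (fun r => w r * ((profile φ (r / R) - profile φ r) * ramp r)) M := by
    have := (hM₁.mul (((hM₂.comp_div hR0).add (hM₂.const_mul (-1))).mul hM₃)).mono
      (L := M) ((Real.le_coe_toNNReal _).trans (by rw [hM]; push_cast; linarith))
    have e (r : ℝ) : profile φ (r / R) - profile φ r = profile φ (r / R) + -1 * profile φ r := by
      ring
    simpa only [e] using this
  -- The dispersive bound is used with N = 1 and support in [1/2, 2R]. The constant is uniform in R
  -- because amplitude bounds are invariant under dilations.
  refine (h _ M 1 (2 * R) t hM0 one_pos le_rfl (by linarith) ht hn (fun r hr => ?_) v hv).trans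
    (mul_le_mul_left (le_of_eq (by simp)) _)
  suffices (profile φ (r / R) - profile φ r) * ramp r = 0 by rw [this, mul_zero]
  rcases le_total r 0 with h0 | h0
  · rw [ramp_of_nonpos h0, mul_zero]
  have hr' : r < 1 / 2 ∨ 2 * R < r := by
    by_contra! h
    exact hr h
  rcases hr' with h' | h'
  · rw [hφ.profile_eq_one, hφ.profile_eq_one, sub_self, zero_mul]
    · rw [abs_of_nonneg h0]; linarith
    · rw [abs_of_nonneg (by positivity), div_le_one hR0]; linarith
  · rw [hφ.profile_eq_zero, hφ.profile_eq_zero, sub_self, zero_mul]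
    · rw [abs_of_nonneg h0]; linarith
    · rw [abs_of_nonneg (by positivity), lt_div_iff₀ hR0]; linarith

/-- The symbol of the projection to the frequencies between `1` and `R`. -/
lemma IsCutoff.high_eq {φ : R3 → ℝ} (hφ : IsCutoff φ) {R : ℝ} (hR : 1 ≤ R) (ξ : R3) :
    φ (R⁻¹ • ξ) - φ ξ = (profile φ (‖ξ‖ / R) - profile φ ‖ξ‖) * ramp ‖ξ‖ := by
  have hR0 : 0 < R := by linarith
  have h1 : ‖R⁻¹ • ξ‖ = ‖ξ‖ / R := by
    rw [norm_smul, norm_inv, Real.norm_of_nonneg hR0.le, inv_mul_eq_div]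
  rw [hφ.eq_profile, hφ.eq_profile ξ, h1]
  rcases le_total (1 / 4) ‖ξ‖ with h | h
  · rw [ramp_of_le h, mul_one]
  · rw [hφ.profile_eq_one, hφ.profile_eq_one, sub_self, zero_mul]
    · rw [abs_of_nonneg (norm_nonneg _)]; linarith
    · rw [abs_of_nonneg (by positivity), div_le_one hR0]; linarith

open Filter Topology

/-! ### Littlewood-Paley summation -/

/-- Norm bounds pass to pointwise limits of dominated symbols. -/
lemma eLpNorm_mult_le_of_tendsto {s : R3 → ℂ} {S : ℕ → R3 → ℂ} {f : L2} {p D : ℝ≥0∞} {c : ℝ}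
    (hs : MultDom s f) (hsm : Measurable s) (hS : ∀ K, Measurable (S K))
    (hle : ∀ K ξ, ‖S K ξ‖ ≤ c * ‖s ξ‖)
    (hlim : ∀ ξ, ξ ≠ 0 → Tendsto (fun K => S K ξ) atTop (𝓝 (s ξ)))
    (hD : ∀ K, eLpNorm (mult (S K) f) p volume ≤ D) : eLpNorm (mult s f) p volume ≤ D := by
  have hd (K : ℕ) : MultDom (fun ξ => S K ξ - s ξ) f :=
    hs.mono ((hS K).sub hsm) (c := c + 1) fun ξ => by
      linarith [norm_sub_le (S K ξ) (s ξ), hle K ξ]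
  have hdiff (K : ℕ) : mult (S K) f - mult s f = mult (fun ξ => S K ξ - s ξ) f := by
    rw [mult_add_left hs (hd K) (k := S K) fun ξ => by ring, add_sub_cancel_left]
  -- Dominated convergence on the Fourier side gives convergence in L² of the truncated multipliers.
  have h2 : Tendsto (fun K => ∫⁻ ξ : R3,
      ‖(S K ((2 * Real.pi) • ξ) - s ((2 * Real.pi) • ξ)) * (𝓕 f : L2) ξ‖ₑ ^ 2) atTop (𝓝 0) := by
    have hb := (hs.const_mul ((c + 1 : ℝ) : ℂ)).eLpNorm_ne_top
    have := tendsto_lintegral_of_dominated_convergence' (μ := (volume : Measure R3))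
      (F := fun K ξ => ‖(S K ((2 * Real.pi) • ξ) - s ((2 * Real.pi) • ξ)) * (𝓕 f : L2) ξ‖ₑ ^ 2)
      (f := fun _ => 0)
      (fun ξ => ‖((c + 1 : ℝ) : ℂ) * (s ((2 * Real.pi) • ξ) * (𝓕 f : L2) ξ)‖ₑ ^ 2)
      (fun K => ((hd K).aestronglyMeasurable.enorm.pow_const 2)) (fun K => .of_forall fun ξ => ?_)
      (by rw [lintegral_sq_eq_eLpNorm]; exact ENNReal.pow_ne_top hb) ?_
    · simpa using this
    · refine pow_le_pow_left' ?_ 2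
      rw [enorm_le_iff_norm_le, norm_mul, norm_mul, norm_mul, ← mul_assoc]
      refine mul_le_mul_of_nonneg_right ?_ (norm_nonneg _)
      rw [Complex.norm_real]
      refine le_trans ?_ (mul_le_mul_of_nonneg_right (le_abs_self _) (norm_nonneg _))
      linarith [norm_sub_le (S K ((2 * Real.pi) • ξ)) (s ((2 * Real.pi) • ξ)),
        hle K ((2 * Real.pi) • ξ)]
    · filter_upwards [ae_ne_zero] with ξ hξ
      have h1 := ((hlim ((2 * Real.pi) • ξ) (by simpa [Real.pi_ne_zero] using hξ)).sub_const
        (s ((2 * Real.pi) • ξ))).mul_const ((𝓕 f : L2) ξ)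
      rw [sub_self, zero_mul] at h1
      have h3 := ENNReal.Tendsto.pow (n := 2) ((continuous_enorm.tendsto _).comp h1)
      simpa using h3
  have h3 : Tendsto (fun K => mult (S K) f) atTop (𝓝 (mult s f)) := by
    rw [tendsto_iff_edist_tendsto_0]
    have h4 := ((ENNReal.continuous_rpow_const (y := (1 / 2 : ℝ))).tendsto 0).comp h2
    rw [ENNReal.zero_rpow_of_pos (by norm_num)] at h4
    refine h4.congr fun K => ?_
    rw [Function.comp_apply, lintegral_sq_eq_eLpNorm, ENNReal_sq_rpow_half, edist_eq_enorm_sub,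
      hdiff, Lp.enorm_def, eLpNorm_mult (hd K)]
  -- L² convergence gives an almost everywhere convergent subsequence, along which Fatou's lemma
  -- carries the bound to any exponent p.
  obtain ⟨ns, -, hns⟩ := (tendstoInMeasure_of_tendsto_Lp h3).exists_seq_tendsto_ae
  refine (Lp.eLpNorm_lim_le_liminf_eLpNorm (fun n => Lp.aestronglyMeasurable _) _ hns).trans ?_
  exact liminf_le_of_frequently_le' (Frequently.of_forall fun n => hD _)

lemma measurable_mul_ofReal {σ : R3 → ℂ} (hσ : Measurable σ) {k : R3 → ℝ} (hk : Continuous k) :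
    Measurable fun ξ => σ ξ * ((k ξ : ℝ) : ℂ) :=
  hσ.mul (Complex.measurable_ofReal.comp hk.measurable)

/-- Summation of the dyadic pieces of a multiplier. -/
lemma eLpNorm_six_mult_le_of_dyadic {φ : R3 → ℝ} (hφ : IsCutoff φ) {σ : R3 → ℂ} (hσ : Measurable σ)
    {f : L2} (hf : MultDom σ f) {D : ℕ → ℝ≥0∞} {E : ℝ≥0∞}
    (hD : ∀ j : ℕ, eLpNorm (mult (fun ξ => σ ξ * lpSymbol φ ((2 : ℝ) ^ j)⁻¹ ξ) f) 6 volume ≤ D j)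
    (hE : ∀ K : ℕ, eLpNorm (mult (fun ξ => σ ξ * ((φ (((2 : ℝ) ^ K)⁻¹ • ξ) - φ ξ : ℝ) : ℂ)) f)
      6 volume ≤ E) :
    eLpNorm (mult σ f) 6 volume ≤ ∑' j, D j + E := by
  obtain ⟨c, hc⟩ := hφ.exists_bound
  have hcont := hφ.continuous
  have hbd (a b : ℝ) (ξ : R3) :
      ‖σ ξ * ((φ (a • ξ) - φ (b • ξ) : ℝ) : ℂ)‖ ≤ (c + c) * ‖σ ξ‖ := by
    rw [norm_mul, mul_comm, Complex.norm_real]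
    exact mul_le_mul_of_nonneg_right ((abs_sub _ _).trans (add_le_add (hc _) (hc _)))
      (norm_nonneg _)
  have hmeas (a b : ℝ) : Measurable fun ξ => σ ξ * ((φ (a • ξ) - φ (b • ξ) : ℝ) : ℂ) :=
    measurable_mul_ofReal hσ (by fun_prop)
  have hdom (a b : ℝ) : MultDom (fun ξ => σ ξ * ((φ (a • ξ) - φ (b • ξ) : ℝ) : ℂ)) f :=
    hf.mono (hmeas a b) (hbd a b)
  have hadd (a b d : ℝ) : eLpNorm (mult (fun ξ => σ ξ * ((φ (a • ξ) - φ (d • ξ) : ℝ) : ℂ)) f)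
      6 volume ≤ eLpNorm (mult (fun ξ => σ ξ * ((φ (a • ξ) - φ (b • ξ) : ℝ) : ℂ)) f) 6 volume +
        eLpNorm (mult (fun ξ => σ ξ * ((φ (b • ξ) - φ (d • ξ) : ℝ) : ℂ)) f) 6 volume := by
    rw [mult_add_left (hdom a b) (hdom b d) fun ξ => by push_cast; ring,
      eLpNorm_congr_ae (Lp.coeFn_add _ _)]
    exact eLpNorm_add_le (Lp.aestronglyMeasurable _) (Lp.aestronglyMeasurable _) (by norm_num)
  -- Telescoping: φ(ξ) - φ(2^K ξ) is the sum of ψ(2^j ξ) over j < K.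
  have hlow (K : ℕ) : eLpNorm (mult (fun ξ => σ ξ *
      ((φ ((1 : ℝ) • ξ) - φ ((2 : ℝ) ^ K • ξ) : ℝ) : ℂ)) f) 6 volume ≤
      ∑ j ∈ Finset.range K, D j := by
    induction K with
    | zero =>
      have h0 : mult (fun ξ => σ ξ * ((φ ((1 : ℝ) • ξ) - φ ((2 : ℝ) ^ 0 • ξ) : ℝ) : ℂ)) f = 0 := by
        refine (mult_eq_of_fourier ?_).2
        rw [FourierTransform.fourier_zero]
        filter_upwards [Lp.coeFn_zero ℂ 2 (volume : Measure R3)] with ξ hξ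
        rw [hξ]; simp
      rw [h0, eLpNorm_congr_ae (Lp.coeFn_zero _ _ _)]
      simp
    | succ K ih =>
      rw [Finset.sum_range_succ]
      refine (hadd 1 (2 ^ K) _).trans (add_le_add ih (le_trans (le_of_eq ?_) (hD K)))
      congr 4
      funext ξ
      rw [lpSymbol, inv_inv, smul_smul, pow_succ']
  refine eLpNorm_mult_le_of_tendsto (c := c + c)
    (S := fun K ξ => σ ξ * ((φ (((2 : ℝ) ^ K)⁻¹ • ξ) - φ ((2 : ℝ) ^ K • ξ) : ℝ) : ℂ)) hf hσ
    (fun K => hmeas _ _) (fun K => hbd _ _) (fun ξ hξ => ?_) fun K => ?_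
  -- For fixed ξ ≠ 0 and K large, φ(2^{-K}ξ) = 1 and φ(2^K ξ) = 0, so the truncated symbol is
  -- eventually equal to σ(ξ).
  · refine tendsto_const_nhds.congr' ?_
    have hξ0 : 0 < ‖ξ‖ := norm_pos_iff.2 hξ
    have hp := tendsto_pow_atTop_atTop_of_one_lt (one_lt_two (α := ℝ))
    filter_upwards [hp.eventually_ge_atTop ‖ξ‖, hp.eventually_gt_atTop (11 / 10 / ‖ξ‖)] with K h1 h2
    rw [hφ.eq_one, hφ.supp]
    · simp
    · rw [norm_smul, norm_pow, Real.norm_two]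
      exact (div_lt_iff₀ hξ0).1 h2
    · rw [norm_smul, norm_inv, norm_pow, Real.norm_two, inv_mul_eq_div]
      exact div_le_one_of_le₀ h1 (by positivity)
  · refine (hadd _ 1 _).trans ?_
    rw [add_comm]
    refine add_le_add ((hlow K).trans (ENNReal.sum_le_tsum _)) ?_
    simpa only [one_smul] using hE K

lemma ofReal_inv_two_pow_rpow (j : ℕ) (a : ℝ) :
    ENNReal.ofReal ((2 : ℝ) ^ j)⁻¹ ^ a = twoPow (a * (-(j : ℤ) : ℤ)) := by
  rw [twoPow_eq_ofReal, ENNReal.ofReal_rpow_of_pos (by positivity)]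
  congr 1
  push_cast
  rw [mul_comm a, Real.rpow_mul zero_le_two, Real.rpow_neg zero_le_two, Real.rpow_natCast]

/-- Summation of the low-frequency bounds for `U⁻¹`. -/
lemma exists_tsum_uInv_le : ∃ C : ℝ≥0, ∀ t : ℝ, 0 < t →
    ∑' j : ℕ, min (ENNReal.ofReal ((2 : ℝ) ^ j)⁻¹ ^ (1 / 3 : ℝ) * ENNReal.ofReal t ^ (-(2 / 3) : ℝ))
      (ENNReal.ofReal ((2 : ℝ) ^ j)⁻¹ ^ (-(2 / 3) : ℝ) * ENNReal.ofReal t ^ (-1 : ℝ)) ≤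
      C * ENNReal.ofReal (t ^ (-(7 / 9) : ℝ)) := by
  have k1 := geom_const_ne_top (a := 1 / 3) (by norm_num)
  have k2 := geom_const_ne_top (a := 2 / 3) (by norm_num)
  refine ⟨((1 - twoPow (-(1 / 3)))⁻¹ + (1 - twoPow (-(2 / 3)))⁻¹).toNNReal, fun t ht => ?_⟩
  rw [ENNReal.coe_toNNReal (ENNReal.add_ne_top.2 ⟨k1, k2⟩)]
  -- The two bounds agree at N = t^{-1/3}, with common value t^{-7/9}. Below this scale the first
  -- one sums geometrically, above it the second.
  set r : ℝ := t ^ (-(1 / 3) : ℝ) with hr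
  have hr0 : 0 < r := Real.rpow_pos_of_pos ht _
  let g (K : ℤ) : ℝ≥0∞ :=
    (if (2 : ℝ) ^ K ≤ r then twoPow (1 / 3 * K) else 0) * ENNReal.ofReal t ^ (-(2 / 3) : ℝ) +
    (if r < (2 : ℝ) ^ K then twoPow (-(2 / 3 * K)) else 0) * ENNReal.ofReal t ^ (-1 : ℝ)
  have hinj : Function.Injective fun j : ℕ => -(j : ℤ) := fun a b h => by simpa using h
  calc _ ≤ ∑' j : ℕ, g (-(j : ℤ)) := by
        refine ENNReal.tsum_le_tsum fun j => ?_
        rw [ofReal_inv_two_pow_rpow, ofReal_inv_two_pow_rpow]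
        rcases le_or_gt ((2 : ℝ) ^ (-(j : ℤ))) r with h | h
        · refine (min_le_left _ _).trans ?_
          simp only [g, if_pos h, if_neg h.not_gt, zero_mul, add_zero, le_refl]
        · refine (min_le_right _ _).trans ?_
          simp only [g, if_neg h.not_ge, if_pos h, zero_mul, zero_add, neg_mul, le_refl]
    _ ≤ ∑' K : ℤ, g K := ENNReal.tsum_comp_le_tsum_of_injective hinj g
    _ ≤ (1 - twoPow (-(1 / 3)))⁻¹ * ENNReal.ofReal (r ^ (1 / 3 : ℝ)) *
          ENNReal.ofReal t ^ (-(2 / 3) : ℝ) +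
        (1 - twoPow (-(2 / 3)))⁻¹ * ENNReal.ofReal (r ^ (-(2 / 3) : ℝ)) *
          ENNReal.ofReal t ^ (-1 : ℝ) := by
        rw [ENNReal.tsum_add, ENNReal.tsum_mul_right, ENNReal.tsum_mul_right]
        exact add_le_add (mul_le_mul_left (tsum_twoPow_le (by norm_num) hr0) _)
          (mul_le_mul_left (tsum_twoPow_gt (by norm_num) hr0) _)
    _ = _ := by
        have e1 : ENNReal.ofReal (r ^ (1 / 3 : ℝ)) * ENNReal.ofReal t ^ (-(2 / 3) : ℝ) =
            ENNReal.ofReal (t ^ (-(7 / 9) : ℝ)) := by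
          rw [ENNReal.ofReal_rpow_of_pos ht, ← ENNReal.ofReal_mul (by positivity), hr,
            ← Real.rpow_mul ht.le, ← Real.rpow_add ht]
          norm_num
        have e2 : ENNReal.ofReal (r ^ (-(2 / 3) : ℝ)) * ENNReal.ofReal t ^ (-1 : ℝ) =
            ENNReal.ofReal (t ^ (-(7 / 9) : ℝ)) := by
          rw [ENNReal.ofReal_rpow_of_pos ht, ← ENNReal.ofReal_mul (by positivity), hr,
            ← Real.rpow_mul ht.le, ← Real.rpow_add ht]
          norm_num
        rw [mul_assoc, e1, mul_assoc, e2, add_mul]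

/-- Frequencies below 1 contribute t^{-7/9} and those above 1 contribute t^{-1}; neither dominates
for all t > 0, so both are kept. -/
lemma exists_eLpNorm_six_uInv_of_pos : ∃ C : ℝ≥0, ∀ t : ℝ, 0 < t → ∀ v : L2, MemJ t v →
    MultDom uInvSymbol v → eLpNorm (mult uInvSymbol v) 6 volume ≤
      C * (ENNReal.ofReal (t ^ (-(7 / 9) : ℝ)) + ENNReal.ofReal (t ^ (-1 : ℝ))) * normJ t v := by
  obtain ⟨φ, hφ⟩ := exists_isCutoff
  obtain ⟨C₁, h₁⟩ := exists_lorentzNorm_uInv_lpProj hφ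
  obtain ⟨C₂, h₂⟩ := exists_lorentzNorm_high hφ exists_ampl_uAmp
  obtain ⟨C₃, h₃⟩ := exists_tsum_uInv_le
  refine ⟨2 * C₁ * C₃ + 2 * C₂, fun t ht v hv hd => ?_⟩
  refine (eLpNorm_six_mult_le_of_dyadic hφ measurable_uInvSymbol hd
    (D := fun j => 2 * C₁ * normJ t v *
      min (ENNReal.ofReal ((2 : ℝ) ^ j)⁻¹ ^ (1 / 3 : ℝ) * ENNReal.ofReal t ^ (-(2 / 3) : ℝ))
      (ENNReal.ofReal ((2 : ℝ) ^ j)⁻¹ ^ (-(2 / 3) : ℝ) * ENNReal.ofReal t ^ (-1 : ℝ)))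
    (E := 2 * (C₂ * ENNReal.ofReal t ^ (-1 : ℝ) * normJ t v)) (fun j => ?_) fun K => ?_).trans ?_
  · refine (eLpNorm_six_le_lorentzNorm _ (Lp.aestronglyMeasurable _)).trans ?_
    refine (mul_le_mul' le_rfl ((h₁ t ht.le v hv ((2 : ℝ) ^ j)⁻¹ (by positivity)
      (inv_le_one_of_one_le₀ (one_le_pow₀ one_le_two))).2.trans
      (mul_le_mul_left (mul_le_mul' le_rfl (min_le_right _ _)) _))).trans (le_of_eq ?_)
    ring
  · refine (eLpNorm_six_le_lorentzNorm _ (Lp.aestronglyMeasurable _)).trans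
      (mul_le_mul' le_rfl (le_trans (le_of_eq ?_)
        (h₂ t ht v hv (2 ^ K) (one_le_pow₀ one_le_two))))
    congr 4
    funext ξ
    rw [radSymbol_uAmp_mul, hφ.high_eq (one_le_pow₀ one_le_two), uInvSymbol_eq]
    push_cast
    rfl
  · rw [ENNReal.tsum_mul_left, ← ENNReal.ofReal_rpow_of_pos ht (p := -1)]
    refine (add_le_add_left (mul_le_mul' le_rfl (h₃ t ht)) _).trans ?_
    push_cast
    set X := ENNReal.ofReal (t ^ (-(7 / 9) : ℝ))
    set Y := ENNReal.ofReal t ^ (-1 : ℝ)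
    calc _ = (2 * C₁ * C₃ * X + 2 * C₂ * Y) * normJ t v := by ring
      _ ≤ (2 * C₁ * C₃ * (X + Y) + 2 * C₂ * (X + Y)) * normJ t v := by
        gcongr
        · exact le_self_add
        · exact le_add_self
      _ = _ := by ring

/-- Without U⁻¹ the dyadic pieces are bounded by N^{1/3}t^{-1}, which is summable over N ≤ 1, so the
full rate t^{-1} survives. -/
lemma exists_eLpNorm_six_of_pos : ∃ C : ℝ≥0, ∀ t : ℝ, 0 < t → ∀ v : L2, MemJ t v →
    eLpNorm v 6 volume ≤ C * ENNReal.ofReal (t ^ (-1 : ℝ)) * normJ t v := by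
  obtain ⟨φ, hφ⟩ := exists_isCutoff
  obtain ⟨M₁, hM₁⟩ := exists_ampl_uAmp
  obtain ⟨M₂, hM₂⟩ := exists_ampl_div_bracket
  obtain ⟨C₁, h₁⟩ := exists_lorentzNorm_lpProj hφ
  obtain ⟨C₂, h₂⟩ := exists_lorentzNorm_high hφ ⟨_, hM₁.mul hM₂⟩
  have k1 := geom_const_ne_top (a := 1 / 3) (by norm_num)
  refine ⟨2 * C₁ * (1 - twoPow (-(1 / 3)))⁻¹.toNNReal + 2 * C₂, fun t ht v hv => ?_⟩
  have hinj : Function.Injective fun j : ℕ => -(j : ℤ) := fun a b h => by simpa using h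
  have hsum : ∑' j : ℕ, ENNReal.ofReal ((2 : ℝ) ^ j)⁻¹ ^ (1 / 3 : ℝ) ≤
      (1 - twoPow (-(1 / 3)))⁻¹ := by
    calc _ ≤ ∑' j : ℕ, (fun K : ℤ => if (2 : ℝ) ^ K ≤ 1 then twoPow (1 / 3 * K) else 0)
          (-(j : ℤ)) := by
          refine ENNReal.tsum_le_tsum fun j => ?_
          rw [ofReal_inv_two_pow_rpow]
          refine le_of_eq (if_pos ?_).symm
          rw [zpow_neg, zpow_natCast]
          exact inv_le_one_of_one_le₀ (one_le_pow₀ one_le_two)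
      _ ≤ _ := ENNReal.tsum_comp_le_tsum_of_injective hinj _
      _ ≤ _ := tsum_twoPow_le (by norm_num) one_pos
      _ = _ := by simp
  have hone : mult (fun _ => 1) v = v := mult_one (fun _ => rfl) v
  rw [← hone]
  refine (eLpNorm_six_mult_le_of_dyadic hφ measurable_const
    (multDom_of_bounded measurable_const (c := 1) (by simp) v)
    (D := fun j => 2 * C₁ * normJ t v * ENNReal.ofReal t ^ (-1 : ℝ) *
      ENNReal.ofReal ((2 : ℝ) ^ j)⁻¹ ^ (1 / 3 : ℝ))
    (E := 2 * (C₂ * ENNReal.ofReal t ^ (-1 : ℝ) * normJ t v)) (fun j => ?_) fun K => ?_).trans ?_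
  · refine (eLpNorm_six_le_lorentzNorm _ (Lp.aestronglyMeasurable _)).trans ?_
    simp only [one_mul]
    refine (mul_le_mul' le_rfl (h₁ t ht v hv ((2 : ℝ) ^ j)⁻¹ (by positivity)
      (inv_le_one_of_one_le₀ (one_le_pow₀ one_le_two)))).trans (le_of_eq ?_)
    ring
  · refine (eLpNorm_six_le_lorentzNorm _ (Lp.aestronglyMeasurable _)).trans
      (mul_le_mul' le_rfl (le_trans (le_of_eq ?_)
        (h₂ t ht v hv (2 ^ K) (one_le_pow₀ one_le_two))))
    congr 4
    funext ξ
    rw [radSymbol_uAmp_mul_div (fun r => (profile φ (r / 2 ^ K) - profile φ r) * ramp r),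
      hφ.high_eq (one_le_pow₀ one_le_two), one_mul]
    rintro h
    rw [h, ramp_of_nonpos le_rfl, mul_zero]
  · rw [ENNReal.tsum_mul_left, ← ENNReal.ofReal_rpow_of_pos ht, hone]
    refine (add_le_add_left (mul_le_mul' le_rfl hsum) _).trans (le_of_eq ?_)
    push_cast
    rw [ENNReal.coe_toNNReal k1]
    ring

/-! ### Bounds without decay -/

lemma le_bracket (ξ : R3) : ‖ξ‖ ≤ bracket ξ := Real.le_sqrt_of_sq_le (by linarith)

lemma one_le_bracket (ξ : R3) : 1 ≤ bracket ξ :=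
  Real.le_sqrt_of_sq_le (by nlinarith [sq_nonneg ‖ξ‖])

lemma bracket_le (ξ : R3) : bracket ξ ≤ 2 + ‖ξ‖ :=
  Real.sqrt_le_iff.2 ⟨by positivity, by nlinarith [norm_nonneg ξ]⟩

lemma norm_japSymbol (ξ : R3) : ‖japSymbol ξ‖ = bracket ξ := by
  have : 0 ≤ bracket ξ := Real.sqrt_nonneg _
  rw [japSymbol, Complex.norm_real, Real.norm_of_nonneg this]

lemma norm_uInvSymbol (ξ : R3) : ‖uInvSymbol ξ‖ = bracket ξ / ‖ξ‖ := by
  have : 0 ≤ bracket ξ := Real.sqrt_nonneg _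
  rw [uInvSymbol, Complex.norm_real, inv_div, Real.norm_of_nonneg (by positivity)]

/-- The Sobolev embedding, with a multiplier. -/
lemma exists_eLpNorm_six_mult_le : ∃ C : ℝ≥0, ∀ (m : R3 → ℂ) (v : L2), MultDom m v →
    (∀ ξ, ‖ξ‖ * ‖m ξ‖ ≤ ‖japSymbol ξ‖) → MultDom japSymbol v →
    eLpNorm (mult m v) 6 volume ≤ C * eLpNorm (mult japSymbol v) 2 volume := by
  obtain ⟨C, h⟩ := exists_lorentzNorm_le
  refine ⟨2 * C, fun m v hm hle hv => ?_⟩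
  -- The interpolation theorem is applied to the inverse Fourier transform acting on the transform
  -- of `mult m v`: the weight is now the frequency, and |ξ||m| is bounded by the symbol of ⟨∇⟩.
  have h1 := h _ 1 1 one_ne_zero one_ne_zero dispersive_fourierInv (𝓕 (mult m v))
  simp only [FourierTransform.fourierInv_fourier_eq, NNReal.one_rpow, mul_one, ENNReal.coe_one] at h1
  refine (eLpNorm_six_le_lorentzNorm _ (Lp.aestronglyMeasurable _)).trans ?_
  push_cast
  rw [mul_assoc]
  refine mul_le_mul' le_rfl (h1.trans (mul_le_mul' le_rfl ?_))
  have h2 : weightMass (𝓕 (mult m v) : L2) ≤ eLpNorm (mult japSymbol v) 2 volume ^ 2 := by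
    rw [eLpNorm_mult hv, ← lintegral_sq_eq_eLpNorm, weightMass]
    refine lintegral_mono_ae ?_
    filter_upwards [fourier_mult hm] with ξ hξ
    rw [hξ, ← mul_pow]
    refine pow_le_pow_left' ?_ 2
    rw [enorm_mul, enorm_mul, ← mul_assoc]
    refine mul_le_mul_left ?_ _
    rw [← ofReal_norm, ← ofReal_norm, ← ofReal_norm, ← ENNReal.ofReal_mul (norm_nonneg _)]
    refine ENNReal.ofReal_le_ofReal (le_trans ?_ (hle _))
    refine mul_le_mul_of_nonneg_right ?_ (norm_nonneg _)
    rw [norm_smul, Real.norm_of_nonneg (by positivity)]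
    exact le_mul_of_one_le_left (norm_nonneg _) (by linarith [Real.pi_gt_three])
  calc _ ≤ (eLpNorm (mult japSymbol v) 2 volume ^ 2) ^ (1 / 2 : ℝ) :=
        ENNReal.rpow_le_rpow h2 (by norm_num)
    _ = _ := ENNReal_sq_rpow_half _

/-- The Hardy inequality controls `U⁻¹ v` in `L²`. -/
lemma exists_eLpNorm_uInv_le : ∃ C : ℝ≥0, ∀ (t : ℝ) (v : L2), MemJ t v →
    MultDom uInvSymbol v ∧
      eLpNorm (mult uInvSymbol v) 2 volume ≤ C * (eLpNorm v 2 volume + normJ t v) := by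
  obtain ⟨C, h⟩ := exists_hardy
  refine ⟨1 + C ^ (1 / 2 : ℝ), fun t v hv => ?_⟩
  let k (ξ : R3) : ℝ := ‖ξ‖⁻¹ * ‖(𝓕 v : L2) ξ‖
  have hk : eLpNorm k 2 volume ≤ (C ^ (1 / 2 : ℝ) : ℝ≥0) * normJ t v := by
    have h1 : eLpNorm k 2 volume ^ 2 ≤ C * normJ t v ^ 2 := by
      rw [← weightMass_prop hv, ← lintegral_sq_eq_eLpNorm]
      -- The propagator does not change the modulus of the Fourier transform, so Hardy's inequality
      -- for e^{itH}v bounds |ξ|⁻¹v̂ by ‖J(t)v‖.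
      refine le_trans (le_of_eq (lintegral_congr_ae ?_)) (h _ dispersive_fourier (prop t v))
      filter_upwards [fourier_mult (multDom_propSymbol t v), ae_ne_zero] with ξ h1 h2
      rw [prop, h1, enorm_mul, enorm_mul, enorm_norm, enorm_inv (norm_ne_zero_iff.2 h2), enorm_norm,
        ← ofReal_norm (propSymbol t _), norm_propSymbol, ENNReal.ofReal_one, one_mul]
    rw [← ENNReal_sq_rpow_half (eLpNorm k 2 volume)]
    refine (ENNReal.rpow_le_rpow h1 (by norm_num)).trans (le_of_eq ?_)
    rw [ENNReal.mul_rpow_of_nonneg _ _ (by norm_num), ENNReal_sq_rpow_half,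
      ENNReal.coe_rpow_of_nonneg _ (by norm_num)]
  have hkm : AEStronglyMeasurable k :=
    (Measurable.aestronglyMeasurable (by fun_prop)).mul (Lp.aestronglyMeasurable _).norm
  have hle : eLpNorm (fun ξ : R3 => uInvSymbol ((2 * Real.pi) • ξ) * (𝓕 v : L2) ξ) 2 volume ≤
      (1 + C ^ (1 / 2 : ℝ) : ℝ≥0) * (eLpNorm v 2 volume + normJ t v) := by
    calc _ ≤ eLpNorm ((fun ξ => ‖(𝓕 v : L2) ξ‖) + k) 2 volume := by
          -- For η = 2πξ ≠ 0 one has ⟨η⟩/|η| ≤ 1 + |ξ|⁻¹, because ⟨η⟩ ≤ 2 + |η| and 2 ≤ 2π.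
          refine eLpNorm_mono_real fun ξ => ?_
          rw [norm_mul, norm_uInvSymbol, Pi.add_apply, ← one_add_mul]
          refine mul_le_mul_of_nonneg_right ?_ (norm_nonneg _)
          rcases eq_or_ne ξ 0 with rfl | hξ
          · simp
          have hξ0 : 0 < ‖ξ‖ := norm_pos_iff.2 hξ
          have h2 : ‖(2 * Real.pi) • ξ‖ = 2 * Real.pi * ‖ξ‖ := by
            rw [norm_smul, Real.norm_of_nonneg (by positivity)]
          have h3 := bracket_le ((2 * Real.pi) • ξ)
          rw [h2] at h3 ⊢
          rw [div_le_iff₀ (by positivity)]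
          have : (1 + ‖ξ‖⁻¹) * (2 * Real.pi * ‖ξ‖) = 2 * Real.pi * ‖ξ‖ + 2 * Real.pi := by
            field_simp
          rw [this]
          linarith [Real.pi_gt_three]
      _ ≤ eLpNorm (fun ξ => ‖(𝓕 v : L2) ξ‖) 2 volume + eLpNorm k 2 volume :=
          eLpNorm_add_le (Lp.aestronglyMeasurable _).norm hkm (by norm_num)
      _ ≤ eLpNorm v 2 volume + (C ^ (1 / 2 : ℝ) : ℝ≥0) * normJ t v := by
          rw [eLpNorm_norm, eLpNorm_fourier]
          exact add_le_add le_rfl hk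
      _ ≤ _ := by
          push_cast
          rw [mul_add]
          exact add_le_add (le_mul_of_one_le_left' le_self_add) (mul_le_mul_left le_add_self _)
  have hd : MultDom uInvSymbol v := by
    refine ⟨aestronglyMeasurable_symbol measurable_uInvSymbol v, hle.trans_lt ?_⟩
    exact ENNReal.mul_lt_top ENNReal.coe_lt_top
      (ENNReal.add_lt_top.2 ⟨Lp.eLpNorm_lt_top v, (normJ_ne_top hv).lt_top⟩)
  exact ⟨hd, (eLpNorm_mult hd).trans_le hle⟩

/-! ### Decay of the energy norm -/

/-- Used with y = 1 when t ≤ 1 and y = t when t ≥ 1; in both cases ⟨t⟩ ≤ 2y, and 2^a ≤ 2. -/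
lemma two_rpow_le_bracket_rpow {t a : ℝ} (h0 : 0 ≤ a) (h1 : a ≤ 1) {y : ℝ} (hy : 0 < y)
    (hb : bracket t ≤ 2 * y) : y ^ (-a) ≤ 2 * bracket t ^ (-a) := by
  have hb0 : 0 < bracket t := Real.sqrt_pos.2 (by positivity)
  calc y ^ (-a) = 2 ^ a * (2 * y) ^ (-a) := by
        rw [Real.mul_rpow zero_le_two hy.le, ← mul_assoc, ← Real.rpow_add two_pos]; simp
    _ ≤ 2 ^ (1 : ℝ) * bracket t ^ (-a) := by
        refine mul_le_mul (Real.rpow_le_rpow_of_exponent_le one_le_two h1)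
          (Real.rpow_le_rpow_of_nonpos hb0 hb (by linarith)) (by positivity) (by positivity)
    _ = _ := by rw [Real.rpow_one]

lemma bracket_le_two {t : ℝ} (h0 : 0 ≤ t) (h1 : t ≤ 1) : bracket t ≤ 2 * 1 := by
  rw [bracket, Real.norm_of_nonneg h0, Real.sqrt_le_left (by norm_num)]
  nlinarith

lemma bracket_le_two_mul {t : ℝ} (h1 : 1 ≤ t) : bracket t ≤ 2 * t := by
  rw [bracket, Real.norm_of_nonneg (by linarith), Real.sqrt_le_left (by linarith)]
  nlinarith

lemma eLpNorm_le_eLpNorm_japSymbol {v : L2} (hv : MultDom japSymbol v) :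
    eLpNorm v 2 volume ≤ eLpNorm (mult japSymbol v) 2 volume := by
  have h := eLpNorm_mult_le (m := fun _ => 1) (c := 1) measurable_const
    (fun ξ => by rw [norm_japSymbol]; simpa using one_le_bracket ξ) hv
  rwa [mult_one (fun _ => rfl), ENNReal.coe_one, one_mul] at h

/-- Combination of a bound for bounded times and a decay bound for large times. -/
lemma le_bracket_rpow_mul {t a : ℝ} (ht : 0 ≤ t) (h0 : 0 ≤ a) (h1 : a ≤ 1) {L X : ℝ≥0∞} {A B : ℝ≥0}
    (hA : L ≤ A * X) (hB : 1 ≤ t → L ≤ B * ENNReal.ofReal (t ^ (-a)) * X) :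
    L ≤ (2 * (A + B) : ℝ≥0) * ENNReal.ofReal (bracket t ^ (-a)) * X := by
  have key {y : ℝ} (hy : 0 < y) (hb : bracket t ≤ 2 * y) (c : ℝ≥0) (hc : c ≤ A + B)
      (h : L ≤ c * ENNReal.ofReal (y ^ (-a)) * X) :
      L ≤ (2 * (A + B) : ℝ≥0) * ENNReal.ofReal (bracket t ^ (-a)) * X := by
    refine h.trans (mul_le_mul_left ?_ _)
    calc (c : ℝ≥0∞) * ENNReal.ofReal (y ^ (-a)) ≤
          (A + B : ℝ≥0) * ENNReal.ofReal (2 * bracket t ^ (-a)) :=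
          mul_le_mul' (ENNReal.coe_le_coe.2 hc)
            (ENNReal.ofReal_le_ofReal (two_rpow_le_bracket_rpow h0 h1 hy hb))
      _ = _ := by
          rw [ENNReal.ofReal_mul zero_le_two, ENNReal.ofReal_ofNat]
          push_cast
          ring
  rcases le_total t 1 with h | h
  · exact key one_pos (bracket_le_two ht h) A le_self_add (by simpa using hA)
  · exact key (by linarith) (bracket_le_two_mul h) B le_add_self (hB h)

theorem exists_eLpNorm_six_le : ∃ C : ℝ≥0, ∀ t : ℝ, 0 ≤ t → ∀ v : L2, MemX t v →
    eLpNorm v 6 volume ≤ C * ENNReal.ofReal (bracket t ^ (-1 : ℝ)) * normX t v := by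
  obtain ⟨A, hA⟩ := exists_eLpNorm_six_mult_le
  obtain ⟨B, hB⟩ := exists_eLpNorm_six_of_pos
  refine ⟨2 * (A + B), fun t ht v hv => le_bracket_rpow_mul ht zero_le_one le_rfl ?_ fun h => ?_⟩
  · have := hA (fun _ => 1) v (multDom_of_bounded measurable_const (c := 1) (by simp) v)
      (fun ξ => by rw [norm_japSymbol]; simpa using le_bracket ξ) hv.1
    rw [mult_one (fun _ => rfl)] at this
    exact this.trans (mul_le_mul' le_rfl (le_self_add.trans le_self_add))
  · exact (hB t (by linarith) v hv.2.1).trans (mul_le_mul' le_rfl (le_add_self.trans le_self_add))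

theorem exists_eLpNorm_six_uInv_le : ∃ C : ℝ≥0, ∀ t : ℝ, 0 ≤ t → ∀ v : L2, MemX t v →
    MultDom uInvSymbol v ∧ eLpNorm (mult uInvSymbol v) 6 volume ≤
      C * ENNReal.ofReal (bracket t ^ (-(7 / 9) : ℝ)) * normX t v := by
  obtain ⟨A, hA⟩ := exists_eLpNorm_six_mult_le
  obtain ⟨B, hB⟩ := exists_eLpNorm_six_uInv_of_pos
  obtain ⟨C, hd⟩ := exists_eLpNorm_uInv_le
  refine ⟨2 * (A + B * 2), fun t ht v hv => ?_⟩
  have hdom := (hd t v hv.2.1).1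
  refine ⟨hdom, le_bracket_rpow_mul ht (by norm_num) (by norm_num) ?_ fun h => ?_⟩
  · have := hA uInvSymbol v hdom (fun ξ => ?_) hv.1
    · exact this.trans (mul_le_mul' le_rfl (le_self_add.trans le_self_add))
    · rw [norm_japSymbol, norm_uInvSymbol]
      rcases eq_or_ne ξ 0 with rfl | hξ
      · rw [norm_zero, zero_mul]; exact Real.sqrt_nonneg _
      · exact (mul_div_cancel₀ _ (norm_ne_zero_iff.2 hξ)).le
  · refine (hB t (by linarith) v hv.2.1 hdom).trans
      (mul_le_mul' ?_ (le_add_self.trans le_self_add))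
    push_cast
    rw [mul_assoc, two_mul]
    refine mul_le_mul' le_rfl (add_le_add le_rfl (ENNReal.ofReal_le_ofReal ?_))
    -- For t ≥ 1 the high-frequency rate t^{-1} is below t^{-7/9}, which accounts for the factor 2
    -- next to B.
    exact Real.rpow_le_rpow_of_exponent_le h (by norm_num)

/-- Interpolation between `L²` and `L⁶`. -/
lemma eLpNorm_le_rpow_mul_rpow {f : R3 → ℂ} (hf : AEStronglyMeasurable f) {r : ℝ} (h2 : 2 ≤ r)
    (h6 : r ≤ 6) : eLpNorm f (ENNReal.ofReal r) volume ≤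
      eLpNorm f 2 volume ^ (1 - (3 / 2 - 3 / r)) * eLpNorm f 6 volume ^ (3 / 2 - 3 / r) := by
  have hr0 : 0 < r := by linarith
  rw [eLpNorm_eq_lintegral_rpow_enorm_toReal (by simpa using hr0) ENNReal.ofReal_ne_top,
    eLpNorm_eq_lintegral_rpow_enorm_toReal (p := 2) (by norm_num) (by norm_num),
    eLpNorm_eq_lintegral_rpow_enorm_toReal (p := 6) (by norm_num) (by norm_num),
    ENNReal.toReal_ofReal hr0.le, ENNReal.toReal_ofNat, ENNReal.toReal_ofNat]
  -- The weights solve r = 2 · (6 - r)/4 + 6 · (r - 2)/4 and add up to 1.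
  have h := ENNReal.lintegral_mul_norm_pow_le (μ := volume) (hf.enorm.pow_const (2 : ℝ))
    (hf.enorm.pow_const (6 : ℝ)) (p := (6 - r) / 4) (q := (r - 2) / 4) (by linarith) (by linarith)
    (by ring)
  have e (x : R3) : (‖f x‖ₑ ^ (2 : ℝ)) ^ ((6 - r) / 4) * (‖f x‖ₑ ^ (6 : ℝ)) ^ ((r - 2) / 4) =
      ‖f x‖ₑ ^ r := by
    rw [← ENNReal.rpow_mul, ← ENNReal.rpow_mul, ← ENNReal.rpow_add_of_nonneg _ _ (by linarith)
      (by linarith)]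
    congr 1
    ring
  simp only [e] at h
  refine (ENNReal.rpow_le_rpow h (by positivity : 0 ≤ 1 / r)).trans (le_of_eq ?_)
  rw [ENNReal.mul_rpow_of_nonneg _ _ (by positivity), ← ENNReal.rpow_mul, ← ENNReal.rpow_mul,
    ← ENNReal.rpow_mul, ← ENNReal.rpow_mul]
  congr 2
  · field_simp; ring
  · field_simp; ring

/-- Interpolation of a bound in `L²` with a decay bound in `L⁶`. -/
lemma eLpNorm_le_of_two_of_six {f : R3 → ℂ} (hf : AEStronglyMeasurable f) {A B : ℝ≥0} {b a : ℝ}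
    (hb : 0 < b) {X : ℝ≥0∞} (hA : eLpNorm f 2 volume ≤ A * X)
    (hB : eLpNorm f 6 volume ≤ B * ENNReal.ofReal (b ^ a) * X) {r : ℝ} (h2 : 2 ≤ r) (h6 : r ≤ 6) :
    eLpNorm f (ENNReal.ofReal r) volume ≤
      (A + B : ℝ≥0) * ENNReal.ofReal (b ^ (a * (3 / 2 - 3 / r))) * X := by
  have hr0 : 0 < r := by linarith
  have p0 : 0 ≤ 3 / 2 - 3 / r := by
    rw [sub_nonneg, div_le_div_iff₀ hr0 two_pos]; linarith
  have p1 : 0 ≤ 1 - (3 / 2 - 3 / r) := by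
    have : 1 / 2 ≤ 3 / r := by rw [div_le_div_iff₀ two_pos hr0]; linarith
    linarith
  refine (eLpNorm_le_rpow_mul_rpow hf h2 h6).trans ?_
  set θ := 3 / 2 - 3 / r
  have hA' : eLpNorm f 2 volume ≤ (A + B : ℝ≥0) * X :=
    hA.trans (mul_le_mul_left (ENNReal.coe_le_coe.2 le_self_add) _)
  have hB' : eLpNorm f 6 volume ≤ (A + B : ℝ≥0) * X * ENNReal.ofReal (b ^ a) := by
    refine hB.trans ?_
    rw [mul_right_comm]
    exact mul_le_mul_left (mul_le_mul_left (ENNReal.coe_le_coe.2 le_add_self) _) _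
  calc _ ≤ ((A + B : ℝ≥0) * X) ^ (1 - θ) * ((A + B : ℝ≥0) * X * ENNReal.ofReal (b ^ a)) ^ θ :=
        mul_le_mul' (ENNReal.rpow_le_rpow hA' p1) (ENNReal.rpow_le_rpow hB' p0)
    _ = (A + B : ℝ≥0) * X * ENNReal.ofReal (b ^ (a * θ)) := by
        rw [ENNReal.mul_rpow_of_nonneg _ (ENNReal.ofReal _) p0, ← mul_assoc,
          ← ENNReal.rpow_add_of_nonneg _ _ p1 p0, sub_add_cancel, ENNReal.rpow_one,
          ENNReal.ofReal_rpow_of_pos (by positivity), ← Real.rpow_mul hb.le]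
    _ = _ := by ring

theorem exists_eLpNorm_le : ∃ C : ℝ≥0, ∀ t : ℝ, 0 ≤ t → ∀ v : L2, MemX t v →
    ∀ r : ℝ, 2 ≤ r → r ≤ 6 →
      eLpNorm v (ENNReal.ofReal r) volume
        ≤ C * ENNReal.ofReal (bracket t ^ (-(3 / 2 - 3 / r))) * normX t v ∧
      eLpNorm (mult uInvSymbol v) (ENNReal.ofReal r) volume
        ≤ C * ENNReal.ofReal (bracket t ^ (-(7 / 9) * (3 / 2 - 3 / r))) * normX t v := by
  obtain ⟨B, hB⟩ := exists_eLpNorm_six_le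
  obtain ⟨B', hB'⟩ := exists_eLpNorm_six_uInv_le
  obtain ⟨A, hA⟩ := exists_eLpNorm_uInv_le
  refine ⟨1 + B + (A + B'), fun t ht v hv r h2 h6 => ?_⟩
  have hb : 0 < bracket t := Real.sqrt_pos.2 (by positivity)
  have hv2 : eLpNorm v 2 volume ≤ eLpNorm (mult japSymbol v) 2 volume :=
    eLpNorm_le_eLpNorm_japSymbol hv.1
  constructor
  · have := eLpNorm_le_of_two_of_six (Lp.aestronglyMeasurable v) (A := 1) hb
      (by rw [ENNReal.coe_one, one_mul]; exact hv2.trans (le_self_add.trans le_self_add))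
      (hB t ht v hv) h2 h6
    rw [neg_one_mul] at this
    exact this.trans (mul_le_mul_left (mul_le_mul_left (ENNReal.coe_le_coe.2 le_self_add) _) _)
  · have := eLpNorm_le_of_two_of_six (Lp.aestronglyMeasurable (mult uInvSymbol v)) hb
      ((hA t v hv.2.1).2.trans (mul_le_mul' le_rfl ((add_le_add_left hv2 _).trans le_self_add)))
      (hB' t ht v hv).2 h2 h6
    exact this.trans (mul_le_mul_left (mul_le_mul_left (ENNReal.coe_le_coe.2 le_add_self) _) _)

end Decay

end

theorem lemma3p2 :
    -- (i)
    (∃ C : ℝ≥0, ∀ t : ℝ, 0 ≤ t → ∀ v : Decay.L2, Decay.MemX t v →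
      eLpNorm v 6 volume
        ≤ C * ENNReal.ofReal (Decay.bracket t ^ (-1 : ℝ)) * Decay.normX t v) ∧
    -- (ii), frequency-localized bound, for dyadic `N = 2 ^ k` with `0 < N ≤ 1`
    (∀ φ : Decay.R3 → ℝ, Decay.IsCutoff φ →
      ∃ C : ℝ≥0, ∀ t : ℝ, 0 ≤ t → ∀ v : Decay.L2, Decay.MemJ t v →
        ∀ (k : ℤ) (N : ℝ), N = (2 : ℝ) ^ k → N ≤ 1 →
          Decay.MultDom Decay.uInvSymbol (Decay.lpProj φ N v) ∧
          Decay.lorentzNorm 6 2 (Decay.mult Decay.uInvSymbol (Decay.lpProj φ N v))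
            ≤ C * min (ENNReal.ofReal N)
                (min (ENNReal.ofReal N ^ (1 / 3 : ℝ) * ENNReal.ofReal t ^ (-(2 / 3) : ℝ))
                  (ENNReal.ofReal N ^ (-(2 / 3) : ℝ) * ENNReal.ofReal t ^ (-1 : ℝ)))
              * Decay.normJ t v) ∧
    -- (ii), consequence
    (∃ C : ℝ≥0, ∀ t : ℝ, 0 ≤ t → ∀ v : Decay.L2, Decay.MemX t v →
      Decay.MultDom Decay.uInvSymbol v ∧
      eLpNorm (Decay.mult Decay.uInvSymbol v) 6 volume
        ≤ C * ENNReal.ofReal (Decay.bracket t ^ (-(7 / 9) : ℝ)) * Decay.normX t v) ∧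
    -- (iii)
    (∃ C : ℝ≥0, ∀ t : ℝ, 0 ≤ t → ∀ v : Decay.L2, Decay.MemX t v →
      ∀ r : ℝ, 2 ≤ r → r ≤ 6 →
        eLpNorm v (ENNReal.ofReal r) volume
          ≤ C * ENNReal.ofReal (Decay.bracket t ^ (-(3 / 2 - 3 / r))) * Decay.normX t v ∧
        eLpNorm (Decay.mult Decay.uInvSymbol v) (ENNReal.ofReal r) volume
          ≤ C * ENNReal.ofReal (Decay.bracket t ^ (-(7 / 9) * (3 / 2 - 3 / r)))
              * Decay.normX t v) := by
  refine ⟨Decay.exists_eLpNorm_six_le, fun φ hφ => ?_, Decay.exists_eLpNorm_six_uInv_le,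
    Decay.exists_eLpNorm_le⟩
  obtain ⟨C, h⟩ := Decay.exists_lorentzNorm_uInv_lpProj hφ
  obtain ⟨c, hc⟩ := Decay.exists_norm_lpSymbol_le hφ
  refine ⟨C, fun t ht v hv k N hN hN1 => ?_⟩
  have hN0 : 0 < N := by rw [hN]; positivity
  obtain ⟨h1, h2⟩ := h t ht v hv N hN0 hN1
  -- The bound was proved for the product symbol. As the cutoff is bounded and the product has v in
  -- its domain, the composition U⁻¹P_N is defined on v and agrees with it.
  obtain ⟨h3, h4⟩ := Decay.mult_mult (Decay.multDom_of_bounded (Decay.measurable_lpSymbol hφ N)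
    (hc N) v) h1 fun ξ => rfl
  rw [Decay.lpProj, h4]
  exact ⟨h3, h2⟩
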